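/- **Setting.** Let $V$ be a vertex operator algebra ($\mathbb Z$-graded by $L(0)$-eigenvalues, with finite-dimensional homogeneous subspaces that vanish in sufficiently low degree), with vacuum $\mathbf 1$ and conformal vector $\omega$, and let $z\in\mathbb C\setminus\{0\}$. A *weak $V$-module* is a complex vector space $M$ with a linear map $Y(\cdot,x)\colon V\to \mathrm{Hom}(M,M((x)))$ satisfying $Y(\mathbf 1,x)=1$ and the Jacobi identity; it is a *generalized $V$-module* if it is the direct sum of its $L(0)$-eigenspaces $M_{(h)}$, $h\in\mathbb C$, and a *$V$-module* if moreover each $M_{(h)}$ is finite-dimensional and $M_{(h)}=0$ whenever the real part of $h$ is sufficiently small. The same notions are used for the tensor product vertex operator algebra $V\otimes V$ (with conformal vector $\omega\otimes\mathbf 1+\mathbf 1\otimes\omega$). Morphisms are the linear maps that commute with the vertex operators. For $V$-modules $W_1,W_2$, the vector space $W_1\otimes W_2$ carries the vertex operators $Y(u\otimes v,x)=Y(u,x)\otimes Y(v,x)$ of $V\otimes V$. For a linear map $G(\cdot,x)\colon V\to X[[x,x^{-1}]]$ put $G^o(v,x)=G(e^{xL(1)}(-x^{-2})^{L(0)}v,x^{-1})$.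 The contragredient module of a $V$-module $W$ is $W'=\coprod_h W_{(h)}^*$ with $\langle Y'(v,x)g,w\rangle=\langle g,Y^o(v,x)w\rangle$, and $\overline W=\prod_h W_{(h)}=(W')^*$ is the algebraic completion, with $\langle Y^o(v,x)t,g\rangle=\langle t,Y'(v,x)g\rangle$ for $t\in\overline W$, $g\in W'$. A morphism $f\colon W\to U$ has a contragredient $f'\colon U'\to W'$ and extends to $\overline f=(f')^*\colon\overline W\to\overline U$. **$Q(z)$-products.** Let $W_1,W_2$ be $V$-modules. With $\delta(x)=\sum_{n\in\mathbb Z}x^n$ (binomials being expanded in nonnegative powers of the second variable), a *$Q(z)$-product* of $W_1$ and $W_2$ is a pair $(W,F)$ of a $V$-module $W$ and a linear map $F\colon W_1\otimes W_2\to\overline W$ such that, for all $v\in V$, $w_1\in W_1$, $w_2\in W_2$, $$z^{-1}\delta\!\left(\tfrac{x_1-x_0}{z}\right)Y^o(v,x_0)F(w_1\otimes w_2)=x_0^{-1}\delta\!\left(\tfrac{x_1-z}{x_0}\right)F(Y^o(v,x_1)w_1\otimes w_2)-x_0^{-1}\delta\!\left(\tfrac{z-x_1}{-x_0}\right)F(w_1\otimes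 Y(v,x_1)w_2).$$ A morphism $(W,F)\to(U,G)$ of $Q(z)$-products is a morphism $\eta\colon W\to U$ with $G=\overline\eta\circ F$. A *(Huang–Lepowsky) $Q(z)$-tensor product* of $W_1$ and $W_2$ is a $Q(z)$-product from which there is exactly one morphism to every $Q(z)$-product of $W_1$ and $W_2$. **The functor $\mathcal F_{Q(z)}$.** For a weak $V$-module $M$ let $\mathcal D_{Q(z)}(M)$ be the space of all $\alpha\in M^*$ such that for every $v\in V$ and $m\in M$ the series $\langle\alpha,Y(v,x)m\rangle$ is the expansion at $x=0$ of a rational function in $\mathbb C[x,x^{-1},(x+z)^{-1}]$, whose orders of pole at $-z$ and at $\infty$ are, for each $v$, bounded independently of $m$. Write $\iota_{x;0}$ and $\iota_{x;\infty}$ for the expansions of rational functions at $x=0$ and $x=\infty$, and define operators $Y^L(v,x)$ and $Y^R(v,x)$ on $\mathcal D_{Q(z)}(M)$ by $$\langle (Y^L)^o(v,x)\alpha,m\rangle=\iota_{x;\infty}\Big(\big(\iota_{y;0}^{-1}\langle\alpha,Y(v,y)m\rangle\big)\big|_{y=x-z}\Big),\qquad \langle Y^R(v,x)\alpha,m\rangle=\iota_{x;0}\Big(\big(\iota_{y;0}^{-1}\langle\alpha,Y(v,y)m\rangle\big)\big|_{y=x-z}\Big),$$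 and $Y_{Q(z)}(u\otimes v,x)=Y^L(u,x)Y^R(v,x)$. Let $R_{Q(z)}(M)\subseteq\mathcal D_{Q(z)}(M)$ be the sum of all subspaces that are stable under $Y_{Q(z)}$, are $V\otimes V$-modules under it, and on which $L(0)\otimes1$ acts semisimply; it is a generalized $V\otimes V$-module. The functor $\mathcal F_{Q(z)}$ from the category of $V$-modules to the category of generalized $V\otimes V$-modules is given by $\mathcal F_{Q(z)}(W)=R_{Q(z)}(W')\subseteq\overline W$ on objects and by restricting $\overline f$ on morphisms $f$. **Proposition 4.7.** Let $W_1$ and $W_2$ be $V$-modules and let $(W,F)$ be a $Q(z)$-product of $W_1$ and $W_2$. Then $(W,F)$ is a $Q(z)$-tensor product of $W_1$ and $W_2$ if and only if $(W,F)$ is a universal arrow from $W_1\otimes W_2$ to the functor $\mathcal F_{Q(z)}$; that is, $W_1\otimes W_2$ is a generalized $V\otimes V$-module, $F$ is a morphism $W_1\otimes W_2\to\mathcal F_{Q(z)}(W)$, and for every $V$-module $U$ and every morphism $G\colon W_1\otimes W_2\to\mathcal F_{Q(z)}(U)$ there is exactly one morphism $\eta\colon W\to U$ with $G=\mathcal F_{Q(z)}(\eta)\circ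 F$. -/

import Mathlib

open scoped TensorProduct
open CategoryTheory

universe v w

namespace VOATheory

noncomputable section

variable {V : Type v} [AddCommGroup V] [Module ℂ V]
variable {M : Type w} [AddCommGroup M] [Module ℂ M]
variable {N : Type w} [AddCommGroup N] [Module ℂ N]

/-- `coef Y v n` is the coefficient of `x ^ n` in `Y(v, x)`. -/
def coef (Y : V →ₗ[ℂ] VertexOperator ℂ M) : V →ₗ[ℂ] (ℤ → Module.End ℂ M) :=
  HVertexOperator.coeff ∘ₗ Y

/-- The mode `v_n`, where `Y(v, x) = ∑ v_n x ^ (-n - 1)`. -/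
def mode (Y : V →ₗ[ℂ] VertexOperator ℂ M) (v : V) (n : ℤ) : Module.End ℂ M :=
  coef Y v (-n - 1)

/-- The data of a vertex operator algebra: the vertex operator map `Y(·, x)`, the vacuum `1` and the
conformal vector `ω`. The axioms are in `VOA`. A `VertexOperator ℂ V` is a linear map
`V → V((x))`, so lower truncation is built in. -/
structure VOAData (V : Type v) [AddCommGroup V] [Module ℂ V] where
  Y : V →ₗ[ℂ] VertexOperator ℂ V
  vac : V
  ω : V

/-- The Virasoro operator `L(n)` on a module, where `Y(ω, x) = ∑ L(n) x ^ (-n - 2)`. -/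
def Lop (𝒱 : VOAData V) (Y : V →ₗ[ℂ] VertexOperator ℂ M) (n : ℤ) : Module.End ℂ M :=
  mode Y 𝒱.ω (n + 1)

/-- The Jacobi identity
`x₀⁻¹ δ((x₁ - x₂) / x₀) Y(u, x₁) Y(v, x₂) - x₀⁻¹ δ((x₂ - x₁) / (-x₀)) Y(v, x₂) Y(u, x₁)`
`= x₂⁻¹ δ((x₁ - x₀) / x₂) Y(Y(u, x₀) v, x₂)`,
applied to `x` and compared coefficient by coefficient: the coefficient of
`x₀ ^ (-l - 1) x₁ ^ (-m - 1) x₂ ^ (-n - 1)`. All but finitely many terms of each sum vanish. -/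
def JacobiAt (𝒱 : VOAData V) (Y : V →ₗ[ℂ] VertexOperator ℂ M) (u v : V) (l m n : ℤ) (x : M) :
    Prop :=
  ∑ᶠ i : ℕ, Ring.choose m i • mode Y (mode 𝒱.Y u (l + i) v) (m + n - i) x =
    ∑ᶠ i : ℕ, ((-1) ^ i * Ring.choose l i) •
      (mode Y u (m + l - i) (mode Y v (n + i) x) -
        (l.negOnePow : ℤ) • mode Y v (n + l - i) (mode Y u (m + i) x))

/-- `(M, Y)` is a weak module: lower truncation (contained in the type of `Y`), the vacuum property
`Y(1, x) = id` and the Jacobi identity. -/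
structure IsWeakModule (𝒱 : VOAData V) (Y : V →ₗ[ℂ] VertexOperator ℂ M) : Prop where
  vacuum : ∀ n : ℤ, coef Y 𝒱.vac n = if n = 0 then 1 else 0
  jacobi : ∀ (u v : V) (l m n : ℤ) (x : M), JacobiAt 𝒱 Y u v l m n x

/-- A generalized module: a weak module that is the direct sum of the eigenspaces of `L(0)`. -/
structure IsGeneralized (𝒱 : VOAData V) (Y : V →ₗ[ℂ] VertexOperator ℂ M) : Prop where
  weak : IsWeakModule 𝒱 Y
  semisimple : ⨆ h : ℂ, (Lop 𝒱 Y 0).eigenspace h = ⊤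

/-- A module: a generalized module whose `L(0)`-eigenspaces are finite-dimensional and vanish for
eigenvalues of sufficiently small real part. -/
structure IsOrdinary (𝒱 : VOAData V) (Y : V →ₗ[ℂ] VertexOperator ℂ M) : Prop
    extends IsGeneralized 𝒱 Y where
  finite : ∀ h : ℂ, FiniteDimensional ℂ ((Lop 𝒱 Y 0).eigenspace h)
  bounded : ∃ r : ℝ, ∀ h : ℂ, h.re < r → (Lop 𝒱 Y 0).eigenspace h = ⊥

/-- A vertex operator algebra. The field `weak` says that `Y(1, x) = id` and that the Jacobi identity
holds on `V`; the remaining fields are the creation property `Y(v, x) 1 ∈ v + x V[[x]]`, the Virasoro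
relations, the `L(-1)`-derivative property `Y(L(-1) v, x) = d/dx Y(v, x)` and the grading conditions. -/
structure VOA (V : Type v) [AddCommGroup V] [Module ℂ V] extends VOAData V where
  weak : IsWeakModule toVOAData Y
  creation : ∀ (v : V) (n : ℤ), 0 ≤ n → mode Y v n vac = 0
  creation_neg_one : ∀ v : V, mode Y v (-1) vac = v
  virasoro : ∃ c : ℂ, ∀ m n : ℤ,
    Lop toVOAData Y m * Lop toVOAData Y n - Lop toVOAData Y n * Lop toVOAData Y m =
      ((m : ℂ) - n) • Lop toVOAData Y (m + n) +
        if m + n = 0 then (((m : ℂ) ^ 3 - m) / 12 * c) • 1 else 0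
  derivative : ∀ (v : V) (n : ℤ),
    coef Y (Lop toVOAData Y (-1) v) n = ((n : ℂ) + 1) • coef Y v (n + 1)
  grading : DirectSum.IsInternal fun n : ℤ => (Lop toVOAData Y 0).eigenspace (n : ℂ)
  finite : ∀ n : ℤ, FiniteDimensional ℂ ((Lop toVOAData Y 0).eigenspace (n : ℂ))
  bounded : ∃ n₀ : ℤ, ∀ n < n₀, (Lop toVOAData Y 0).eigenspace (n : ℂ) = ⊥

/-- The subspace `V_(n)` of vectors of weight `n`. -/
def VOA.wt (𝒱 : VOA V) (n : ℤ) : Submodule ℂ V := (Lop 𝒱.toVOAData 𝒱.Y 0).eigenspace (n : ℂ)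

theorem coef_trunc (Y : V →ₗ[ℂ] VertexOperator ℂ M) (v : V) (x : M) :
    ∃ n₀ : ℤ, ∀ n < n₀, coef Y v n x = 0 :=
  ⟨_, fun n h => VertexOperator.coeff_eq_zero_of_lt_order (Y v) n x h⟩

theorem mode_trunc (Y : V →ₗ[ℂ] VertexOperator ℂ M) (v : V) (x : M) :
    ∃ n₀ : ℤ, ∀ n, n₀ ≤ n → mode Y v n x = 0 := by
  obtain ⟨n₀, h⟩ := coef_trunc Y v x
  exact ⟨-n₀, fun n hn => h _ (by omega)⟩

/-- Constructor for the vertex operator map out of its coefficients. -/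
def ofCoef (f : V →ₗ[ℂ] (ℤ → Module.End ℂ M))
    (hf : ∀ v x, ∃ n₀ : ℤ, ∀ n < n₀, f v n x = 0) : V →ₗ[ℂ] VertexOperator ℂ M where
  toFun v := VertexOperator.of_coeff (f v) fun x => by
    obtain ⟨n₀, h⟩ := hf v x
    exact ⟨n₀, fun n hn => not_lt.1 fun hlt => hn (h n hlt)⟩
  map_add' u v := by
    apply HVertexOperator.coeff_inj
    refine Eq.trans ?_ (LinearMap.map_add HVertexOperator.coeff _ _).symm
    exact map_add f u v
  map_smul' c v := by
    apply HVertexOperator.coeff_inj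
    refine Eq.trans ?_ (LinearMap.map_smul HVertexOperator.coeff _ _).symm
    exact map_smul f c v

@[simp]
theorem coef_ofCoef (f : V →ₗ[ℂ] (ℤ → Module.End ℂ M))
    (hf : ∀ v x, ∃ n₀ : ℤ, ∀ n < n₀, f v n x = 0) : coef (ofCoef f hf) = f := rfl

theorem mode_add (Y : V →ₗ[ℂ] VertexOperator ℂ M) (u v : V) (n : ℤ) :
    mode Y (u + v) n = mode Y u n + mode Y v n := by simp [mode]

theorem mode_smul (Y : V →ₗ[ℂ] VertexOperator ℂ M) (c : ℂ) (v : V) (n : ℤ) :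
    mode Y (c • v) n = c • mode Y v n := by simp [mode]

theorem finite_of_eventually {X : Type*} [Zero X] (f : ℕ → X) (n₀ : ℤ)
    (h : ∀ i : ℕ, n₀ ≤ i → f i = 0) : f.HasFiniteSupport := by
  refine (Set.finite_lt_nat n₀.toNat).subset fun i hi => ?_
  by_contra hlt
  exact hi (h i (by simp at hlt; omega))

theorem jacobi_fin_left (𝒱 : VOAData V) (Y : V →ₗ[ℂ] VertexOperator ℂ M) (u v : V) (l m n : ℤ)
    (x : M) : Function.HasFiniteSupport (fun i : ℕ =>
      Ring.choose m i • mode Y (mode 𝒱.Y u (l + i) v) (m + n - i) x) := by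
  obtain ⟨n₀, h⟩ := mode_trunc 𝒱.Y u v
  refine finite_of_eventually _ (n₀ - l) fun i hi => ?_
  rw [h _ (by omega)]
  simp [mode]

theorem jacobi_fin_right (Y : V →ₗ[ℂ] VertexOperator ℂ M) (u v : V) (l m n : ℤ)
    (x : M) : Function.HasFiniteSupport (fun i : ℕ => ((-1) ^ i * Ring.choose l i) •
      (mode Y u (m + l - i) (mode Y v (n + i) x) -
        (l.negOnePow : ℤ) • mode Y v (n + l - i) (mode Y u (m + i) x))) := by
  obtain ⟨n₀, h⟩ := mode_trunc Y v x
  obtain ⟨m₀, h'⟩ := mode_trunc Y u x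
  refine finite_of_eventually _ (max (n₀ - n) (m₀ - m)) fun i hi => ?_
  rw [h _ (by have := le_max_left (n₀ - n) (m₀ - m); omega),
    h' _ (by have := le_max_right (n₀ - n) (m₀ - m); omega)]
  simp

theorem JacobiAt.add {𝒱 : VOAData V} {Y : V →ₗ[ℂ] VertexOperator ℂ M} {u v : V} {l m n : ℤ}
    {x y : M} (hx : JacobiAt 𝒱 Y u v l m n x) (hy : JacobiAt 𝒱 Y u v l m n y) :
    JacobiAt 𝒱 Y u v l m n (x + y) := by
  unfold JacobiAt at *
  have e₁ := finsum_add_distrib (jacobi_fin_left 𝒱 Y u v l m n x) (jacobi_fin_left 𝒱 Y u v l m n y)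
  have e₂ := finsum_add_distrib (jacobi_fin_right Y u v l m n x) (jacobi_fin_right Y u v l m n y)
  rw [← hx, ← hy, ← e₁] at e₂
  convert e₂.symm using 3 with i i
  · simp
  · rw [← smul_add]
    simp only [map_add]
    rw [smul_add (l.negOnePow : ℤ)]
    congr 1
    abel

/-- A linear map between two modules that commutes with the vertex operators. -/
def Intertwines {N : Type*} [AddCommGroup N] [Module ℂ N] (Y : V →ₗ[ℂ] VertexOperator ℂ M)
    (Y' : V →ₗ[ℂ] VertexOperator ℂ N) (f : M →ₗ[ℂ] N) : Prop :=
  ∀ (v : V) (n : ℤ) (x : M), f (coef Y v n x) = coef Y' v n (f x)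

theorem Intertwines.mode {Y : V →ₗ[ℂ] VertexOperator ℂ M} {Y' : V →ₗ[ℂ] VertexOperator ℂ N}
    {f : M →ₗ[ℂ] N} (hf : Intertwines Y Y' f) (v : V) (n : ℤ) (x : M) :
    f (mode Y v n x) = VOATheory.mode Y' v n (f x) := hf _ _ _

theorem Intertwines.jacobiAt {𝒱 : VOAData V} {Y : V →ₗ[ℂ] VertexOperator ℂ M}
    {Y' : V →ₗ[ℂ] VertexOperator ℂ N} {f : M →ₗ[ℂ] N} (hf : Intertwines Y Y' f) {u v : V}
    {l m n : ℤ} {x : M} (hx : JacobiAt 𝒱 Y u v l m n x) : JacobiAt 𝒱 Y' u v l m n (f x) := by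
  have e₁ := f.toAddMonoidHom.map_finsum (jacobi_fin_left 𝒱 Y u v l m n x)
  have e₂ := f.toAddMonoidHom.map_finsum (jacobi_fin_right Y u v l m n x)
  unfold JacobiAt at *
  rw [hx] at e₁
  rw [e₁] at e₂
  simpa [hf.mode] using e₂

theorem Intertwines.isWeakModule {𝒱 : VOAData V} {Y : V →ₗ[ℂ] VertexOperator ℂ M}
    {Y' : V →ₗ[ℂ] VertexOperator ℂ N} {f : M →ₗ[ℂ] N} (hf : Intertwines Y Y' f)
    (hs : Function.Surjective f) (hY : IsWeakModule 𝒱 Y) : IsWeakModule 𝒱 Y' where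
  vacuum n := by
    ext y
    obtain ⟨x, rfl⟩ := hs y
    rw [← hf, hY.vacuum]
    split_ifs <;> simp
  jacobi u v l m n y := by
    obtain ⟨x, rfl⟩ := hs y
    exact hf.jacobiAt (hY.jacobi u v l m n x)

theorem map_eigenspace {A : Module.End ℂ M} {B : Module.End ℂ N} {f : M →ₗ[ℂ] N}
    (hf : ∀ x, f (A x) = B (f x)) (h : ℂ) : (A.eigenspace h).map f ≤ B.eigenspace h := by
  rintro _ ⟨x, hx, rfl⟩
  have hx' : A x = h • x := Module.End.mem_eigenspace_iff.1 hx
  rw [Module.End.mem_eigenspace_iff, ← hf, hx', map_smul]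

theorem iSup_eigenspace_of_surjective {A : Module.End ℂ M} {B : Module.End ℂ N} {f : M →ₗ[ℂ] N}
    (hf : ∀ x, f (A x) = B (f x)) (hs : Function.Surjective f)
    (hA : ⨆ h : ℂ, A.eigenspace h = ⊤) : ⨆ h : ℂ, B.eigenspace h = ⊤ := by
  rw [eq_top_iff, ← LinearMap.range_eq_top.2 hs, LinearMap.range_eq_map, ← hA, Submodule.map_iSup]
  exact iSup_mono fun h => map_eigenspace hf h

theorem eigenspace_eq_map {A : Module.End ℂ M} {B : Module.End ℂ N} {f : M →ₗ[ℂ] N}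
    (hf : ∀ x, f (A x) = B (f x)) (hs : Function.Surjective f)
    (hA : ⨆ h : ℂ, A.eigenspace h = ⊤) (h : ℂ) : B.eigenspace h = (A.eigenspace h).map f := by
  refine le_antisymm (fun y hy => ?_) (map_eigenspace hf h)
  obtain ⟨x, rfl⟩ := hs y
  have hx : x ∈ ⨆ h : ℂ, A.eigenspace h := hA ▸ Submodule.mem_top
  have hsplit : ⨆ k : ℂ, A.eigenspace k ≤ A.eigenspace h ⊔ ⨆ k ≠ h, A.eigenspace k :=
    iSup_le fun k => by
      by_cases hk : k = h
      · subst hk; exact le_sup_left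
      · exact le_sup_of_le_right (le_iSup₂_of_le k hk le_rfl)
  obtain ⟨a, ha, b, hb, rfl⟩ := Submodule.mem_sup.1 (hsplit hx)
  have hfb : f b ∈ ⨆ k ≠ h, B.eigenspace k := by
    have : f b ∈ (⨆ k ≠ h, A.eigenspace k).map f := ⟨b, hb, rfl⟩
    simp only [Submodule.map_iSup] at this
    exact iSup₂_mono (fun k _ => map_eigenspace hf k) this
  have hfa := map_eigenspace hf h ⟨a, ha, rfl⟩
  have hfb' : f b ∈ B.eigenspace h := by
    have := Submodule.sub_mem _ hy hfa
    simpa using this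
  have := (Submodule.disjoint_def.1 (B.eigenspaces_iSupIndep h)) _ hfb' hfb
  exact ⟨a, ha, by simp [this]⟩

theorem Intertwines.isOrdinary {𝒱 : VOAData V} {Y : V →ₗ[ℂ] VertexOperator ℂ M}
    {Y' : V →ₗ[ℂ] VertexOperator ℂ N} {f : M →ₗ[ℂ] N} (hf : Intertwines Y Y' f)
    (hs : Function.Surjective f) (hY : IsOrdinary 𝒱 Y) : IsOrdinary 𝒱 Y' where
  weak := hf.isWeakModule hs hY.weak
  semisimple := iSup_eigenspace_of_surjective (fun x => hf.mode _ _ x) hs hY.semisimple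
  finite h := by
    have := hY.finite h
    rw [eigenspace_eq_map (A := Lop 𝒱 Y 0) (B := Lop 𝒱 Y' 0) (fun x => hf.mode _ _ x) hs hY.semisimple h]
    infer_instance
  bounded := by
    obtain ⟨r, hr⟩ := hY.bounded
    refine ⟨r, fun h hh => ?_⟩
    rw [eigenspace_eq_map (A := Lop 𝒱 Y 0) (B := Lop 𝒱 Y' 0) (fun x => hf.mode _ _ x) hs hY.semisimple h, hr h hh, Submodule.map_bot]

theorem Lneg_one_eq (𝒱 : VOA V) (v : V) :
    Lop 𝒱.toVOAData 𝒱.Y (-1) v = mode 𝒱.Y v (-2) 𝒱.vac := by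
  have h := 𝒱.derivative v 0
  have h' := 𝒱.creation_neg_one (Lop 𝒱.toVOAData 𝒱.Y (-1) v)
  simp only [mode] at h' ⊢
  rw [show (- -1 - 1 : ℤ) = 0 by norm_num, h] at h'
  rw [← h']
  simp

theorem choose_neg_two (i : ℕ) : ((-1) ^ i * Ring.choose (-2 : ℤ) i) = (i : ℤ) + 1 := by
  rw [Ring.choose_neg', Ring.multichoose_two]
  rcases Nat.even_or_odd i with h | h
  · simp [h.neg_one_pow, Int.negOnePow_even (i : ℤ) (by exact_mod_cast h)]
  · simp [h.neg_one_pow, Int.negOnePow_odd (i : ℤ) (by exact_mod_cast h), add_comm]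

theorem mode_vac {𝒱 : VOAData V} {Y : V →ₗ[ℂ] VertexOperator ℂ M}
    (hY : IsWeakModule 𝒱 Y) (n : ℤ) (x : M) :
    mode Y 𝒱.vac n x = if n = -1 then x else 0 := by
  rw [mode, hY.vacuum]
  by_cases h : n = -1
  · subst h; simp
  · rw [if_neg h, if_neg (by omega)]; rfl

theorem Lneg_one_mode {𝒱 : VOA V} {Y : V →ₗ[ℂ] VertexOperator ℂ M}
    (hY : IsWeakModule 𝒱.toVOAData Y) (v : V) (n : ℤ) (x : M) :
    mode Y (Lop 𝒱.toVOAData 𝒱.Y (-1) v) n x = -n • mode Y v (n - 1) x := by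
  have h := hY.jacobi v 𝒱.vac (-2) 0 n x
  unfold JacobiAt at h
  rw [finsum_eq_single _ 0 (fun i hi => by simp [Ring.choose_zero_pos ℤ (Nat.pos_of_ne_zero hi)])] at h
  simp only [Ring.choose_zero_right, one_smul, Nat.cast_zero, add_zero, zero_add, sub_zero] at h
  rw [Lneg_one_eq, h]
  simp only [choose_neg_two, mode_vac hY]
  rcases lt_trichotomy n 0 with hn | rfl | hn
  · rw [finsum_eq_single _ (-1 - n).toNat]
    · rw [if_pos (by omega), if_neg (by omega), smul_zero, sub_zero]
      congr 3 <;> omega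
    · intro i hi
      rw [if_neg (by omega), if_neg (by omega)]
      simp
  · rw [finsum_eq_zero_of_forall_eq_zero]
    · simp
    · intro i
      rw [if_neg (by omega), if_neg (by omega)]
      simp
  · rw [finsum_eq_single _ (n - 1).toNat]
    · rw [if_neg (by omega), if_pos (by omega)]
      have e : ((n - 1).toNat : ℤ) = n - 1 := by omega
      rw [e, Int.negOnePow_even (-2) ⟨-1, rfl⟩]
      simp
    · intro i hi
      rw [if_neg (by omega), if_neg (by omega)]
      simp

theorem L0_comm {𝒱 : VOA V} {Y : V →ₗ[ℂ] VertexOperator ℂ M}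
    (hY : IsWeakModule 𝒱.toVOAData Y) (v : V) (n : ℤ) (x : M) :
    Lop 𝒱.toVOAData Y 0 (mode Y v n x) = mode Y v n (Lop 𝒱.toVOAData Y 0 x) +
      mode Y (Lop 𝒱.toVOAData 𝒱.Y 0 v) n x - (n + 1) • mode Y v n x := by
  have h := hY.jacobi 𝒱.ω v 0 1 n x
  unfold JacobiAt at h
  have h1 := Lneg_one_mode hY v (n + 1) x
  rw [finsum_eq_finsetSum_of_support_subset (s := Finset.range 2)] at h
  · rw [finsum_eq_single _ 0 (fun i hi => by simp [Ring.choose_zero_pos ℤ (Nat.pos_of_ne_zero hi)])] at h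
    simp [Finset.sum_range_succ] at h
    rw [show (1 + n : ℤ) = n + 1 by ring] at h
    simp only [Lop] at h1 ⊢
    simp only [zero_add, add_sub_cancel_right] at h1 ⊢
    rw [show (-1 + 1 : ℤ) = 0 by norm_num] at h1
    rw [h1, eq_sub_iff_add_eq] at h
    rw [← h]
    module
  · intro i hi
    by_contra hlt
    apply hi
    have e : Ring.choose (1 : ℤ) i = 0 := by
      have := Ring.choose_natCast (R := ℤ) 1 i
      rw [Nat.choose_eq_zero_of_lt (by simpa using hlt)] at this
      simpa using this
    simp [e]

theorem L1_pow_mem (𝒱 : VOA V) (h : ℤ) {v : V} (hv : v ∈ 𝒱.wt h) (i : ℕ) :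
    ((Lop 𝒱.toVOAData 𝒱.Y 1) ^ i) v ∈ 𝒱.wt (h - i) := by
  induction i with
  | zero => simpa using hv
  | succ i ih =>
    obtain ⟨c, hc⟩ := 𝒱.virasoro
    have h1 := LinearMap.congr_fun (hc 0 1) (((Lop 𝒱.toVOAData 𝒱.Y 1) ^ i) v)
    rw [VOA.wt, Module.End.mem_eigenspace_iff] at ih ⊢
    rw [pow_succ', Module.End.mul_apply]
    simp only [zero_add, one_ne_zero, if_false, LinearMap.sub_apply, Module.End.mul_apply, ih,
      LinearMap.add_apply, LinearMap.smul_apply, LinearMap.zero_apply, map_smul] at h1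
    rw [sub_eq_iff_eq_add] at h1
    rw [h1]
    push_cast
    module

/-- `e^{x L(1)} (-x^{-2})^{L(0)} v` for `v` of weight `h`: the coefficient of `x ^ (i - 2h)` is
`(-1)^h / i! · L(1)^i v`. The sum is finite because `L(1)` lowers weights by one. -/
def thetaHom (𝒱 : VOA V) (h : ℤ) : 𝒱.wt h →ₗ[ℂ] (ℤ →₀ V) :=
  have fin : ∀ v : 𝒱.wt h, Function.HasFiniteSupport (fun i : ℕ =>
      Finsupp.single ((i : ℤ) - 2 * h)
        (((-1 : ℂ) ^ h * ((i.factorial : ℂ))⁻¹) • ((Lop 𝒱.toVOAData 𝒱.Y 1) ^ i) (v : V))) := by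
    intro v
    obtain ⟨n₀, hn⟩ := 𝒱.bounded
    refine finite_of_eventually _ (h - n₀ + 1) fun i hi => ?_
    have hm := L1_pow_mem 𝒱 h v.2 i
    rw [VOA.wt, hn _ (by omega), Submodule.mem_bot] at hm
    rw [hm, smul_zero, Finsupp.single_zero]
  { toFun := fun v => ∑ᶠ i : ℕ, Finsupp.single ((i : ℤ) - 2 * h)
      (((-1 : ℂ) ^ h * ((i.factorial : ℂ))⁻¹) • ((Lop 𝒱.toVOAData 𝒱.Y 1) ^ i) (v : V))
    map_add' := fun u v => by
      rw [← finsum_add_distrib (fin u) (fin v)]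
      simp [Finsupp.single_add]
    map_smul' := fun c v => by
      rw [RingHom.id_apply, smul_finsum' c (fin v)]
      refine finsum_congr fun i => ?_
      rw [Finsupp.smul_single, smul_comm c]
      simp }

theorem VOA.isInternal (𝒱 : VOA V) : DirectSum.IsInternal 𝒱.wt := 𝒱.grading

/-- The decomposition of `V` as the direct sum of its weight spaces. -/
def VOA.decomp (𝒱 : VOA V) : (DirectSum ℤ fun n => 𝒱.wt n) ≃ₗ[ℂ] V :=
  LinearEquiv.ofBijective (DirectSum.coeLinearMap 𝒱.wt) 𝒱.isInternal

theorem VOA.decomp_lof (𝒱 : VOA V) (h : ℤ) (v : 𝒱.wt h) :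
    𝒱.decomp (DirectSum.lof ℂ ℤ (fun n => 𝒱.wt n) h v) = v :=
  DirectSum.coeLinearMap_lof 𝒱.wt h v

/-- The Laurent polynomial `e^{x L(1)} (-x^{-2})^{L(0)} v` with coefficients in `V`. -/
def theta (𝒱 : VOA V) : V →ₗ[ℂ] (ℤ →₀ V) :=
  DirectSum.toModule ℂ ℤ (ℤ →₀ V) (thetaHom 𝒱) ∘ₗ 𝒱.decomp.symm.toLinearMap

theorem theta_of_mem (𝒱 : VOA V) (h : ℤ) (v : 𝒱.wt h) :
    theta 𝒱 (v : V) = thetaHom 𝒱 h v := by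
  have e : 𝒱.decomp.symm (v : V) = DirectSum.lof ℂ ℤ (fun n => 𝒱.wt n) h v := by
    rw [← 𝒱.decomp_lof h v, LinearEquiv.symm_apply_apply]
  rw [theta, LinearMap.comp_apply, LinearEquiv.coe_coe, e, DirectSum.toModule_lof]

/-- The opposite `G^o(v, x) = G(e^{x L(1)} (-x^{-2})^{L(0)} v, x^{-1})` of a linear map
`G : V → X[[x, x^{-1}]]`. -/
def opp {X : Type*} [AddCommGroup X] [Module ℂ X] (𝒱 : VOA V) (G : V →ₗ[ℂ] (ℤ → X)) :
    V →ₗ[ℂ] (ℤ → X) :=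
  LinearMap.pi fun n =>
    (Finsupp.lsum ℂ fun k : ℤ => LinearMap.proj (k - n) ∘ₗ G) ∘ₗ theta 𝒱

theorem opp_apply {X : Type*} [AddCommGroup X] [Module ℂ X] (𝒱 : VOA V) (G : V →ₗ[ℂ] (ℤ → X))
    (v : V) (n : ℤ) : opp 𝒱 G v n = (theta 𝒱 v).sum fun k u => G u (k - n) := by
  simp [opp]
  rfl

theorem coef_weight {𝒱 : VOA V} {Y : V →ₗ[ℂ] VertexOperator ℂ M}
    (hY : IsWeakModule 𝒱.toVOAData Y) {h : ℤ} {v : V} (hv : v ∈ 𝒱.wt h) (n : ℤ) {μ : ℂ} {x : M}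
    (hx : x ∈ (Lop 𝒱.toVOAData Y 0).eigenspace μ) :
    coef Y v n x ∈ (Lop 𝒱.toVOAData Y 0).eigenspace (μ + h + n) := by
  have h0 := L0_comm hY v (-n - 1) x
  rw [VOA.wt, Module.End.mem_eigenspace_iff] at hv
  rw [Module.End.mem_eigenspace_iff] at hx ⊢
  have e : mode Y v (-n - 1) = coef Y v n := by
    rw [mode, show (-(-n - 1) - 1 : ℤ) = n by ring]
  rw [hv, hx, mode_smul, e, ← Int.cast_smul_eq_zsmul ℂ] at h0
  rw [h0, map_smul]
  simp only [LinearMap.smul_apply]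
  push_cast
  module

theorem theta_mem (𝒱 : VOA V) {h : ℤ} {v : V} (hv : v ∈ 𝒱.wt h) (k : ℤ) :
    theta 𝒱 v k ∈ 𝒱.wt (-h - k) := by
  rw [theta_of_mem 𝒱 h ⟨v, hv⟩]
  refine finsum_induction (fun f : ℤ →₀ V => f k ∈ 𝒱.wt (-h - k)) (Submodule.zero_mem _)
    (fun a b ha hb => Submodule.add_mem _ ha hb) fun i => ?_
  rw [Finsupp.single_apply]
  split_ifs with hk
  · rw [show -h - k = h - i by omega]
    exact Submodule.smul_mem _ _ (L1_pow_mem 𝒱 h hv i)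
  · exact Submodule.zero_mem _

theorem opp_weight {𝒱 : VOA V} {Y : V →ₗ[ℂ] VertexOperator ℂ M}
    (hY : IsWeakModule 𝒱.toVOAData Y) {h : ℤ} {v : V} (hv : v ∈ 𝒱.wt h) (n : ℤ) {μ : ℂ} {x : M}
    (hx : x ∈ (Lop 𝒱.toVOAData Y 0).eigenspace μ) :
    opp 𝒱 (coef Y) v n x ∈ (Lop 𝒱.toVOAData Y 0).eigenspace (μ - h - n) := by
  rw [opp_apply, Finsupp.sum, LinearMap.sum_apply]
  refine Submodule.sum_mem _ fun k _ => ?_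
  have := coef_weight hY (theta_mem 𝒱 hv k) (k - n) hx
  convert this using 2
  push_cast
  ring

theorem VOA.induction (𝒱 : VOA V) {p : V → Prop} (v : V) (h0 : p 0)
    (hadd : ∀ u v, p u → p v → p (u + v)) (hmem : ∀ h : ℤ, ∀ v ∈ 𝒱.wt h, p v) : p v :=
  Submodule.iSup_induction 𝒱.wt (motive := p)
    (𝒱.isInternal.submodule_iSup_eq_top ▸ Submodule.mem_top : v ∈ ⨆ h, 𝒱.wt h) hmem h0 hadd

/-- The restricted dual `∐ (M_(h))^*` of a module `M = ∐ M_(h)` graded by `L(0)`-eigenvalues: the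
functionals that vanish on all but finitely many of the `M_(h)`. -/
def restrictedDual (𝒱 : VOAData V) (Y : V →ₗ[ℂ] VertexOperator ℂ M) :
    Submodule ℂ (Module.Dual ℂ M) where
  carrier := {g | {h : ℂ | ¬ (Lop 𝒱 Y 0).eigenspace h ≤ LinearMap.ker g}.Finite}
  zero_mem' := by simp
  add_mem' {f g} hf hg := by
    refine (hf.union hg).subset fun h hh => ?_
    by_contra hn
    simp only [Set.mem_union, Set.mem_ofPred_eq, not_or, not_not] at hn
    refine hh fun x hx => ?_
    have h1 : f x = 0 := hn.1 hx
    have h2 : g x = 0 := hn.2 hx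
    simp [h1, h2]
  smul_mem' c f hf := by
    refine hf.subset fun h hh hn => hh fun x hx => ?_
    have h1 : f x = 0 := hn hx
    simp [h1]

theorem contra_mem {𝒱 : VOA V} {Y : V →ₗ[ℂ] VertexOperator ℂ M}
    (hY : IsWeakModule 𝒱.toVOAData Y) (v : V) (n : ℤ) {g : Module.Dual ℂ M}
    (hg : g ∈ restrictedDual 𝒱.toVOAData Y) :
    g ∘ₗ opp 𝒱 (coef Y) v n ∈ restrictedDual 𝒱.toVOAData Y := by
  refine 𝒱.induction (p := fun v => g ∘ₗ opp 𝒱 (coef Y) v n ∈ restrictedDual 𝒱.toVOAData Y) v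
    ?_ ?_ ?_
  · simp
  · intro u v hu hv
    rw [map_add, Pi.add_apply, LinearMap.comp_add]
    exact Submodule.add_mem _ hu hv
  · intro h v hv
    refine (hg.preimage (f := fun μ : ℂ => μ - h - n) (fun a _ b _ hab => ?_)).subset
      fun μ hμ hn => hμ fun x hx => hn (opp_weight hY hv n hx)
    simpa using hab

theorem contra_trunc {𝒱 : VOA V} {Y : V →ₗ[ℂ] VertexOperator ℂ M}
    (hY : IsOrdinary 𝒱.toVOAData Y) (v : V) {g : Module.Dual ℂ M}
    (hg : g ∈ restrictedDual 𝒱.toVOAData Y) :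
    ∃ n₀ : ℤ, ∀ n < n₀, g ∘ₗ opp 𝒱 (coef Y) v n = 0 := by
  refine 𝒱.induction (p := fun v => ∃ n₀ : ℤ, ∀ n < n₀, g ∘ₗ opp 𝒱 (coef Y) v n = 0) v
    ?_ ?_ ?_
  · exact ⟨0, fun n _ => by simp⟩
  · rintro u v ⟨a, ha⟩ ⟨b, hb⟩
    refine ⟨min a b, fun n hn => ?_⟩
    rw [map_add, Pi.add_apply, LinearMap.comp_add, ha n (lt_min_iff.1 hn).1,
      hb n (lt_min_iff.1 hn).2, add_zero]
  · intro h v hv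
    obtain ⟨r, hr⟩ := hY.bounded
    have hfin : (Complex.re '' {μ : ℂ | ¬ (Lop 𝒱.toVOAData Y 0).eigenspace μ ≤
      LinearMap.ker g}).Finite := Set.Finite.image _ hg
    obtain ⟨B, hB⟩ := hfin.bddAbove
    refine ⟨⌊r - h - B⌋, fun n hn => ?_⟩
    have htop : ⨆ μ : ℂ, (Lop 𝒱.toVOAData Y 0).eigenspace μ ≤
        LinearMap.ker (g ∘ₗ opp 𝒱 (coef Y) v n) := by
      refine iSup_le fun μ x hx => ?_
      rcases lt_or_ge μ.re r with hμ | hμ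
      · rw [hr μ hμ, Submodule.mem_bot] at hx
        simp [hx]
      · by_contra hne
        have hmem : (μ - h - n).re ≤ B := by
          refine hB ⟨_, fun hle => hne ?_, rfl⟩
          exact hle (opp_weight hY.weak hv n hx)
        have hn' : (n : ℝ) < r - h - B := by
          have h1 : n + 1 ≤ ⌊r - h - B⌋ := hn
          have h2 := Int.le_floor.1 h1
          push_cast at h2
          linarith
        simp at hmem
        linarith
    rw [hY.semisimple] at htop
    exact LinearMap.ker_eq_top.1 (top_le_iff.1 htop)

/-- The vertex operator map of the contragredient module `M'`, which is the restricted dual with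
`⟨Y'(v, x) g, m⟩ = ⟨g, Y^o(v, x) m⟩`. -/
def contraY {𝒱 : VOA V} {Y : V →ₗ[ℂ] VertexOperator ℂ M} (hY : IsOrdinary 𝒱.toVOAData Y) :
    V →ₗ[ℂ] VertexOperator ℂ (restrictedDual 𝒱.toVOAData Y) :=
  ofCoef
    { toFun := fun v n =>
        { toFun := fun g => ⟨g.1 ∘ₗ opp 𝒱 (coef Y) v n, contra_mem hY.weak v n g.2⟩
          map_add' := fun f g => by ext; simp
          map_smul' := fun c g => by ext; simp }
      map_add' := fun u v => by ext; simp
      map_smul' := fun c v => by ext; simp }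
    fun v g => by
      obtain ⟨n₀, h⟩ := contra_trunc hY v g.2
      exact ⟨n₀, fun n hn => Subtype.ext (h n hn)⟩

@[simp]
theorem coef_contraY {𝒱 : VOA V} {Y : V →ₗ[ℂ] VertexOperator ℂ M} (hY : IsOrdinary 𝒱.toVOAData Y)
    (v : V) (n : ℤ) (g : restrictedDual 𝒱.toVOAData Y) (x : M) :
    (coef (contraY hY) v n g).1 x = g.1 (opp 𝒱 (coef Y) v n x) := rfl

theorem tensor_fin (Y₁ : V →ₗ[ℂ] VertexOperator ℂ M) (Y₂ : V →ₗ[ℂ] VertexOperator ℂ N)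
    (u v : V) (n : ℤ) (x : M) (y : N) : Function.HasFiniteSupport
      (fun i : ℤ => coef Y₁ u i x ⊗ₜ[ℂ] coef Y₂ v (n - i) y) := by
  obtain ⟨a, ha⟩ := coef_trunc Y₁ u x
  obtain ⟨b, hb⟩ := coef_trunc Y₂ v y
  refine (Set.finite_Icc a (n - b)).subset fun i hi => ?_
  by_contra hn
  rw [Set.mem_Icc, not_and_or] at hn
  apply hi
  rcases hn with hn | hn
  · simp [ha i (by omega)]
  · simp [hb (n - i) (by omega)]

/-- `Y₁(u, x) ⊗ Y₂(v, x)`, coefficientwise. -/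
def tensorCoef (Y₁ : V →ₗ[ℂ] VertexOperator ℂ M) (Y₂ : V →ₗ[ℂ] VertexOperator ℂ N)
    (u v : V) (n : ℤ) : Module.End ℂ (M ⊗[ℂ] N) :=
  TensorProduct.lift (LinearMap.mk₂ ℂ
    (fun x y => ∑ᶠ i : ℤ, coef Y₁ u i x ⊗ₜ[ℂ] coef Y₂ v (n - i) y)
    (fun x x' y => by
      rw [← finsum_add_distrib (tensor_fin Y₁ Y₂ u v n x y) (tensor_fin Y₁ Y₂ u v n x' y)]
      simp [TensorProduct.add_tmul])
    (fun c x y => by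
      rw [smul_finsum' c (tensor_fin Y₁ Y₂ u v n x y)]
      simp [TensorProduct.smul_tmul'])
    (fun x y y' => by
      rw [← finsum_add_distrib (tensor_fin Y₁ Y₂ u v n x y) (tensor_fin Y₁ Y₂ u v n x y')]
      simp [TensorProduct.tmul_add])
    (fun c x y => by
      rw [smul_finsum' c (tensor_fin Y₁ Y₂ u v n x y)]
      simp))

@[simp]
theorem tensorCoef_tmul (Y₁ : V →ₗ[ℂ] VertexOperator ℂ M) (Y₂ : V →ₗ[ℂ] VertexOperator ℂ N)
    (u v : V) (n : ℤ) (x : M) (y : N) : tensorCoef Y₁ Y₂ u v n (x ⊗ₜ y) =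
      ∑ᶠ i : ℤ, coef Y₁ u i x ⊗ₜ[ℂ] coef Y₂ v (n - i) y := by
  simp [tensorCoef]

/-- The vertex operator map on `M ⊗ N` determined by
`Y(u ⊗ v, x) = Y₁(u, x) ⊗ Y₂(v, x)`. -/
def tensorY (Y₁ : V →ₗ[ℂ] VertexOperator ℂ M) (Y₂ : V →ₗ[ℂ] VertexOperator ℂ N) :
    V ⊗[ℂ] V →ₗ[ℂ] VertexOperator ℂ (M ⊗[ℂ] N) :=
  ofCoef
    (TensorProduct.lift (LinearMap.mk₂ ℂ (fun u v => tensorCoef Y₁ Y₂ u v)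
      (fun u u' v => by
        ext n x y
        have := finsum_add_distrib (tensor_fin Y₁ Y₂ u v n x y) (tensor_fin Y₁ Y₂ u' v n x y)
        simpa [TensorProduct.add_tmul] using this)
      (fun c u v => by
        ext n x y
        have := smul_finsum' c (tensor_fin Y₁ Y₂ u v n x y)
        simpa [TensorProduct.smul_tmul'] using this.symm)
      (fun u v v' => by
        ext n x y
        have := finsum_add_distrib (tensor_fin Y₁ Y₂ u v n x y) (tensor_fin Y₁ Y₂ u v' n x y)
        simpa [TensorProduct.tmul_add] using this)
      (fun c u v => by
        ext n x y
        have := smul_finsum' c (tensor_fin Y₁ Y₂ u v n x y)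
        simpa using this.symm)))
    (fun a t => by
      induction a using TensorProduct.induction_on with
      | zero => exact ⟨0, fun n _ => by simp⟩
      | add a b ha hb =>
        obtain ⟨i, hi⟩ := ha
        obtain ⟨j, hj⟩ := hb
        refine ⟨min i j, fun n hn => ?_⟩
        have h1 := hi n (lt_min_iff.1 hn).1
        have h2 := hj n (lt_min_iff.1 hn).2
        rw [map_add, Pi.add_apply, LinearMap.add_apply, h1, h2, add_zero]
      | tmul u v =>
        induction t using TensorProduct.induction_on with
        | zero => exact ⟨0, fun n _ => by simp⟩
        | add a b ha hb =>
          obtain ⟨i, hi⟩ := ha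
          obtain ⟨j, hj⟩ := hb
          refine ⟨min i j, fun n hn => ?_⟩
          have h1 := hi n (lt_min_iff.1 hn).1
          have h2 := hj n (lt_min_iff.1 hn).2
          rw [map_add, h1, h2, add_zero]
        | tmul x y =>
          obtain ⟨a, ha⟩ := coef_trunc Y₁ u x
          obtain ⟨b, hb⟩ := coef_trunc Y₂ v y
          refine ⟨a + b, fun n hn => ?_⟩
          simp only [TensorProduct.lift.tmul, LinearMap.mk₂_apply, tensorCoef_tmul]
          refine finsum_eq_zero_of_forall_eq_zero fun i => ?_
          rcases lt_or_ge i a with h | h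
          · simp [ha i h]
          · simp [hb (n - i) (by omega)])

theorem coef_tensorY_tmul (Y₁ : V →ₗ[ℂ] VertexOperator ℂ M) (Y₂ : V →ₗ[ℂ] VertexOperator ℂ N)
    (u v : V) (n : ℤ) (x : M) (y : N) : coef (tensorY Y₁ Y₂) (u ⊗ₜ v) n (x ⊗ₜ y) =
      ∑ᶠ i : ℤ, coef Y₁ u i x ⊗ₜ[ℂ] coef Y₂ v (n - i) y := by
  simp [tensorY]

/-- The tensor product vertex operator algebra `V ⊗ V`, with vacuum `1 ⊗ 1` and conformal vector
`ω ⊗ 1 + 1 ⊗ ω`. -/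
def VOAData.tensor (𝒱 : VOAData V) : VOAData (V ⊗[ℂ] V) where
  Y := tensorY 𝒱.Y 𝒱.Y
  vac := 𝒱.vac ⊗ₜ 𝒱.vac
  ω := 𝒱.ω ⊗ₜ 𝒱.vac + 𝒱.vac ⊗ₜ 𝒱.ω

/-- The weak modules, bundled. -/
structure WeakModule (𝒱 : VOAData V) where
  carrier : Type w
  [addCommGroup : AddCommGroup carrier]
  [module : Module ℂ carrier]
  Y : V →ₗ[ℂ] VertexOperator ℂ carrier
  isWeakModule : IsWeakModule 𝒱 Y

attribute [instance] WeakModule.addCommGroup WeakModule.module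

/-- The morphisms of weak modules. -/
@[ext]
structure WeakModule.Hom {𝒱 : VOAData V} (A B : WeakModule.{v, w} 𝒱) where
  toLin : A.carrier →ₗ[ℂ] B.carrier
  comm : Intertwines A.Y B.Y toLin

instance (𝒱 : VOAData V) : Category (WeakModule.{v, w} 𝒱) where
  Hom := WeakModule.Hom
  id A := ⟨LinearMap.id, fun _ _ _ => rfl⟩
  comp f g := ⟨g.toLin ∘ₗ f.toLin, fun v n x => by simp [f.comm v n x, g.comm v n]⟩

/-- The category of generalized modules. -/
abbrev GenModule (𝒱 : VOAData V) :=
  ObjectProperty.FullSubcategory fun A : WeakModule.{v, w} 𝒱 => IsGeneralized 𝒱 A.Y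

/-- The category of modules. -/
abbrev VModule (𝒱 : VOAData V) :=
  ObjectProperty.FullSubcategory fun A : WeakModule.{v, w} 𝒱 => IsOrdinary 𝒱 A.Y

/-- The map `ι_{x;0}`: the Laurent expansion at `x = 0` of a rational function. -/
def iotaZero : RatFunc ℂ →ₗ[ℂ] LaurentSeries ℂ where
  toFun f := (f : LaurentSeries ℂ)
  map_add' f g := map_add _ f g
  map_smul' c f := by
    have h1 : (((c • f : RatFunc ℂ)) : LaurentSeries ℂ) =
        ((RatFunc.C c : RatFunc ℂ) : LaurentSeries ℂ) * (f : LaurentSeries ℂ) := by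
      rw [RatFunc.smul_eq_C_mul, map_mul]
    have h2 : ((RatFunc.C c : RatFunc ℂ) : LaurentSeries ℂ) = HahnSeries.C c := by
      rw [← RatFunc.algebraMap_C]
      rw [← PowerSeries.coe_C, ← Polynomial.coe_C, RatFunc.coe_coe]
      rfl
    rw [h1, h2]
    simp

theorem iotaZero_injective : Function.Injective iotaZero :=
  fun f g (h : (f : LaurentSeries ℂ) = (g : LaurentSeries ℂ)) => RingHom.injective _ h

theorem transcendental_inv_X : Transcendental ℂ (RatFunc.X : RatFunc ℂ)⁻¹ := fun h =>
  RatFunc.transcendental_X (by simpa using h.inv)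

theorem transcendental_X_sub (z : ℂ) : Transcendental ℂ (RatFunc.X - RatFunc.C z : RatFunc ℂ) :=
  fun h => RatFunc.transcendental_X (by
    simpa using h.add (isAlgebraic_algebraMap (R := ℂ) (A := RatFunc ℂ) z))

/-- The substitution `f(x) ↦ f(g(x))` on rational functions, for non-constant `g`. -/
def ratSubst (g : RatFunc ℂ) (hg : Transcendental ℂ g) : RatFunc ℂ →ₐ[ℂ] RatFunc ℂ :=
  RatFunc.liftAlgHom (Polynomial.aeval g)
    (nonZeroDivisors_le_comap_nonZeroDivisors_of_injective _ (transcendental_iff_injective.1 hg))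

/-- The map `ι_{x;0}⁻¹`, from the expansions at `x = 0` of rational functions back to the rational
functions. It is extended linearly to all Laurent series; it is only ever used on the range of
`ι_{x;0}`. -/
def ratOf : LaurentSeries ℂ →ₗ[ℂ] RatFunc ℂ :=
  Classical.choose (LinearMap.exists_leftInverse_of_injective iotaZero
    (LinearMap.ker_eq_bot.2 iotaZero_injective))

theorem ratOf_iotaZero (f : RatFunc ℂ) : ratOf (iotaZero f) = f :=
  LinearMap.congr_fun (Classical.choose_spec (LinearMap.exists_leftInverse_of_injective iotaZero
    (LinearMap.ker_eq_bot.2 iotaZero_injective))) f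

/-- The map `ι_{x;∞}`: the Laurent expansion at `x = ∞`, given by its coefficients. -/
def iotaInf : RatFunc ℂ →ₗ[ℂ] (ℤ → ℂ) where
  toFun f n := (iotaZero (ratSubst RatFunc.X⁻¹ transcendental_inv_X f)).coeff (-n)
  map_add' f g := by ext n; simp
  map_smul' c f := by
    ext n
    have h : ratSubst RatFunc.X⁻¹ transcendental_inv_X (c • f) =
        c • ratSubst RatFunc.X⁻¹ transcendental_inv_X f :=
      (ratSubst RatFunc.X⁻¹ transcendental_inv_X).toLinearMap.map_smul c f
    rw [h, map_smul]
    simp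

/-- The substitution `f(y) ↦ f(x - z)` on rational functions. -/
def ratShift (z : ℂ) : RatFunc ℂ →ₗ[ℂ] RatFunc ℂ :=
  (ratSubst (RatFunc.X - RatFunc.C z) (transcendental_X_sub z)).toLinearMap

/-- `f ↦ ι_{x;0} ((ι_{y;0}⁻¹ f)|_{y = x - z})`. -/
def shiftZero (z : ℂ) : LaurentSeries ℂ →ₗ[ℂ] (ℤ → ℂ) where
  toFun f n := (iotaZero (ratShift z (ratOf f))).coeff n
  map_add' f g := by ext n; simp
  map_smul' c f := by ext n; simp

/-- `f ↦ ι_{x;∞} ((ι_{y;0}⁻¹ f)|_{y = x - z})`. -/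
def shiftInf (z : ℂ) : LaurentSeries ℂ →ₗ[ℂ] (ℤ → ℂ) := iotaInf ∘ₗ ratShift z ∘ₗ ratOf

/-- The Laurent series `⟨α, Y(v, x) m⟩`. -/
def pairing (Y : V →ₗ[ℂ] VertexOperator ℂ M) (α : Module.Dual ℂ M) (v : V) (m : M) :
    LaurentSeries ℂ where
  coeff n := α (coef Y v n m)
  isPWO_support' := by
    obtain ⟨n₀, h⟩ := coef_trunc Y v m
    refine (BddBelow.isWF ⟨n₀, fun n hn => ?_⟩).isPWO
    by_contra hlt
    exact hn (by simp [h n (not_le.1 hlt)])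

section pairing

variable (Y : V →ₗ[ℂ] VertexOperator ℂ M) (α β : Module.Dual ℂ M) (u v : V) (x y : M) (c : ℂ)

theorem pairing_add₁ : pairing Y (α + β) v x = pairing Y α v x + pairing Y β v x := by
  ext n; simp [pairing]
theorem pairing_smul₁ : pairing Y (c • α) v x = c • pairing Y α v x := by
  ext n; simp [pairing]
theorem pairing_add₂ : pairing Y α (u + v) x = pairing Y α u x + pairing Y α v x := by
  ext n; simp [pairing]
theorem pairing_smul₂ : pairing Y α (c • v) x = c • pairing Y α v x := by
  ext n; simp [pairing]
theorem pairing_add₃ : pairing Y α v (x + y) = pairing Y α v x + pairing Y α v y := by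
  ext n; simp [pairing]
theorem pairing_smul₃ : pairing Y α v (c • x) = c • pairing Y α v x := by
  ext n; simp [pairing]

end pairing

/-- The operators `α ↦ (m ↦ Λ ⟨α, Y(v, x) m⟩)` on `M^*`, coefficient by coefficient. -/
def dualOp (Y : V →ₗ[ℂ] VertexOperator ℂ M) (Λ : LaurentSeries ℂ →ₗ[ℂ] (ℤ → ℂ)) :
    V →ₗ[ℂ] (ℤ → Module.End ℂ (Module.Dual ℂ M)) where
  toFun v n :=
    { toFun := fun α =>
        { toFun := fun x => Λ (pairing Y α v x) n
          map_add' := fun x y => by simp [pairing_add₃]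
          map_smul' := fun c x => by simp [pairing_smul₃] }
      map_add' := fun α β => by ext x; simp [pairing_add₁]
      map_smul' := fun c α => by ext x; simp [pairing_smul₁] }
  map_add' u v := by ext n α x; simp [pairing_add₂]
  map_smul' c v := by ext n α x; simp [pairing_smul₂]

@[simp]
theorem dualOp_apply (Y : V →ₗ[ℂ] VertexOperator ℂ M) (Λ : LaurentSeries ℂ →ₗ[ℂ] (ℤ → ℂ)) (v : V)
    (n : ℤ) (α : Module.Dual ℂ M) (x : M) : dualOp Y Λ v n α x = Λ (pairing Y α v x) n := rfl

/-- The space `D_{Q(z)}(M)` of the functionals `α` on `M` such that each matrix coefficient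
`⟨α, Y(v, x) m⟩` is the expansion at `x = 0` of a rational function in `ℂ[x, x⁻¹, (x + z)⁻¹]`, whose
orders of pole at `-z` and at `∞` are bounded independently of `m`: here it is
`p / (x ^ k (x + z) ^ l)` with `deg p - k - l ≤ m`. -/
def qzFunctionals (z : ℂ) (Y : V →ₗ[ℂ] VertexOperator ℂ M) : Submodule ℂ (Module.Dual ℂ M) where
  carrier := {α | ∀ v : V, ∃ l m : ℕ, ∀ x : M, ∃ (k : ℕ) (p : Polynomial ℂ),
    p.natDegree ≤ k + l + m ∧ pairing Y α v x = iotaZero (algebraMap (Polynomial ℂ) (RatFunc ℂ) p /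
      (RatFunc.X ^ k * (RatFunc.X + RatFunc.C z) ^ l))}
  zero_mem' v := ⟨0, 0, fun x => ⟨0, 0, by simp, by ext n; simp [pairing]⟩⟩
  add_mem' {α β} hα hβ v := by
    obtain ⟨l₁, m₁, h₁⟩ := hα v
    obtain ⟨l₂, m₂, h₂⟩ := hβ v
    refine ⟨l₁ + l₂, m₁ + m₂, fun x => ?_⟩
    obtain ⟨k₁, p₁, d₁, e₁⟩ := h₁ x
    obtain ⟨k₂, p₂, d₂, e₂⟩ := h₂ x
    have hX : (RatFunc.X : RatFunc ℂ) ≠ 0 := RatFunc.X_ne_zero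
    have hz : (RatFunc.X + RatFunc.C z : RatFunc ℂ) ≠ 0 := by
      have := Polynomial.X_add_C_ne_zero z
      intro h
      apply this
      apply RatFunc.algebraMap_injective ℂ
      simpa using h
    refine ⟨k₁ + k₂, p₁ * (Polynomial.X ^ k₂ * (Polynomial.X + Polynomial.C z) ^ l₂) +
      p₂ * (Polynomial.X ^ k₁ * (Polynomial.X + Polynomial.C z) ^ l₁), ?_, ?_⟩
    · have hd : ∀ k l : ℕ, (Polynomial.X ^ k * (Polynomial.X + Polynomial.C z) ^ l).natDegree
          ≤ k + l := fun k l => by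
        refine Polynomial.natDegree_mul_le_of_le (by simp) ?_
        refine (Polynomial.natDegree_pow_le).trans ?_
        simp
      refine Polynomial.natDegree_add_le_of_degree_le
        ((Polynomial.natDegree_mul_le_of_le d₁ (hd k₂ l₂)).trans (by omega))
        ((Polynomial.natDegree_mul_le_of_le d₂ (hd k₁ l₁)).trans (by omega))
    · rw [pairing_add₁, e₁, e₂, ← map_add]
      congr 1
      simp only [map_add, map_mul, map_pow, RatFunc.algebraMap_X, RatFunc.algebraMap_C]
      field_simp
      ring
  smul_mem' c α hα v := by
    obtain ⟨l, m, h⟩ := hα v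
    refine ⟨l, m, fun x => ?_⟩
    obtain ⟨k, p, d, e⟩ := h x
    refine ⟨k, Polynomial.C c * p, (Polynomial.natDegree_C_mul_le _ _).trans d, ?_⟩
    rw [pairing_smul₁, e, ← map_smul, map_mul, RatFunc.algebraMap_C, RatFunc.smul_eq_C_mul,
      mul_div_assoc]

/-- The operators `Y^R(v, x)`, for which
`⟨Y^R(v, x) α, m⟩ = ι_{x;0} ((ι_{y;0}⁻¹ ⟨α, Y(v, y) m⟩)|_{y = x - z})`, coefficient by coefficient.
They are meant for `α ∈ D_{Q(z)}(M)` only. -/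
def YRop (z : ℂ) (Y : V →ₗ[ℂ] VertexOperator ℂ M) :
    V →ₗ[ℂ] (ℤ → Module.End ℂ (Module.Dual ℂ M)) := dualOp Y (shiftZero z)

/-- The operators `Y^L(v, x)`, whose opposite is given by
`⟨(Y^L)^o(v, x) α, m⟩ = ι_{x;∞} ((ι_{y;0}⁻¹ ⟨α, Y(v, y) m⟩)|_{y = x - z})`, coefficient by
coefficient. (Taking the opposite is an involution.) They are meant for `α ∈ D_{Q(z)}(M)` only. -/
def YLop (𝒱 : VOA V) (z : ℂ) (Y : V →ₗ[ℂ] VertexOperator ℂ M) :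
    V →ₗ[ℂ] (ℤ → Module.End ℂ (Module.Dual ℂ M)) := opp 𝒱 (dualOp Y (shiftInf z))

/-- The functionals `α ∈ D_{Q(z)}(M)` to which the product `Y^L(u, x) Y^R(v, x)` can be applied
coefficient by coefficient: the coefficients of `Y^R(v, x) α` lie in `D_{Q(z)}(M)` again, so that
`Y^L(u, x)` is defined on them, and only finitely many products of coefficients contribute to each
power of `x`. In fact every element of `D_{Q(z)}(M)` has these properties, if `M` is a weak module
and `z ≠ 0`. -/
def qzDomain (𝒱 : VOA V) (z : ℂ) (Y : V →ₗ[ℂ] VertexOperator ℂ M) :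
    Submodule ℂ (Module.Dual ℂ M) where
  carrier := {α | α ∈ qzFunctionals z Y ∧ (∀ v n, YRop z Y v n α ∈ qzFunctionals z Y) ∧
    ∀ (u v : V) (n : ℤ),
      Function.HasFiniteSupport fun j : ℤ => YLop 𝒱 z Y u (n - j) (YRop z Y v j α)}
  zero_mem' := by
    refine ⟨Submodule.zero_mem _, fun v n => ?_, fun u v n => ?_⟩
    · rw [map_zero]; exact Submodule.zero_mem _
    · simp [Function.HasFiniteSupport]
  add_mem' {α β} hα hβ := by
    refine ⟨Submodule.add_mem _ hα.1 hβ.1, fun v n => ?_, fun u v n => ?_⟩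
    · rw [map_add]; exact Submodule.add_mem _ (hα.2.1 v n) (hβ.2.1 v n)
    · simp only [map_add]
      exact Function.HasFiniteSupport.add (hα.2.2 u v n) (hβ.2.2 u v n)
  smul_mem' c α hα := by
    refine ⟨Submodule.smul_mem _ _ hα.1, fun v n => ?_, fun u v n => ?_⟩
    · rw [map_smul]; exact Submodule.smul_mem _ _ (hα.2.1 v n)
    · simp only [map_smul]
      exact (hα.2.2 u v n).subset fun j hj h => hj (by simp only [h, smul_zero])

/-- The coefficients of `Y_{Q(z)}(u ⊗ v, x) = Y^L(u, x) Y^R(v, x)`. -/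
def YQz (𝒱 : VOA V) (z : ℂ) (Y : V →ₗ[ℂ] VertexOperator ℂ M) :
    V ⊗[ℂ] V →ₗ[ℂ] (ℤ → (qzDomain 𝒱 z Y →ₗ[ℂ] Module.Dual ℂ M)) :=
  TensorProduct.lift (LinearMap.mk₂ ℂ
    (fun u v n =>
      { toFun := fun α => ∑ᶠ j : ℤ, YLop 𝒱 z Y u (n - j) (YRop z Y v j α.1)
        map_add' := fun α β => by
          rw [← finsum_add_distrib (α.2.2.2 u v n) (β.2.2.2 u v n)]
          simp
        map_smul' := fun c α => by
          rw [RingHom.id_apply, smul_finsum' c (α.2.2.2 u v n)]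
          simp })
    (fun u u' v => by
      ext n α : 2
      have := finsum_add_distrib (α.2.2.2 u v n) (α.2.2.2 u' v n)
      simpa using this)
    (fun c u v => by
      ext n α : 2
      have := smul_finsum' c (α.2.2.2 u v n)
      simpa using this.symm)
    (fun u v v' => by
      ext n α : 2
      have := finsum_add_distrib (α.2.2.2 u v n) (α.2.2.2 u v' n)
      simpa using this)
    (fun c u v => by
      ext n α : 2
      have := smul_finsum' c (α.2.2.2 u v n)
      simpa using this.symm))

theorem YQz_tmul (𝒱 : VOA V) (z : ℂ) (Y : V →ₗ[ℂ] VertexOperator ℂ M) (u v : V) (n : ℤ)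
    (α : qzDomain 𝒱 z Y) :
    YQz 𝒱 z Y (u ⊗ₜ v) n α = ∑ᶠ j : ℤ, YLop 𝒱 z Y u (n - j) (YRop z Y v j α.1) := by
  simp [YQz]

/-- `S` is a subspace of `D_{Q(z)}(M)` that is stable under the coefficients of `Y_{Q(z)}`, and on which
`Y_{Q(z)}` is lower truncated. -/
structure IsQzStable (𝒱 : VOA V) (z : ℂ) (Y : V →ₗ[ℂ] VertexOperator ℂ M)
    (S : Submodule ℂ (Module.Dual ℂ M)) : Prop where
  le : S ≤ qzDomain 𝒱 z Y
  mem : ∀ (a : V ⊗[ℂ] V) (n : ℤ) (α : Module.Dual ℂ M) (h : α ∈ S),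
    YQz 𝒱 z Y a n ⟨α, le h⟩ ∈ S
  trunc : ∀ (a : V ⊗[ℂ] V) (α : Module.Dual ℂ M) (h : α ∈ S),
    ∃ n₀ : ℤ, ∀ n < n₀, YQz 𝒱 z Y a n ⟨α, le h⟩ = 0

/-- The restriction of `Y_{Q(z)}` to a stable subspace. -/
def restrictY {𝒱 : VOA V} {z : ℂ} {Y : V →ₗ[ℂ] VertexOperator ℂ M}
    {S : Submodule ℂ (Module.Dual ℂ M)} (hS : IsQzStable 𝒱 z Y S) :
    V ⊗[ℂ] V →ₗ[ℂ] VertexOperator ℂ S :=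
  ofCoef
    { toFun := fun a n =>
        ((YQz 𝒱 z Y a n) ∘ₗ Submodule.inclusion hS.le).codRestrict S fun α => hS.mem a n α.1 α.2
      map_add' := fun a b => by ext n α : 3; simp; rfl
      map_smul' := fun c a => by ext n α : 3; simp; rfl }
    fun a α => by
      obtain ⟨n₀, h⟩ := hS.trunc a α.1 α.2
      exact ⟨n₀, fun n hn => Subtype.ext (h n hn)⟩

theorem coef_restrictY {𝒱 : VOA V} {z : ℂ} {Y : V →ₗ[ℂ] VertexOperator ℂ M}
    {S : Submodule ℂ (Module.Dual ℂ M)} (hS : IsQzStable 𝒱 z Y S) (a : V ⊗[ℂ] V) (n : ℤ) (α : S) :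
    (coef (restrictY hS) a n α : Module.Dual ℂ M) = YQz 𝒱 z Y a n ⟨α.1, hS.le α.2⟩ := rfl

/-- `S` is a `V ⊗ V`-submodule of `D_{Q(z)}(M)` that is a module (not only a weak one) and on which
`L(0) ⊗ 1` acts semisimply. -/
def IsRSummand (𝒱 : VOA V) (z : ℂ) (Y : V →ₗ[ℂ] VertexOperator ℂ M)
    (S : Submodule ℂ (Module.Dual ℂ M)) : Prop :=
  ∃ hS : IsQzStable 𝒱 z Y S, IsOrdinary 𝒱.toVOAData.tensor (restrictY hS) ∧
    ⨆ h : ℂ, (mode (restrictY hS) (𝒱.ω ⊗ₜ 𝒱.vac) 1).eigenspace h = ⊤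

/-- `R_{Q(z)}(M)`: the sum of all the submodules of `D_{Q(z)}(M)` that are modules with semisimple
action of `L(0) ⊗ 1`. -/
def RQz (𝒱 : VOA V) (z : ℂ) (Y : V →ₗ[ℂ] VertexOperator ℂ M) :
    Submodule ℂ (Module.Dual ℂ M) := sSup {S | IsRSummand 𝒱 z Y S}

theorem RQz_stable (𝒱 : VOA V) (z : ℂ) (Y : V →ₗ[ℂ] VertexOperator ℂ M) :
    IsQzStable 𝒱 z Y (RQz 𝒱 z Y) := by
  have hle : RQz 𝒱 z Y ≤ qzDomain 𝒱 z Y := sSup_le fun S hS => hS.1.le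
  refine ⟨hle, fun a n α h => ?_, fun a α h => ?_⟩
  · have key : RQz 𝒱 z Y ≤
        ((RQz 𝒱 z Y).comap (YQz 𝒱 z Y a n)).map (qzDomain 𝒱 z Y).subtype :=
      sSup_le fun S hS β hβ => ⟨⟨β, hS.1.le hβ⟩,
        (le_sSup (show S ∈ {S | IsRSummand 𝒱 z Y S} from hS) : S ≤ RQz 𝒱 z Y)
          (hS.1.mem a n β hβ), rfl⟩
    obtain ⟨β, hβ, rfl⟩ := key h
    exact hβ
  · let T : Submodule ℂ (Module.Dual ℂ M) :=
      { carrier := {α | ∃ hα : α ∈ qzDomain 𝒱 z Y, ∃ n₀ : ℤ, ∀ n < n₀, YQz 𝒱 z Y a n ⟨α, hα⟩ = 0}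
        zero_mem' := ⟨Submodule.zero_mem _, 0, fun n _ => map_zero (YQz 𝒱 z Y a n)⟩
        add_mem' := by
          rintro α β ⟨hα, i, hi⟩ ⟨hβ, j, hj⟩
          refine ⟨Submodule.add_mem _ hα hβ, min i j, fun n hn => ?_⟩
          have := map_add (YQz 𝒱 z Y a n) ⟨α, hα⟩ ⟨β, hβ⟩
          rw [hi n (lt_min_iff.1 hn).1, hj n (lt_min_iff.1 hn).2, add_zero] at this
          exact this
        smul_mem' := by
          rintro c α ⟨hα, i, hi⟩
          refine ⟨Submodule.smul_mem _ _ hα, i, fun n hn => ?_⟩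
          have := map_smul (YQz 𝒱 z Y a n) c ⟨α, hα⟩
          rw [hi n hn, smul_zero] at this
          exact this }
    have key : RQz 𝒱 z Y ≤ T := sSup_le fun S hS β hβ => ⟨hS.1.le hβ, hS.1.trunc a β hβ⟩
    exact (key h).2

/-- The vertex operator map of `V ⊗ V` on `R_{Q(z)}(M)`. -/
def RQzY (𝒱 : VOA V) (z : ℂ) (Y : V →ₗ[ℂ] VertexOperator ℂ M) :
    V ⊗[ℂ] V →ₗ[ℂ] VertexOperator ℂ (RQz 𝒱 z Y) := restrictY (RQz_stable 𝒱 z Y)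

theorem IsRSummand.le {𝒱 : VOA V} {z : ℂ} {Y : V →ₗ[ℂ] VertexOperator ℂ M}
    {S : Submodule ℂ (Module.Dual ℂ M)} (hS : IsRSummand 𝒱 z Y S) : S ≤ RQz 𝒱 z Y := le_sSup hS

theorem IsRSummand.intertwines {𝒱 : VOA V} {z : ℂ} {Y : V →ₗ[ℂ] VertexOperator ℂ M}
    {S : Submodule ℂ (Module.Dual ℂ M)} (hS : IsRSummand 𝒱 z Y S) :
    Intertwines (restrictY hS.1) (RQzY 𝒱 z Y) (Submodule.inclusion hS.le) :=
  fun _ _ _ => rfl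

theorem RQz_induction {𝒱 : VOA V} {z : ℂ} {Y : V →ₗ[ℂ] VertexOperator ℂ M}
    (p : RQz 𝒱 z Y → Prop) (h0 : p 0) (hadd : ∀ α β, p α → p β → p (α + β))
    (hmem : ∀ S (hS : IsRSummand 𝒱 z Y S) (α : S), p (Submodule.inclusion hS.le α))
    (α : RQz 𝒱 z Y) : p α := by
  obtain ⟨α, hα⟩ := α
  have hα' := hα
  rw [RQz, sSup_eq_iSup'] at hα'
  have := Submodule.iSup_induction
    (fun S : {S | IsRSummand 𝒱 z Y S} => (S : Submodule ℂ (Module.Dual ℂ M)))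
    (motive := fun β => ∃ h : β ∈ RQz 𝒱 z Y, p ⟨β, h⟩) hα'
    (fun S β hβ => ⟨IsRSummand.le S.2 hβ, hmem S.1 S.2 ⟨β, hβ⟩⟩)
    ⟨Submodule.zero_mem _, h0⟩
    (fun β γ ⟨hβ, pβ⟩ ⟨hγ, pγ⟩ => ⟨Submodule.add_mem _ hβ hγ, hadd _ _ pβ pγ⟩)
  exact this.2

theorem RQz_isGeneralized (𝒱 : VOA V) (z : ℂ) (Y : V →ₗ[ℂ] VertexOperator ℂ M) :
    IsGeneralized 𝒱.toVOAData.tensor (RQzY 𝒱 z Y) where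
  weak :=
    { vacuum := fun n => by
        ext1 α
        refine RQz_induction (p := fun α => coef (RQzY 𝒱 z Y) 𝒱.toVOAData.tensor.vac n α =
          (if n = 0 then (1 : Module.End ℂ (RQz 𝒱 z Y)) else 0) α) ?_ ?_ ?_ α
        · simp
        · intro α β hα hβ
          rw [map_add, map_add, hα, hβ]
        · intro S hS α
          rw [← hS.intertwines, hS.2.1.weak.vacuum]
          split_ifs <;> simp
      jacobi := fun u v l m n α => by
        refine RQz_induction (p := fun α => JacobiAt 𝒱.toVOAData.tensor (RQzY 𝒱 z Y) u v l m n α)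
          ?_ (fun α β => JacobiAt.add) ?_ α
        · simp [JacobiAt]
        · intro S hS α
          exact hS.intertwines.jacobiAt (hS.2.1.weak.jacobi u v l m n α) }
  semisimple := by
    refine eq_top_iff.2 fun α _ => ?_
    refine RQz_induction (p := fun α => α ∈ ⨆ h : ℂ,
      (Lop 𝒱.toVOAData.tensor (RQzY 𝒱 z Y) 0).eigenspace h) (Submodule.zero_mem _)
      (fun α β => Submodule.add_mem _) ?_ α
    intro S hS α
    have h1 : α ∈ ⨆ h : ℂ, (Lop 𝒱.toVOAData.tensor (restrictY hS.1) 0).eigenspace h :=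
      hS.2.1.semisimple ▸ Submodule.mem_top
    have h2 := Submodule.mem_map_of_mem (f := Submodule.inclusion hS.le) h1
    rw [Submodule.map_iSup] at h2
    exact iSup_mono (fun h => map_eigenspace (A := Lop 𝒱.toVOAData.tensor (restrictY hS.1) 0)
      (B := Lop 𝒱.toVOAData.tensor (RQzY 𝒱 z Y) 0) (fun x => hS.intertwines.mode _ _ x) h) h2

section functoriality

variable {𝒱 : VOA V} {z : ℂ} {Y : V →ₗ[ℂ] VertexOperator ℂ M} {Y' : V →ₗ[ℂ] VertexOperator ℂ N}
  {f : N →ₗ[ℂ] M}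

theorem pairing_dualMap (hf : Intertwines Y' Y f) (α : Module.Dual ℂ M) (v : V) (x : N) :
    pairing Y' (f.dualMap α) v x = pairing Y α v (f x) := by
  ext n
  simp [pairing, hf v n x]

theorem dualOp_dualMap (hf : Intertwines Y' Y f) (Λ : LaurentSeries ℂ →ₗ[ℂ] (ℤ → ℂ)) (v : V) (n : ℤ)
    (α : Module.Dual ℂ M) : dualOp Y' Λ v n (f.dualMap α) = f.dualMap (dualOp Y Λ v n α) := by
  ext x
  simp [pairing_dualMap hf]

theorem YRop_dualMap (hf : Intertwines Y' Y f) (v : V) (n : ℤ) (α : Module.Dual ℂ M) :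
    YRop z Y' v n (f.dualMap α) = f.dualMap (YRop z Y v n α) := dualOp_dualMap hf _ _ _ _

theorem YLop_dualMap (hf : Intertwines Y' Y f) (v : V) (n : ℤ) (α : Module.Dual ℂ M) :
    YLop 𝒱 z Y' v n (f.dualMap α) = f.dualMap (YLop 𝒱 z Y v n α) := by
  simp only [YLop, opp_apply, Finsupp.sum, LinearMap.sum_apply, map_sum, dualOp_dualMap hf]

theorem qzFunctionals_dualMap (hf : Intertwines Y' Y f) {α : Module.Dual ℂ M}
    (hα : α ∈ qzFunctionals z Y) : f.dualMap α ∈ qzFunctionals z Y' := fun v => by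
  obtain ⟨l, m, h⟩ := hα v
  exact ⟨l, m, fun x => by rw [pairing_dualMap hf]; exact h (f x)⟩

theorem qzDomain_dualMap (hf : Intertwines Y' Y f) {α : Module.Dual ℂ M}
    (hα : α ∈ qzDomain 𝒱 z Y) : f.dualMap α ∈ qzDomain 𝒱 z Y' := by
  refine ⟨qzFunctionals_dualMap hf hα.1, fun v n => ?_, fun u v n => ?_⟩
  · rw [YRop_dualMap hf]
    exact qzFunctionals_dualMap hf (hα.2.1 v n)
  · simp only [YRop_dualMap hf, YLop_dualMap hf]
    exact (hα.2.2 u v n).subset fun j hj h => hj (by simp only [h, map_zero])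

theorem YQz_dualMap (hf : Intertwines Y' Y f) (a : V ⊗[ℂ] V) (n : ℤ) (α : Module.Dual ℂ M)
    (hα : α ∈ qzDomain 𝒱 z Y) :
    YQz 𝒱 z Y' a n ⟨f.dualMap α, qzDomain_dualMap hf hα⟩ = f.dualMap (YQz 𝒱 z Y a n ⟨α, hα⟩) := by
  induction a using TensorProduct.induction_on with
  | zero => simp
  | add a b ha hb => simp only [map_add, Pi.add_apply, LinearMap.add_apply, ha, hb]
  | tmul u v =>
    rw [YQz_tmul, YQz_tmul]
    have := f.dualMap.toAddMonoidHom.map_finsum (hα.2.2 u v n)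
    simp only [YRop_dualMap hf, YLop_dualMap hf]
    exact this.symm

theorem IsQzStable.map (hf : Intertwines Y' Y f) {S : Submodule ℂ (Module.Dual ℂ M)}
    (hS : IsQzStable 𝒱 z Y S) : IsQzStable 𝒱 z Y' (S.map f.dualMap) where
  le := by
    rintro _ ⟨α, hα, rfl⟩
    exact qzDomain_dualMap hf (hS.le hα)
  mem := by
    rintro a n _ ⟨α, hα, rfl⟩
    rw [YQz_dualMap hf a n α (hS.le hα)]
    exact ⟨_, hS.mem a n α hα, rfl⟩
  trunc := by
    rintro a _ ⟨α, hα, rfl⟩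
    obtain ⟨n₀, h⟩ := hS.trunc a α hα
    refine ⟨n₀, fun n hn => ?_⟩
    rw [YQz_dualMap hf a n α (hS.le hα), h n hn, map_zero]

/-- The map `S → f^*(S)` induced by `f^*`. -/
def mapRestrict (f : N →ₗ[ℂ] M) (S : Submodule ℂ (Module.Dual ℂ M)) :
    S →ₗ[ℂ] S.map f.dualMap :=
  (f.dualMap ∘ₗ S.subtype).codRestrict _ fun α => ⟨α.1, α.2, rfl⟩

theorem IsRSummand.map (hf : Intertwines Y' Y f) {S : Submodule ℂ (Module.Dual ℂ M)}
    (hS : IsRSummand 𝒱 z Y S) : IsRSummand 𝒱 z Y' (S.map f.dualMap) := by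
  obtain ⟨h, ho, hs⟩ := hS
  have hi : Intertwines (restrictY h) (restrictY (h.map hf)) (mapRestrict f S) := fun a n α => by
    apply Subtype.ext
    exact (YQz_dualMap hf a n α.1 (h.le α.2)).symm
  have hsurj : Function.Surjective (mapRestrict f S) := by
    rintro ⟨_, α, hα, rfl⟩
    exact ⟨⟨α, hα⟩, rfl⟩
  exact ⟨h.map hf, hi.isOrdinary hsurj ho,
    iSup_eigenspace_of_surjective (fun x => hi.mode _ _ x) hsurj hs⟩

theorem RQz_dualMap (hf : Intertwines Y' Y f) {α : Module.Dual ℂ M} (hα : α ∈ RQz 𝒱 z Y) :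
    f.dualMap α ∈ RQz 𝒱 z Y' := by
  have : RQz 𝒱 z Y ≤ (RQz 𝒱 z Y').comap f.dualMap :=
    sSup_le fun S hS => Submodule.map_le_iff_le_comap.1 (IsRSummand.le (IsRSummand.map hf hS))
  exact this hα

/-- The restriction of `f^* : M^* → N^*` to a map `R_{Q(z)}(M) → R_{Q(z)}(N)`. -/
def RQzMap (z : ℂ) (hf : Intertwines Y' Y f) : RQz 𝒱 z Y →ₗ[ℂ] RQz 𝒱 z Y' :=
  (f.dualMap ∘ₗ (RQz 𝒱 z Y).subtype).codRestrict _ fun α => RQz_dualMap hf α.2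

theorem RQzMap_intertwines (hf : Intertwines Y' Y f) :
    Intertwines (RQzY 𝒱 z Y) (RQzY 𝒱 z Y') (RQzMap z hf) := fun a n α => by
  apply Subtype.ext
  exact (YQz_dualMap hf a n α.1 ((RQz_stable 𝒱 z Y).le α.2)).symm

end functoriality

section modules

variable {𝒱 : VOA V}

/-- (The underlying space of) the contragredient module `W'`. -/
abbrev Contra (W : VModule.{v, w} 𝒱.toVOAData) : Type w := restrictedDual 𝒱.toVOAData W.obj.Y

/-- The algebraic completion of `W`, that is `∏ W_(h) = (W')^*`. -/
abbrev Completion (W : VModule.{v, w} 𝒱.toVOAData) : Type w := Module.Dual ℂ (Contra W)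

theorem Intertwines.opp {Y : V →ₗ[ℂ] VertexOperator ℂ M} {Y' : V →ₗ[ℂ] VertexOperator ℂ N}
    {f : M →ₗ[ℂ] N} (hf : Intertwines Y Y' f) (v : V) (n : ℤ) (x : M) :
    f (VOATheory.opp 𝒱 (coef Y) v n x) = VOATheory.opp 𝒱 (coef Y') v n (f x) := by
  simp only [opp_apply, Finsupp.sum, LinearMap.sum_apply, map_sum, hf _ _ _]

/-- The morphism `f' : W₂' → W₁'` contragredient to `f : W₁ → W₂`. -/
def contraMap {W₁ W₂ : VModule.{v, w} 𝒱.toVOAData} (f : W₁ ⟶ W₂) : Contra W₂ →ₗ[ℂ] Contra W₁ :=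
  (f.hom.toLin.dualMap ∘ₗ Submodule.subtype _).codRestrict _ fun g => by
    refine g.2.subset fun h hh hn => hh fun x hx => ?_
    exact hn (map_eigenspace (fun x => f.hom.comm.mode _ _ x) h ⟨x, hx, rfl⟩)

theorem contraMap_intertwines {W₁ W₂ : VModule.{v, w} 𝒱.toVOAData} (f : W₁ ⟶ W₂) :
    Intertwines (contraY W₂.property) (contraY W₁.property) (contraMap f) := fun v n g => by
  apply Subtype.ext
  ext x
  exact congrArg g.1 (f.hom.comm.opp v n x).symm

/-- The extension `(f')^*` of a morphism `f` to the completions. -/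
def completionMap {W₁ W₂ : VModule.{v, w} 𝒱.toVOAData} (f : W₁ ⟶ W₂) :
    Completion W₁ →ₗ[ℂ] Completion W₂ := (contraMap f).dualMap

/-- The functor `F_{Q(z)}` from modules for `V` to generalized modules for `V ⊗ V`:
`F_{Q(z)}(W) = R_{Q(z)}(W')`, and `F_{Q(z)}(f)` is the restriction of `(f')^*`. -/
def FQz (𝒱 : VOA V) (z : ℂ) :
    VModule.{v, w} 𝒱.toVOAData ⥤ GenModule.{v, w} 𝒱.toVOAData.tensor where
  obj W :=
    { obj :=
        { carrier := RQz 𝒱 z (contraY W.property)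
          Y := RQzY 𝒱 z (contraY W.property)
          isWeakModule := (RQz_isGeneralized 𝒱 z _).weak }
      property := RQz_isGeneralized 𝒱 z _ }
  map f := ObjectProperty.homMk
    ⟨RQzMap z (contraMap_intertwines f), RQzMap_intertwines (contraMap_intertwines f)⟩

/-- The coefficient of `x₀ ^ a x₁ ^ b` in `z⁻¹ δ((x₁ - x₀) / z)`, where `δ(x) = ∑ x ^ n`, and
binomials are expanded in nonnegative powers of the second variable. -/
def deltaOut (z : ℂ) (a b : ℤ) : ℂ :=
  if 0 ≤ a then z ^ (-a - b - 1) * (Ring.choose (a + b) a.toNat : ℤ) * (-1) ^ a else 0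

/-- The coefficient of `x₀ ^ a x₁ ^ b` in `x₀⁻¹ δ((x₁ - z) / x₀)`. -/
def deltaFst (z : ℂ) (a b : ℤ) : ℂ :=
  if 0 ≤ -a - 1 - b then
    (Ring.choose (-a - 1) (-a - 1 - b).toNat : ℤ) * (-z) ^ (-a - 1 - b) else 0

/-- The coefficient of `x₀ ^ a x₁ ^ b` in `x₀⁻¹ δ((z - x₁) / (-x₀))`. -/
def deltaSnd (z : ℂ) (a b : ℤ) : ℂ :=
  if 0 ≤ b then
    (-1) ^ (-a - 1) * (Ring.choose (-a - 1) b.toNat : ℤ) * (-1) ^ b * z ^ (-a - 1 - b) else 0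

/-- `F : W₁ ⊗ W₂ → (W₃')^*` is a `Q(z)`-intertwining map:
`z⁻¹ δ((x₁ - x₀) / z) Y^o(v, x₀) F(w₁ ⊗ w₂) = x₀⁻¹ δ((x₁ - z) / x₀) F(Y^o(v, x₁) w₁ ⊗ w₂)`
`- x₀⁻¹ δ((z - x₁) / (-x₀)) F(w₁ ⊗ Y(v, x₁) w₂)`.
Both sides are evaluated at `g ∈ W₃'`, and the coefficients of `x₀ ^ a x₁ ^ b` are compared. On the
completion, `⟨Y^o(v, x) t, g⟩ = ⟨t, Y'(v, x) g⟩`. The sums have only finitely many nonzero terms. -/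
def IsQzIntertwining (𝒱 : VOA V) (z : ℂ) (W₁ W₂ W₃ : VModule.{v, w} 𝒱.toVOAData)
    (F : W₁.obj.carrier ⊗[ℂ] W₂.obj.carrier →ₗ[ℂ] Completion W₃) : Prop :=
  ∀ (v : V) (w₁ : W₁.obj.carrier) (w₂ : W₂.obj.carrier) (g : Contra W₃) (a b : ℤ),
    ∑ᶠ j : ℤ, deltaOut z (a - j) b * F (w₁ ⊗ₜ w₂) (coef (contraY W₃.property) v j g) =
      ∑ᶠ j : ℤ, deltaFst z a (b - j) * F (opp 𝒱 (coef W₁.obj.Y) v j w₁ ⊗ₜ w₂) g -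
        ∑ᶠ j : ℤ, deltaSnd z a (b - j) * F (w₁ ⊗ₜ coef W₂.obj.Y v j w₂) g

/-- A `Q(z)`-product `(W, F)` of `W₁` and `W₂`. -/
structure QzProduct (𝒱 : VOA V) (z : ℂ) (W₁ W₂ : VModule.{v, w} 𝒱.toVOAData) where
  module : VModule.{v, w} 𝒱.toVOAData
  map : W₁.obj.carrier ⊗[ℂ] W₂.obj.carrier →ₗ[ℂ] Completion module
  isIntertwining : IsQzIntertwining 𝒱 z W₁ W₂ module map

/-- `η` is a morphism of `Q(z)`-products: the extension of `η` to the completions carries `F` to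
the intertwining map of the target. -/
def IsProductHom {z : ℂ} {W₁ W₂ : VModule.{v, w} 𝒱.toVOAData} (P Q : QzProduct 𝒱 z W₁ W₂)
    (η : P.module ⟶ Q.module) : Prop :=
  Q.map = completionMap η ∘ₗ P.map

/-- A `Q(z)`-tensor product is a `Q(z)`-product with a unique morphism to every `Q(z)`-product. -/
def IsQzTensorProduct {z : ℂ} {W₁ W₂ : VModule.{v, w} 𝒱.toVOAData} (P : QzProduct 𝒱 z W₁ W₂) :
    Prop :=
  ∀ Q : QzProduct 𝒱 z W₁ W₂, ∃! η : P.module ⟶ Q.module, IsProductHom P Q η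

/-- `W₁ ⊗ W₂` as an object of the category of generalized `V ⊗ V`-modules. -/
def tensorObj (W₁ W₂ : VModule.{v, w} 𝒱.toVOAData)
    (h : IsGeneralized 𝒱.toVOAData.tensor (tensorY W₁.obj.Y W₂.obj.Y)) :
    GenModule.{v, w} 𝒱.toVOAData.tensor where
  obj :=
    { carrier := W₁.obj.carrier ⊗[ℂ] W₂.obj.carrier
      Y := tensorY W₁.obj.Y W₂.obj.Y
      isWeakModule := h.weak }
  property := h

/-- `(W, F)` is a universal from `W₁ ⊗ W₂` to the functor `F_{Q(z)}`: `W₁ ⊗ W₂` is an object of the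
category of generalized `V ⊗ V`-modules, `F` is (with its target restricted) a morphism from it to
`F_{Q(z)}(W)`, and each morphism from `W₁ ⊗ W₂` to some `F_{Q(z)}(U)` is the composite of this one
with `F_{Q(z)}(η)` for a unique `η : W → U`. -/
def IsUniversalArrow (𝒱 : VOA V) (z : ℂ) (W₁ W₂ W : VModule.{v, w} 𝒱.toVOAData)
    (F : W₁.obj.carrier ⊗[ℂ] W₂.obj.carrier →ₗ[ℂ] Completion W) : Prop :=
  ∃ (h : IsGeneralized 𝒱.toVOAData.tensor (tensorY W₁.obj.Y W₂.obj.Y))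
    (f : tensorObj W₁ W₂ h ⟶ (FQz 𝒱 z).obj W),
    (∀ t : W₁.obj.carrier ⊗[ℂ] W₂.obj.carrier,
      (RQz 𝒱 z (contraY W.property)).subtype (f.hom.toLin t) = F t) ∧
    Nonempty (StructuredArrow.mk f).IsUniversal

end modules
end
end VOATheory

open VOATheory

namespace VOATheory

noncomputable section

/-! ### Coefficients of the three delta functions -/

section deltaFunctions

/-! The point is that a Q(z)-intertwining map `W₁ ⊗ W₂ → (W')^*` and a morphism `W₁ ⊗ W₂ →
F_{Q(z)}(W)` of generalized `V ⊗ V`-modules are the same linear map, up to restriction of the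
target. This identification is compatible with postcomposition by `η : W → U`, so Q(z)-products are
the objects under `W₁ ⊗ W₂` of the comma category of `F_{Q(z)}`, and the two universal properties
say the same thing.

To identify the maps, pair the defining identity with `g ∈ W'`. It becomes a relation `ThreeTerm`
between scalar series `f(x₀)`, `A(x₁)`, `B(x₁)`, where `f` and `B` are truncated from below and `A`
from above. Such a relation holds exactly when `f` is the expansion at 0 of some `r ∈ ℂ[x, x⁻¹, (x +
z)⁻¹]` and `A`, `B` are the expansions of `r(x₁ - z)` at ∞ and at 0. It holds for `r = 1` by
`deltaOut_eq`; multiplication of the relation by `x₀` or by `x₁` is reversible and multiplies `r` by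
`x` or by `x + z`, so all poles can be cleared (`isThreeTerm_div`, `ThreeTerm.exists_fraction`,
`ThreeTerm.shift_eq`). These expansions are the ones that define `(Y^L)^o` and `Y^R`. Since the
opposite is an involution (`opp_opp`), the intertwining identity says that the values of `F` lie in
`D_{Q(z)}(W')`, that `Y^L` acts on them through `W₁` and that `Y^R` acts through `W₂`
(`isQzIntertwining_iff`). Inserting the vacuum in one tensor factor recovers `Y^L` and `Y^R`
separately from `Y_{Q(z)}` (`QzCompatible.isLRCompatible`).

Two facts remain. The space `W₁ ⊗ W₂` is a generalized `V ⊗ V`-module: its matrix coefficients are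
products of those of the factors, and products of scalar solutions of the Jacobi identity are
solutions (`JTriple.IsJacobi.mul`). The image of `F` lies in `R_{Q(z)}(W')`: although `W₁ ⊗ W₂` may
have infinite-dimensional weight spaces, it is the sum of tensor products of submodules with weights
in single cosets of ℤ, and those are modules (`isOrdinary_tensorY`, `QzCompatible.mem_RQz`). -/

theorem deltaFst_sub_one {z : ℂ} (a b : ℤ) :
    deltaFst z (a - 1) b = deltaFst z a (b - 1) - z * deltaFst z a b := by
  unfold deltaFst
  rcases lt_trichotomy (-a - 1 - b) (-1) with h | h | h
  · rw [if_neg (by omega), if_neg (by omega), if_neg (by omega)]; simp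
  · rw [if_pos (by omega), if_pos (by omega), if_neg (by omega),
      show -(a - 1) - 1 - b = 0 by omega, show -a - 1 - (b - 1) = 0 by omega]
    simp
  · rw [if_pos (by omega), if_pos (by omega), if_pos (by omega)]
    obtain ⟨i, hi⟩ := Int.eq_ofNat_of_zero_le (show 0 ≤ -a - 1 - b by omega)
    rw [show -(a - 1) - 1 - b = ((i + 1 : ℕ) : ℤ) by push_cast; omega,
      show -a - 1 - (b - 1) = ((i + 1 : ℕ) : ℤ) by push_cast; omega, hi,
      show -(a - 1) - 1 = (-a - 1) + 1 by ring]
    simp only [Int.toNat_natCast, zpow_natCast, Ring.choose_succ_succ]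
    push_cast
    ring

/-- On this delta function, as on the previous one, multiplication by `x₀` agrees with
multiplication by `x₁ - z`. On coefficients this is Pascal's rule. -/
theorem deltaSnd_sub_one {z : ℂ} (hz : z ≠ 0) (a b : ℤ) :
    deltaSnd z (a - 1) b = deltaSnd z a (b - 1) - z * deltaSnd z a b := by
  unfold deltaSnd
  have h1 : (-1 : ℂ) ≠ 0 := by norm_num
  rcases lt_trichotomy b 0 with h | rfl | h
  · rw [if_neg (by omega), if_neg (by omega), if_neg (by omega)]; simp
  · rw [if_pos le_rfl, if_pos le_rfl, if_neg (by omega),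
      show -(a - 1) - 1 = (-a - 1) + 1 by ring, zpow_add_one₀ h1,
      show (-a - 1) + 1 - 0 = (-a - 1 - 0) + 1 by ring, zpow_add_one₀ hz]
    simp only [Int.toNat_zero, Ring.choose_zero_right, Int.cast_one, zpow_zero]
    ring
  · rw [if_pos (by omega), if_pos (by omega), if_pos (by omega)]
    obtain ⟨i, hi⟩ := Int.eq_ofNat_of_zero_le (show 0 ≤ b - 1 by omega)
    obtain rfl : b = ((i + 1 : ℕ) : ℤ) := by push_cast; omega
    rw [show -(a - 1) - 1 = (-a - 1) + 1 by ring, zpow_add_one₀ h1,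
      show (-a - 1) + 1 - ((i + 1 : ℕ) : ℤ) = (-a - 1 - ((i + 1 : ℕ) : ℤ)) + 1 by ring,
      zpow_add_one₀ hz, show -a - 1 - (((i + 1 : ℕ) : ℤ) - 1) = (-a - 1 - ((i + 1 : ℕ) : ℤ)) + 1 by
        ring, zpow_add_one₀ hz, hi]
    simp only [Int.toNat_natCast, zpow_natCast, Ring.choose_succ_succ]
    push_cast
    ring

/-- The same substitution in the form `x₁ = x₀ + z`; again Pascal's rule. -/
theorem deltaOut_sub_one {z : ℂ} (hz : z ≠ 0) (a b : ℤ) :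
    deltaOut z (a - 1) b + z * deltaOut z a b = deltaOut z a (b - 1) := by
  unfold deltaOut
  rcases lt_trichotomy a 0 with h | rfl | h
  · rw [if_neg (by omega), if_neg (by omega), if_neg (by omega)]; simp
  · rw [if_neg (by omega), if_pos (by omega), if_pos (by omega),
      show -0 - (b - 1) - 1 = (-0 - b - 1) + 1 by ring, zpow_add_one₀ hz]
    simp
    ring
  · rw [if_pos (by omega), if_pos (by omega), if_pos (by omega)]
    obtain ⟨i, hi⟩ := Int.eq_ofNat_of_zero_le (show 0 ≤ a - 1 by omega)
    obtain rfl : a = ((i + 1 : ℕ) : ℤ) := by push_cast; omega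
    rw [show -(((i + 1 : ℕ) : ℤ) - 1) - b - 1 = (-((i + 1 : ℕ) : ℤ) - b - 1) + 1 by ring,
      zpow_add_one₀ hz, show -((i + 1 : ℕ) : ℤ) - (b - 1) - 1 = (-((i + 1 : ℕ) : ℤ) - b - 1) + 1 by
        ring, zpow_add_one₀ hz, hi,
      show ((i + 1 : ℕ) : ℤ) + b = (i + b) + 1 by push_cast; ring,
      show ((i + 1 : ℕ) : ℤ) + (b - 1) = (i + b) by push_cast; ring]
    simp only [Int.toNat_natCast, zpow_natCast, Ring.choose_succ_succ]
    push_cast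
    ring

/-- All three families satisfy the recurrence that expresses `x₀ = x₁ - z`, so the defect of the
identity does too. Row `a = -1` is checked directly. The recurrence gives row `a - 1` from row `a`;
upwards, a vanishing row `a - 1` leaves a geometric progression in `b` in row `a`, which is killed
by its entry at `b = 0`. -/
theorem deltaOut_eq {z : ℂ} (hz : z ≠ 0) (a b : ℤ) :
    deltaOut z a b = deltaFst z a b - deltaSnd z a b := by
  have hO : ∀ a b : ℤ, _ := fun a b => deltaOut_sub_one hz a b
  have hF : ∀ a b : ℤ, _ := fun a b => deltaFst_sub_one (z := z) a b
  have hS : ∀ a b : ℤ, _ := fun a b => deltaSnd_sub_one hz a b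
  -- At `x₀⁻¹` the outer delta function has no coefficient, and the other two both have the
  -- coefficient 1 at `b = 0` and 0 elsewhere.
  have base (b : ℤ) : deltaOut z (-1) b = deltaFst z (-1) b - deltaSnd z (-1) b := by
    unfold deltaOut deltaFst deltaSnd
    rw [if_neg (by omega)]
    rcases lt_trichotomy b 0 with h | rfl | h
    · obtain ⟨i, rfl⟩ := Int.eq_negSucc_of_lt_zero h
      rw [if_pos (by omega), if_neg (by omega),
        show - -1 - 1 - Int.negSucc i = ((i + 1 : ℕ) : ℤ) by push_cast; omega]
      simp [Ring.choose_zero_succ]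
    · simp
    · rw [if_neg (by omega), if_pos (by omega), show (- -1 - 1 : ℤ) = 0 by norm_num,
        Ring.choose_zero_pos ℤ (by omega)]
      simp
  rcases lt_or_ge a 0 with ha | ha
  · obtain ⟨i, rfl⟩ : ∃ i : ℕ, a = -1 - i := ⟨(-1 - a).toNat, by omega⟩
    clear ha
    induction i generalizing b with
    | zero => simpa using base b
    | succ i ih =>
      have e : (-1 - ((i + 1 : ℕ) : ℤ)) = (-1 - i) - 1 := by push_cast; ring
      rw [e]
      linear_combination hO (-1 - i) b - hF (-1 - i) b + hS (-1 - i) b + ih (b - 1) - z * ih b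
  · obtain ⟨i, rfl⟩ : ∃ i : ℕ, a = i - 1 := ⟨(a + 1).toNat, by omega⟩
    clear ha
    induction i generalizing b with
    | zero => simpa using base b
    | succ i ih =>
      have e : (((i + 1 : ℕ) : ℤ) - 1) = i := by push_cast; ring
      rw [e]
      -- The previous row vanishes, so neighbouring defects in this row differ by the factor `z`. As
      -- `z ≠ 0`, vanishing propagates from `b = 0` in both directions.
      have step (b : ℤ) : deltaOut z i (b - 1) - deltaFst z i (b - 1) + deltaSnd z i (b - 1) =
          z * (deltaOut z i b - deltaFst z i b + deltaSnd z i b) := by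
        linear_combination -hO i b + hF i b - hS i b + ih b
      have zero : deltaOut z i 0 - deltaFst z i 0 + deltaSnd z i 0 = 0 := by
        unfold deltaOut deltaFst deltaSnd
        have e1 : (-1 : ℂ) ^ (-(i : ℤ) - 1) = -(-1) ^ i := by
          rw [show -(i : ℤ) - 1 = -((i + 1 : ℕ) : ℤ) by push_cast; ring, zpow_neg, zpow_natCast,
            ← inv_pow, inv_neg, inv_one, pow_succ]
          ring
        rw [if_pos (by omega), if_neg (by omega), if_pos le_rfl, e1]
        simp [Ring.choose_natCast]
        ring
      have all : deltaOut z i b - deltaFst z i b + deltaSnd z i b = 0 := by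
        induction b using Int.induction_on with
        | zero => exact zero
        | succ b ihb =>
          have := step (b + 1)
          rw [add_sub_cancel_right, ihb] at this
          exact (mul_eq_zero.1 this.symm).resolve_left hz
        | pred b ihb => rw [step, ihb, mul_zero]
      linear_combination all

end deltaFunctions

/-! ### The three-term identity for scalar series -/

section threeTerm

/-- A doubly infinite sequence that vanishes in low degrees. -/
def LowerTrunc (f : ℤ → ℂ) : Prop := ∃ n₀ : ℤ, ∀ n < n₀, f n = 0

/-- A doubly infinite sequence that vanishes in high degrees. -/
def UpperTrunc (f : ℤ → ℂ) : Prop := ∃ n₀ : ℤ, ∀ n, n₀ < n → f n = 0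

theorem LowerTrunc.shift {f : ℤ → ℂ} (hf : LowerTrunc f) : LowerTrunc fun j => f (j - 1) := by
  obtain ⟨n₀, h⟩ := hf
  exact ⟨n₀, fun n hn => h _ (by omega)⟩

theorem UpperTrunc.shift {f : ℤ → ℂ} (hf : UpperTrunc f) : UpperTrunc fun j => f (j - 1) := by
  obtain ⟨n₀, h⟩ := hf
  exact ⟨n₀ + 1, fun n hn => h _ (by omega)⟩

theorem LowerTrunc.add_smul {f g : ℤ → ℂ} (hf : LowerTrunc f) (hg : LowerTrunc g) (c : ℂ) :
    LowerTrunc fun j => f j + c * g j := by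
  obtain ⟨a, ha⟩ := hf
  obtain ⟨b, hb⟩ := hg
  refine ⟨min a b, fun n hn => ?_⟩
  simp [ha n (lt_min_iff.1 hn).1, hb n (lt_min_iff.1 hn).2]

theorem UpperTrunc.add_smul {f g : ℤ → ℂ} (hf : UpperTrunc f) (hg : UpperTrunc g) (c : ℂ) :
    UpperTrunc fun j => f j + c * g j := by
  obtain ⟨a, ha⟩ := hf
  obtain ⟨b, hb⟩ := hg
  refine ⟨max a b, fun n hn => ?_⟩
  simp [ha n (max_lt_iff.1 hn).1, hb n (max_lt_iff.1 hn).2]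

variable {z : ℂ}

/-- The supports of the delta functions fit the truncations: the outer one has only nonnegative
powers of `x₀`, the second one on the right only nonnegative powers of `x₁`, and the first one, for
fixed `a`, powers of `x₁` that are bounded above. -/
theorem finite_deltaOut (z : ℂ) {f : ℤ → ℂ} (hf : LowerTrunc f) (a b : ℤ) :
    Function.HasFiniteSupport fun j => deltaOut z (a - j) b * f j := by
  obtain ⟨n₀, h⟩ := hf
  refine (Set.finite_Icc n₀ a).subset fun j hj => ?_
  by_contra hn
  rw [Set.mem_Icc, not_and_or, not_le, not_le] at hn
  apply hj
  rcases hn with hn | hn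
  · simp [h j hn]
  · simp only [deltaOut]
    rw [if_neg (by omega), zero_mul]

theorem finite_deltaSnd (z : ℂ) {f : ℤ → ℂ} (hf : LowerTrunc f) (a b : ℤ) :
    Function.HasFiniteSupport fun j => deltaSnd z a (b - j) * f j := by
  obtain ⟨n₀, h⟩ := hf
  refine (Set.finite_Icc n₀ b).subset fun j hj => ?_
  by_contra hn
  rw [Set.mem_Icc, not_and_or, not_le, not_le] at hn
  apply hj
  rcases hn with hn | hn
  · simp [h j hn]
  · simp only [deltaSnd]
    rw [if_neg (by omega), zero_mul]

theorem finite_deltaFst (z : ℂ) {f : ℤ → ℂ} (hf : UpperTrunc f) (a b : ℤ) :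
    Function.HasFiniteSupport fun j => deltaFst z a (b - j) * f j := by
  obtain ⟨n₀, h⟩ := hf
  refine (Set.finite_Icc (a + 1 + b) n₀).subset fun j hj => ?_
  by_contra hn
  rw [Set.mem_Icc, not_and_or, not_le, not_le] at hn
  apply hj
  rcases hn with hn | hn
  · simp only [deltaFst]
    rw [if_neg (by omega), zero_mul]
  · simp [h j hn]

/-- The identity
`z⁻¹ δ((x₁ - x₀) / z) f(x₀) = x₀⁻¹ δ((x₁ - z) / x₀) A(x₁) - x₀⁻¹ δ((z - x₁) / (-x₀)) B(x₁)` for formal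
series with scalar coefficients, with `f` and `B` truncated from below and `A` from above. -/
structure ThreeTerm (z : ℂ) (f A B : ℤ → ℂ) : Prop where
  lower : LowerTrunc f
  upper : UpperTrunc A
  lower' : LowerTrunc B
  eq : ∀ a b : ℤ, ∑ᶠ j : ℤ, deltaOut z (a - j) b * f j =
    ∑ᶠ j : ℤ, deltaFst z a (b - j) * A j - ∑ᶠ j : ℤ, deltaSnd z a (b - j) * B j

theorem finsum_add_mul {ι : Type*} {g h : ι → ℂ} (hg : g.HasFiniteSupport)
    (hh : h.HasFiniteSupport) (c : ℂ) :
    ∑ᶠ j, (g j + c * h j) = ∑ᶠ j, g j + c * ∑ᶠ j, h j := by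
  have hh' : Function.HasFiniteSupport fun j => c * h j :=
    hh.subset fun j hj h0 => hj (by simp [h0])
  rw [finsum_add_distrib hg hh', mul_finsum' _ _ hh]

theorem ThreeTerm.add_smul {f A B f' A' B' : ℤ → ℂ} (h : ThreeTerm z f A B)
    (h' : ThreeTerm z f' A' B') (c : ℂ) : ThreeTerm z (fun j => f j + c * f' j)
      (fun j => A j + c * A' j) (fun j => B j + c * B' j) where
  lower := h.lower.add_smul h'.lower c
  upper := h.upper.add_smul h'.upper c
  lower' := h.lower'.add_smul h'.lower' c
  eq a b := by
    have e₁ := finsum_add_mul (finite_deltaOut z h.lower a b) (finite_deltaOut z h'.lower a b) c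
    have e₂ := finsum_add_mul (finite_deltaFst z h.upper a b) (finite_deltaFst z h'.upper a b) c
    have e₃ := finsum_add_mul (finite_deltaSnd z h.lower' a b) (finite_deltaSnd z h'.lower' a b) c
    rw [h.eq, h'.eq] at e₁
    simp only [mul_add, mul_left_comm _ c]
    rw [e₁, e₂, e₃]
    ring

theorem finsum_sub_one {R : Type*} [AddCommMonoid R] (g : ℤ → R) : ∑ᶠ j, g (j - 1) = ∑ᶠ j, g j :=
  finsum_comp_equiv (Equiv.subRight (1 : ℤ))

/-- Multiplying the identity by `x₀` turns `f` into `x₀ f` and, by the recurrences, `A` and `B` into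
`(x₁ - z) A` and `(x₁ - z) B`. All coefficients are merely moved from `a` to `a - 1`, so nothing is
lost and the step can be undone. -/
theorem threeTerm_mul_fst {f A B : ℤ → ℂ} (hz : z ≠ 0) (hf : LowerTrunc f) (hA : UpperTrunc A)
    (hB : LowerTrunc B) :
    ThreeTerm z (fun j => f (j - 1)) (fun j => A (j - 1) + -z * A j)
      (fun j => B (j - 1) + -z * B j) ↔ ThreeTerm z f A B := by
  have e₁ (a b : ℤ) : ∑ᶠ j : ℤ, deltaOut z (a - j) b * f (j - 1) =
      ∑ᶠ j : ℤ, deltaOut z ((a - 1) - j) b * f j := by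
    rw [← finsum_sub_one fun j => deltaOut z ((a - 1) - j) b * f j]
    simp only [sub_sub_sub_cancel_right]
  have e₂ (a b : ℤ) : ∑ᶠ j : ℤ, deltaFst z a (b - j) * (A (j - 1) + -z * A j) =
      ∑ᶠ j : ℤ, deltaFst z (a - 1) (b - j) * A j := by
    have h := finsum_add_mul (finite_deltaFst z hA.shift a b) (finite_deltaFst z hA a b) (-z)
    have h' := finsum_add_mul (finite_deltaFst z hA a (b - 1)) (finite_deltaFst z hA a b) (-z)
    rw [← finsum_sub_one fun j => deltaFst z a (b - 1 - j) * A j] at h'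
    simp only [sub_sub_sub_cancel_right] at h'
    rw [← h] at h'
    simp only [mul_add, mul_left_comm _ (-z)]
    rw [← h']
    refine finsum_congr fun j => ?_
    rw [deltaFst_sub_one, show b - 1 - j = b - j - 1 by ring]
    ring
  have e₃ (a b : ℤ) : ∑ᶠ j : ℤ, deltaSnd z a (b - j) * (B (j - 1) + -z * B j) =
      ∑ᶠ j : ℤ, deltaSnd z (a - 1) (b - j) * B j := by
    have h := finsum_add_mul (finite_deltaSnd z hB.shift a b) (finite_deltaSnd z hB a b) (-z)
    have h' := finsum_add_mul (finite_deltaSnd z hB a (b - 1)) (finite_deltaSnd z hB a b) (-z)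
    rw [← finsum_sub_one fun j => deltaSnd z a (b - 1 - j) * B j] at h'
    simp only [sub_sub_sub_cancel_right] at h'
    rw [← h] at h'
    simp only [mul_add, mul_left_comm _ (-z)]
    rw [← h']
    refine finsum_congr fun j => ?_
    rw [deltaSnd_sub_one hz, show b - 1 - j = b - j - 1 by ring]
    ring
  refine ⟨fun h => ⟨hf, hA, hB, fun a b => ?_⟩, fun h => ⟨hf.shift, hA.shift.add_smul hA _,
    hB.shift.add_smul hB _, fun a b => ?_⟩⟩
  · have := h.eq (a + 1) b
    rwa [e₁, e₂, e₃, add_sub_cancel_right] at this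
  · rw [e₁, e₂, e₃, h.eq]

/-- The same for multiplication by `x₁`, which acts on the left as `x₀ + z` and moves coefficients
from `b` to `b - 1`. -/
theorem threeTerm_mul_snd {f A B : ℤ → ℂ} (hz : z ≠ 0) (hf : LowerTrunc f) (hA : UpperTrunc A)
    (hB : LowerTrunc B) :
    ThreeTerm z (fun j => f (j - 1) + z * f j) (fun j => A (j - 1)) (fun j => B (j - 1)) ↔
      ThreeTerm z f A B := by
  have e₁ (a b : ℤ) : ∑ᶠ j : ℤ, deltaOut z (a - j) b * (f (j - 1) + z * f j) =
      ∑ᶠ j : ℤ, deltaOut z (a - j) (b - 1) * f j := by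
    have h := finsum_add_mul (finite_deltaOut z hf.shift a b) (finite_deltaOut z hf a b) z
    have h' := finsum_add_mul (finite_deltaOut z hf (a - 1) b) (finite_deltaOut z hf a b) z
    rw [← finsum_sub_one fun j => deltaOut z (a - 1 - j) b * f j] at h'
    simp only [sub_sub_sub_cancel_right] at h'
    rw [← h] at h'
    simp only [mul_add, mul_left_comm _ z]
    rw [← h']
    refine finsum_congr fun j => ?_
    rw [← deltaOut_sub_one hz, show a - 1 - j = a - j - 1 by ring]
    ring
  have e₂ (a b : ℤ) : ∑ᶠ j : ℤ, deltaFst z a (b - j) * A (j - 1) =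
      ∑ᶠ j : ℤ, deltaFst z a ((b - 1) - j) * A j := by
    rw [← finsum_sub_one fun j => deltaFst z a ((b - 1) - j) * A j]
    simp only [sub_sub_sub_cancel_right]
  have e₃ (a b : ℤ) : ∑ᶠ j : ℤ, deltaSnd z a (b - j) * B (j - 1) =
      ∑ᶠ j : ℤ, deltaSnd z a ((b - 1) - j) * B j := by
    rw [← finsum_sub_one fun j => deltaSnd z a ((b - 1) - j) * B j]
    simp only [sub_sub_sub_cancel_right]
  refine ⟨fun h => ⟨hf, hA, hB, fun a b => ?_⟩, fun h => ⟨hf.shift.add_smul hf _, hA.shift,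
    hB.shift, fun a b => ?_⟩⟩
  · have := h.eq a (b + 1)
    rwa [e₁, e₂, e₃, add_sub_cancel_right] at this
  · rw [e₁, e₂, e₃, h.eq]

theorem threeTerm_one (hz : z ≠ 0) :
    ThreeTerm z (Pi.single 0 1) (Pi.single 0 1) (Pi.single 0 1) where
  lower := ⟨0, fun n hn => by simp [hn.ne]⟩
  upper := ⟨0, fun n hn => by simp [hn.ne']⟩
  lower' := ⟨0, fun n hn => by simp [hn.ne]⟩
  eq a b := by
    rw [finsum_eq_single _ 0 (fun j hj => by simp [hj]),
      finsum_eq_single _ 0 (fun j hj => by simp [hj]),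
      finsum_eq_single _ 0 (fun j hj => by simp [hj])]
    simpa using deltaOut_eq hz a b

/-- If `f` has no negative powers, then `A = B`. -/
theorem ThreeTerm.eq_of_nonneg {f A B : ℤ → ℂ} (h : ThreeTerm z f A B)
    (hf : ∀ n < 0, f n = 0) : A = B := by
  funext b
  -- In the coefficient of `x₀⁻¹` the left side drops out, and each delta function on the right
  -- contributes only its term at `j = b`, with coefficient 1.
  have e := h.eq (-1) b
  rw [finsum_eq_zero_of_forall_eq_zero, finsum_eq_single _ b, finsum_eq_single _ b] at e
  · have := (sub_eq_zero.1 e.symm)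
    simpa [deltaFst, deltaSnd] using this
  · intro j hj
    simp only [deltaSnd]
    split_ifs with h
    · rw [show (- -1 - 1 : ℤ) = 0 by norm_num, Ring.choose_zero_pos ℤ (by omega)]
      simp
    · simp
  · intro j hj
    simp only [deltaFst]
    split_ifs with h
    · rw [show (- -1 - 1 : ℤ) = 0 by norm_num, Ring.choose_zero_pos ℤ (by omega)]
      simp
    · simp
  · intro j
    rcases lt_or_ge j 0 with hj | hj
    · simp [hf j hj]
    · simp only [deltaOut]
      rw [if_neg (by omega), zero_mul]

/-- The coefficient of `x₁⁰` in the outer delta function is a power series in `x₀` with constant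
term `z⁻¹`, hence not a zero divisor. The coefficients of `f` vanish one after another, starting
from the lowest. -/
theorem ThreeTerm.eq_zero {f : ℤ → ℂ} (hz : z ≠ 0) (h : ThreeTerm z f 0 0) : f = 0 := by
  obtain ⟨n₀, hn⟩ := h.lower
  have key (i : ℕ) : ∀ n < n₀ + i, f n = 0 := by
    induction i with
    | zero => simpa using hn
    | succ i ih =>
      intro n hlt
      rcases (show n < n₀ + i ∨ n = n₀ + i by push_cast at hlt; omega) with hlt | rfl
      · exact ih n hlt
      · have e := h.eq (n₀ + i) 0
        rw [finsum_eq_single _ (n₀ + i)] at e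
        · simpa [deltaOut, hz] using e
        · intro j hj
          rcases lt_or_ge j (n₀ + i) with hj' | hj'
          · rw [ih j hj', mul_zero]
          · simp only [deltaOut]
            rw [if_neg (by omega), zero_mul]
  funext n
  exact key (n - n₀ + 1).toNat n (by omega)

end threeTerm

/-! ### Rational functions and the three-term identity -/

section rational

theorem iotaZero_mul (f g : RatFunc ℂ) : iotaZero (f * g) = iotaZero f * iotaZero g := by
  show ((f * g : RatFunc ℂ) : LaurentSeries ℂ) = (f : LaurentSeries ℂ) * (g : LaurentSeries ℂ)
  exact map_mul _ f g

theorem iotaZero_X : iotaZero RatFunc.X = HahnSeries.single 1 1 := by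
  show ((RatFunc.X : RatFunc ℂ) : LaurentSeries ℂ) = _
  exact RatFunc.coe_X

theorem iotaZero_one : iotaZero 1 = 1 := by
  show ((1 : RatFunc ℂ) : LaurentSeries ℂ) = _
  exact map_one _

theorem iotaZero_C (c : ℂ) : iotaZero (RatFunc.C c) = HahnSeries.single 0 c := by
  have : (RatFunc.C c : RatFunc ℂ) = c • 1 := by rw [RatFunc.smul_eq_C_mul, mul_one]
  rw [this, map_smul, iotaZero_one]
  ext n
  simp [HahnSeries.coeff_one, HahnSeries.coeff_single]

theorem coeff_iotaZero_X_mul (r : RatFunc ℂ) (n : ℤ) :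
    (iotaZero (RatFunc.X * r)).coeff n = (iotaZero r).coeff (n - 1) := by
  rw [iotaZero_mul, iotaZero_X]
  have := HahnSeries.coeff_single_mul_add (r := (1 : ℂ)) (x := iotaZero r) (a := n - 1) (b := (1 : ℤ))
  rwa [sub_add_cancel, one_mul] at this

theorem coeff_iotaZero_C_mul (c : ℂ) (r : RatFunc ℂ) (n : ℤ) :
    (iotaZero (RatFunc.C c * r)).coeff n = c * (iotaZero r).coeff n := by
  rw [← RatFunc.smul_eq_C_mul, map_smul]
  rfl

theorem ratSubst_X (g : RatFunc ℂ) (hg : Transcendental ℂ g) : ratSubst g hg RatFunc.X = g := by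
  have := RatFunc.liftAlgHom_apply_div' (φ := (Polynomial.aeval g : Polynomial ℂ →ₐ[ℂ] RatFunc ℂ))
    (nonZeroDivisors_le_comap_nonZeroDivisors_of_injective _ (transcendental_iff_injective.1 hg))
    Polynomial.X 1
  simpa [ratSubst] using this

theorem ratSubst_C (g : RatFunc ℂ) (hg : Transcendental ℂ g) (c : ℂ) :
    ratSubst g hg (RatFunc.C c) = RatFunc.C c :=
  (ratSubst g hg).commutes c

theorem iotaInf_C (c : ℂ) (n : ℤ) : iotaInf (RatFunc.C c) n = if n = 0 then c else 0 := by
  show (iotaZero (ratSubst _ _ (RatFunc.C c))).coeff (-n) = _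
  rw [ratSubst_C, iotaZero_C, HahnSeries.coeff_single]
  simp

theorem iotaInf_C_mul (c : ℂ) (r : RatFunc ℂ) (n : ℤ) :
    iotaInf (RatFunc.C c * r) n = c * iotaInf r n := by
  rw [← RatFunc.smul_eq_C_mul, map_smul]
  rfl

theorem iotaInf_X_mul (r : RatFunc ℂ) (n : ℤ) :
    iotaInf (RatFunc.X * r) n = iotaInf r (n - 1) := by
  show (iotaZero (ratSubst _ _ (RatFunc.X * r))).coeff (-n) =
    (iotaZero (ratSubst _ _ r)).coeff (-(n - 1))
  rw [map_mul, ratSubst_X]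
  set s := ratSubst RatFunc.X⁻¹ transcendental_inv_X r
  have h := coeff_iotaZero_X_mul (RatFunc.X⁻¹ * s) (-(n - 1))
  rw [mul_inv_cancel_left₀ RatFunc.X_ne_zero] at h
  rw [h]
  congr 1
  ring

theorem lowerTrunc_coeff (f : LaurentSeries ℂ) : LowerTrunc f.coeff :=
  ⟨f.order, fun _ hn => HahnSeries.coeff_eq_zero_of_lt_order hn⟩

theorem upperTrunc_iotaInf (r : RatFunc ℂ) : UpperTrunc (iotaInf r) := by
  obtain ⟨n₀, h⟩ := lowerTrunc_coeff (iotaZero (ratSubst RatFunc.X⁻¹ transcendental_inv_X r))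
  exact ⟨-n₀, fun n hn => h _ (by omega)⟩

variable {z : ℂ}

theorem ratShift_mul (r s : RatFunc ℂ) : ratShift z (r * s) = ratShift z r * ratShift z s :=
  map_mul (ratSubst _ (transcendental_X_sub z)) r s

theorem ratShift_X : ratShift z RatFunc.X = RatFunc.X - RatFunc.C z := ratSubst_X _ (transcendental_X_sub z)

theorem ratShift_C (c : ℂ) : ratShift z (RatFunc.C c) = RatFunc.C c := ratSubst_C _ (transcendental_X_sub z) c

/-- The expansions of the rational function `r(x - z)` at `∞` and at `0`, and that of `r` at `0`,
satisfy the three-term identity. -/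
def IsThreeTerm (z : ℂ) (r : RatFunc ℂ) : Prop :=
  ThreeTerm z (iotaZero r).coeff (iotaInf (ratShift z r)) (iotaZero (ratShift z r)).coeff

/-- Under `x ↦ x - z` the factor `X` becomes `x₁ - z`, so this is `threeTerm_mul_fst`. -/
theorem isThreeTerm_X_mul (hz : z ≠ 0) (r : RatFunc ℂ) :
    IsThreeTerm z (RatFunc.X * r) ↔ IsThreeTerm z r := by
  refine Iff.trans ?_ (threeTerm_mul_fst hz (lowerTrunc_coeff _) (upperTrunc_iotaInf _)
    (lowerTrunc_coeff _))
  have e : ratShift z (RatFunc.X * r) =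
      RatFunc.X * ratShift z r + RatFunc.C (-z) * ratShift z r := by
    rw [ratShift_mul, ratShift_X, map_neg]; ring
  rw [IsThreeTerm, e]
  apply iff_of_eq
  congr 1 <;> ext j <;> simp only [map_add, HahnSeries.coeff_add,
    Pi.add_apply, coeff_iotaZero_C_mul, coeff_iotaZero_X_mul, iotaInf_C_mul, iotaInf_X_mul]

/-- Under `x ↦ x - z` the factor `X + z` becomes `x₁`, so this is `threeTerm_mul_snd`. -/
theorem isThreeTerm_X_add_mul (hz : z ≠ 0) (r : RatFunc ℂ) :
    IsThreeTerm z ((RatFunc.X + RatFunc.C z) * r) ↔ IsThreeTerm z r := by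
  refine Iff.trans ?_ (threeTerm_mul_snd hz (lowerTrunc_coeff _) (upperTrunc_iotaInf _)
    (lowerTrunc_coeff _))
  have e : ratShift z ((RatFunc.X + RatFunc.C z) * r) = RatFunc.X * ratShift z r := by
    rw [ratShift_mul, map_add, ratShift_X, ratShift_C]; ring
  rw [IsThreeTerm, e, add_mul]
  apply iff_of_eq
  congr 1 <;> ext j <;> simp only [map_add, HahnSeries.coeff_add,
    coeff_iotaZero_C_mul, coeff_iotaZero_X_mul, iotaInf_X_mul]

theorem IsThreeTerm.add_smul {r s : RatFunc ℂ} (hr : IsThreeTerm z r) (hs : IsThreeTerm z s) (c : ℂ) :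
    IsThreeTerm z (r + RatFunc.C c * s) := by
  have h := ThreeTerm.add_smul hr hs c
  rw [IsThreeTerm, map_add, map_add, map_add, map_add, ratShift_mul, ratShift_C]
  convert h using 1 <;> ext j <;> simp only [HahnSeries.coeff_add, Pi.add_apply,
    coeff_iotaZero_C_mul, iotaInf_C_mul]

theorem isThreeTerm_one (hz : z ≠ 0) : IsThreeTerm z 1 := by
  have h := threeTerm_one hz
  have e₁ : (iotaZero 1).coeff = Pi.single 0 1 := by
    ext n; simp [iotaZero_one, HahnSeries.coeff_one, Pi.single_apply]
  have e₂ : iotaInf 1 = Pi.single 0 1 := by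
    ext n; rw [← map_one RatFunc.C, iotaInf_C, Pi.single_apply]
  rw [IsThreeTerm, ← map_one RatFunc.C, ratShift_C, map_one, e₁, e₂]
  exact h

theorem isThreeTerm_zero (hz : z ≠ 0) : IsThreeTerm z 0 := by
  have := (isThreeTerm_one hz).add_smul (isThreeTerm_one hz) (-1)
  simpa using this

theorem isThreeTerm_X_pow (hz : z ≠ 0) (k : ℕ) (r : RatFunc ℂ) :
    IsThreeTerm z (RatFunc.X ^ k * r) ↔ IsThreeTerm z r := by
  induction k with
  | zero => simp
  | succ k ih => rw [pow_succ', mul_assoc, isThreeTerm_X_mul hz, ih]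

theorem isThreeTerm_X_add_pow (hz : z ≠ 0) (k : ℕ) (r : RatFunc ℂ) :
    IsThreeTerm z ((RatFunc.X + RatFunc.C z) ^ k * r) ↔ IsThreeTerm z r := by
  induction k with
  | zero => simp
  | succ k ih => rw [pow_succ', mul_assoc, isThreeTerm_X_add_mul hz, ih]

theorem isThreeTerm_polynomial (hz : z ≠ 0) (p : Polynomial ℂ) :
    IsThreeTerm z (algebraMap (Polynomial ℂ) (RatFunc ℂ) p) := by
  induction p using Polynomial.induction_on' with
  | add p q hp hq => simpa using hp.add_smul hq 1
  | monomial n c =>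
    rw [← Polynomial.C_mul_X_pow_eq_monomial, map_mul, map_pow, RatFunc.algebraMap_X,
      RatFunc.algebraMap_C]
    have := (isThreeTerm_X_pow hz n 1).2 (isThreeTerm_one hz)
    simpa using (isThreeTerm_zero hz).add_smul this c

theorem X_add_C_ne_zero (z : ℂ) : (RatFunc.X + RatFunc.C z : RatFunc ℂ) ≠ 0 := by
  intro h
  apply Polynomial.X_add_C_ne_zero z
  apply RatFunc.algebraMap_injective ℂ
  simpa using h

/-- Both factors of the denominator can be cleared reversibly, and polynomials are linear
combinations of powers of `X`, obtained from the case `r = 1`. -/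
theorem isThreeTerm_div (hz : z ≠ 0) (p : Polynomial ℂ) (k l : ℕ) :
    IsThreeTerm z (algebraMap (Polynomial ℂ) (RatFunc ℂ) p /
      (RatFunc.X ^ k * (RatFunc.X + RatFunc.C z) ^ l)) := by
  rw [← isThreeTerm_X_add_pow hz l, ← isThreeTerm_X_pow hz k]
  convert isThreeTerm_polynomial hz p using 1
  have h1 := X_add_C_ne_zero z
  have h2 := RatFunc.X_ne_zero (K := ℂ)
  field_simp

theorem coeff_iotaZero_algebraMap (p : Polynomial ℂ) (n : ℤ) :
    (iotaZero (algebraMap (Polynomial ℂ) (RatFunc ℂ) p)).coeff n =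
      if 0 ≤ n then p.coeff n.toNat else 0 := by
  induction p using Polynomial.induction_on generalizing n with
  | C c =>
    rw [RatFunc.algebraMap_C, iotaZero_C, HahnSeries.coeff_single, Polynomial.coeff_C]
    split_ifs <;> first | rfl | omega
  | add p q hp hq =>
    rw [map_add, map_add, HahnSeries.coeff_add, hp, hq]
    split_ifs <;> simp
  | monomial i c h =>
    rw [pow_succ', mul_left_comm, map_mul, RatFunc.algebraMap_X, coeff_iotaZero_X_mul, h]
    rcases lt_trichotomy n 0 with hn | rfl | hn
    · rw [if_neg (by omega), if_neg (by omega)]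
    · simp
    · rw [if_pos (by omega), if_pos (by omega), show n.toNat = (n - 1).toNat + 1 by omega,
        Polynomial.coeff_X_mul]

theorem iotaInf_algebraMap (p : Polynomial ℂ) (n : ℤ) :
    iotaInf (algebraMap (Polynomial ℂ) (RatFunc ℂ) p) n =
      if 0 ≤ n then p.coeff n.toNat else 0 := by
  induction p using Polynomial.induction_on generalizing n with
  | C c =>
    rw [RatFunc.algebraMap_C, iotaInf_C, Polynomial.coeff_C]
    split_ifs <;> first | rfl | omega
  | add p q hp hq =>
    rw [map_add, map_add, Pi.add_apply, hp, hq]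
    split_ifs <;> simp
  | monomial i c h =>
    rw [pow_succ', mul_left_comm, map_mul, RatFunc.algebraMap_X, iotaInf_X_mul, h]
    rcases lt_trichotomy n 0 with hn | rfl | hn
    · rw [if_neg (by omega), if_neg (by omega)]
    · simp
    · rw [if_pos (by omega), if_pos (by omega), show n.toNat = (n - 1).toNat + 1 by omega,
        Polynomial.coeff_X_mul]

theorem ratShift_algebraMap_comp (q : Polynomial ℂ) :
    ratShift z (algebraMap (Polynomial ℂ) (RatFunc ℂ) (q.comp (Polynomial.X + Polynomial.C z))) =
      algebraMap (Polynomial ℂ) (RatFunc ℂ) q := by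
  induction q using Polynomial.induction_on with
  | C c => rw [Polynomial.C_comp, RatFunc.algebraMap_C, ratShift_C]
  | add p q hp hq => rw [Polynomial.add_comp, map_add, map_add, map_add, hp, hq]
  | monomial i c h =>
    rw [pow_succ', mul_left_comm, Polynomial.mul_comp, map_mul, ratShift_mul, h, Polynomial.X_comp,
      map_add, map_add, RatFunc.algebraMap_X, RatFunc.algebraMap_C, ratShift_X, ratShift_C,
      sub_add_cancel, map_mul (algebraMap _ (RatFunc ℂ)) Polynomial.X, RatFunc.algebraMap_X]

/-- The pole-free case of the converse. Here `A = B`, and this common series is a polynomial `q(x₁)`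
because `A` is bounded above and `B` below. The polynomial sought is `q(x + z)`, so that the shift
gives `q` back. -/
theorem ThreeTerm.exists_polynomial (hz : z ≠ 0) {F : LaurentSeries ℂ} {A B : ℤ → ℂ}
    (h : ThreeTerm z F.coeff A B) {m : ℕ} (hf : ∀ n < 0, F.coeff n = 0)
    (hB : ∀ n < 0, B n = 0) (hA : ∀ n : ℤ, m < n → A n = 0) :
    ∃ p : Polynomial ℂ, p.natDegree ≤ m ∧ F = iotaZero (algebraMap _ (RatFunc ℂ) p) ∧
      A = iotaInf (ratShift z (algebraMap _ (RatFunc ℂ) p)) ∧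
      B = (iotaZero (ratShift z (algebraMap _ (RatFunc ℂ) p))).coeff := by
  obtain rfl := h.eq_of_nonneg hf
  let q : Polynomial ℂ := ∑ i ∈ Finset.range (m + 1), Polynomial.monomial i (A i)
  have hq (i : ℕ) : q.coeff i = A i := by
    simp only [q, Polynomial.finsetSum_coeff, Polynomial.coeff_monomial, Finset.sum_ite_eq']
    rw [ite_eq_left_iff, Finset.mem_range]
    intro hi
    exact (hA _ (by omega)).symm
  have hq' (n : ℤ) : A n = if 0 ≤ n then q.coeff n.toNat else 0 := by
    split_ifs with hn
    · rw [hq, Int.toNat_of_nonneg hn]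
    · exact hB n (by omega)
  have hd : q.natDegree ≤ m := by
    refine Polynomial.natDegree_le_iff_coeff_eq_zero.2 fun i hi => ?_
    rw [hq, hA _ (by exact_mod_cast hi)]
  refine ⟨q.comp (Polynomial.X + Polynomial.C z), ?_, ?_, ?_, ?_⟩
  · rw [Polynomial.natDegree_comp, Polynomial.natDegree_X_add_C, mul_one]
    exact hd
  · have h' := isThreeTerm_polynomial hz (q.comp (Polynomial.X + Polynomial.C z))
    rw [IsThreeTerm, ratShift_algebraMap_comp] at h'
    -- In the difference between the given identity and that of `q(x + z)`, the two series on the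
    -- right vanish; then so does the one on the left.
    have h'' := h.add_smul h' (-1)
    have e₁ : (fun j => A j + -1 * iotaInf (algebraMap _ (RatFunc ℂ) q) j) = 0 := by
      funext j
      rw [iotaInf_algebraMap, ← hq']
      simp
    have e₂ : (fun j => A j + -1 * (iotaZero (algebraMap _ (RatFunc ℂ) q)).coeff j) = 0 := by
      funext j
      rw [coeff_iotaZero_algebraMap, ← hq']
      simp
    rw [e₁, e₂] at h''
    ext j
    have := congrFun (h''.eq_zero hz) j
    simp only [Pi.zero_apply] at this
    linear_combination this
  · rw [ratShift_algebraMap_comp]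
    funext n
    rw [iotaInf_algebraMap, hq']
  · rw [ratShift_algebraMap_comp]
    funext n
    rw [coeff_iotaZero_algebraMap, hq']

/-- Multiplication by `x₁` keeps `f = 0` and removes the negative powers of `B` one at a time. In
the pole-free case `A` and `B` come from a polynomial whose expansion at 0 is `f = 0`. -/
theorem ThreeTerm.eq_zero_of_left (hz : z ≠ 0) {A B : ℤ → ℂ} (h : ThreeTerm z 0 A B) :
    A = 0 ∧ B = 0 := by
  obtain ⟨n₀, hn⟩ := h.lower'
  obtain ⟨l, hl⟩ : ∃ l : ℕ, ∀ n < -(l : ℤ), B n = 0 := ⟨(-n₀).toNat, fun n hn' => hn n (by omega)⟩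
  clear hn
  induction l generalizing A B with
  | zero =>
    obtain ⟨n₁, hn⟩ := h.upper
    obtain ⟨p, -, h0, rfl, rfl⟩ := ThreeTerm.exists_polynomial hz (F := 0) (m := n₁.toNat) h
      (fun n hn => rfl) (by simpa using hl) (fun n hn' => hn n (by omega))
    have : algebraMap _ (RatFunc ℂ) p = 0 := iotaZero_injective (by rw [← h0, map_zero])
    rw [this]
    simp only [map_zero, true_and]
    rfl
  | succ l ih =>
    have h' := (threeTerm_mul_snd hz h.lower h.upper h.lower').2 h
    obtain ⟨h₁, h₂⟩ := ih (A := fun j => A (j - 1)) (B := fun j => B (j - 1))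
      (by convert h' using 1; funext j; simp) (fun n hn => hl _ (by push_cast; omega))
    refine ⟨funext fun n => ?_, funext fun n => ?_⟩
    · simpa using congrFun h₁ (n + 1)
    · simpa using congrFun h₂ (n + 1)

/-- The lower bound of `f` controls the pole at 0, that of `B` the pole at `-z`, and the upper bound
of `A` the pole at ∞. Multiplying `k` times by `x₀` and `l` times by `x₁` reduces to
`ThreeTerm.exists_polynomial`. -/
theorem ThreeTerm.exists_fraction (hz : z ≠ 0) {F : LaurentSeries ℂ} {A B : ℤ → ℂ}
    (h : ThreeTerm z F.coeff A B) {k l m : ℕ} (hf : ∀ n < -(k : ℤ), F.coeff n = 0)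
    (hB : ∀ n < -(l : ℤ), B n = 0) (hA : ∀ n : ℤ, m < n → A n = 0) :
    ∃ p : Polynomial ℂ, p.natDegree ≤ k + l + m ∧ F = iotaZero (algebraMap _ (RatFunc ℂ) p /
      (RatFunc.X ^ k * (RatFunc.X + RatFunc.C z) ^ l)) := by
  have hX := RatFunc.X_ne_zero (K := ℂ)
  have hXz := X_add_C_ne_zero z
  have hmul (r : RatFunc ℂ) (hr : r ≠ 0) : iotaZero r ≠ 0 := fun h0 =>
    hr (iotaZero_injective (by rw [h0, map_zero]))
  induction k generalizing F A B m with
  | zero =>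
    induction l generalizing F A B m with
    | zero =>
      obtain ⟨p, hp, e, -⟩ := h.exists_polynomial hz (by simpa using hf) (by simpa using hB) hA
      exact ⟨p, by simpa using hp, by simpa using e⟩
    | succ l ih =>
      have h' := (threeTerm_mul_snd hz h.lower h.upper h.lower').2 h
      have e : (iotaZero (RatFunc.X + RatFunc.C z) * F).coeff =
          fun j => F.coeff (j - 1) + z * F.coeff j := by
        ext j
        rw [map_add, add_mul, HahnSeries.coeff_add, iotaZero_X, iotaZero_C]
        have := HahnSeries.coeff_single_mul_add (r := (1 : ℂ)) (x := F) (a := j - 1) (b := (1 : ℤ))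
        rw [sub_add_cancel, one_mul] at this
        rw [this]
        simp
      rw [← e] at h'
      -- `A` becomes `x₁ A`, so its degree bound grows by one; this makes up for the decrease of `l`
      -- in the bound on the degree of `p`.
      obtain ⟨p, hp, h₁⟩ := ih (m := m + 1) h' (fun n hn => by
          rw [e]
          simp only [Nat.cast_zero, neg_zero] at hf hn
          simp only [hf n hn, hf (n - 1) (by omega)]
          simp) (fun n hn => hB _ (by push_cast; omega))
        (fun n hn => hA _ (by push_cast at hn; omega))
      refine ⟨p, by omega, mul_left_cancel₀ (hmul _ hXz) ?_⟩
      rw [h₁, ← iotaZero_mul]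
      congr 1
      field_simp
      ring
  | succ k ih =>
    have h' := (threeTerm_mul_fst hz h.lower h.upper h.lower').2 h
    have e : (iotaZero RatFunc.X * F).coeff = fun j => F.coeff (j - 1) := by
      ext j
      rw [iotaZero_X]
      have := HahnSeries.coeff_single_mul_add (r := (1 : ℂ)) (x := F) (a := j - 1) (b := (1 : ℤ))
      rwa [sub_add_cancel, one_mul] at this
    rw [← e] at h'
    -- `A` becomes `(x₁ - z) A`, so again one degree is gained while `k` drops by one.
    obtain ⟨p, hp, h₁⟩ := ih (m := m + 1) h' (fun n hn => by
        rw [e]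
        exact hf _ (by push_cast; omega))
      (fun n hn => by simp only [hB n hn, hB (n - 1) (by omega)]; simp)
      (fun n hn => by
        push_cast at hn
        simp only [hA n (by omega), hA (n - 1) (by omega)]; simp)
    refine ⟨p, by omega, mul_left_cancel₀ (hmul _ hX) ?_⟩
    rw [h₁, ← iotaZero_mul]
    congr 1
    field_simp
    ring

/-- The left series is the expansion of a fraction, and that fraction has a three-term identity with
the same left series. Since `f` determines `A` and `B`, the two identities coincide. -/
theorem ThreeTerm.shift_eq (hz : z ≠ 0) {F : LaurentSeries ℂ} {A B : ℤ → ℂ}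
    (h : ThreeTerm z F.coeff A B) : shiftInf z F = A ∧ shiftZero z F = B := by
  obtain ⟨a, ha⟩ := h.lower
  obtain ⟨b, hb⟩ := h.lower'
  obtain ⟨c, hc⟩ := h.upper
  obtain ⟨p, -, e⟩ := h.exists_fraction hz (k := (-a).toNat) (l := (-b).toNat) (m := c.toNat)
    (fun n hn => ha n (by omega)) (fun n hn => hb n (by omega)) (fun n hn => hc n (by omega))
  have h' := isThreeTerm_div hz p (-a).toNat (-b).toNat
  rw [IsThreeTerm, ← e] at h'
  have h'' := h.add_smul h' (-1)
  rw [show (fun j => F.coeff j + -1 * F.coeff j) = 0 by funext j; simp] at h''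
  obtain ⟨h₁, h₂⟩ := h''.eq_zero_of_left hz
  constructor
  · funext n
    have := congrFun h₁ n
    rw [e, shiftInf, LinearMap.comp_apply, LinearMap.comp_apply, ratOf_iotaZero]
    simp only [Pi.zero_apply] at this
    linear_combination -this
  · funext n
    have := congrFun h₂ n
    rw [e]
    show (iotaZero (ratShift z (ratOf _))).coeff n = _
    rw [ratOf_iotaZero]
    simp only [Pi.zero_apply] at this
    linear_combination -this

/-- `ratOf` is an arbitrary linear extension outside the expansions of rational functions, so
membership of `F` among these has to be given explicitly. -/
theorem threeTerm_shift (hz : z ≠ 0) (p : Polynomial ℂ) (k l : ℕ) {F : LaurentSeries ℂ}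
    (hF : F = iotaZero (algebraMap _ (RatFunc ℂ) p /
      (RatFunc.X ^ k * (RatFunc.X + RatFunc.C z) ^ l))) :
    ThreeTerm z F.coeff (shiftInf z F) (shiftZero z F) := by
  have h := isThreeTerm_div hz p k l
  have e₁ : shiftInf z F = iotaInf (ratShift z (algebraMap _ (RatFunc ℂ) p /
      (RatFunc.X ^ k * (RatFunc.X + RatFunc.C z) ^ l))) := by
    rw [hF, shiftInf, LinearMap.comp_apply, LinearMap.comp_apply, ratOf_iotaZero]
  have e₂ : shiftZero z F = (iotaZero (ratShift z (algebraMap _ (RatFunc ℂ) p /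
      (RatFunc.X ^ k * (RatFunc.X + RatFunc.C z) ^ l)))).coeff := by
    funext n
    rw [hF]
    show (iotaZero (ratShift z (ratOf _))).coeff n = _
    rw [ratOf_iotaZero]
  rw [e₁, e₂, hF]
  exact h

end rational

/-! ### The opposite is an involution -/

section opposite

variable {V : Type v} [AddCommGroup V] [Module ℂ V]
variable {X : Type*} [AddCommGroup X] [Module ℂ X] {𝒱 : VOA V}

theorem exists_L1_pow_eq_zero (h : ℤ) : ∃ K : ℕ, ∀ v ∈ 𝒱.wt h, ∀ i : ℕ, K ≤ i →
    ((Lop 𝒱.toVOAData 𝒱.Y 1) ^ i) v = 0 := by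
  obtain ⟨n₀, hn⟩ := 𝒱.bounded
  refine ⟨(h - n₀ + 1).toNat, fun v hv i hi => ?_⟩
  have hm := L1_pow_mem 𝒱 h hv i
  rwa [VOA.wt, hn _ (by omega), Submodule.mem_bot] at hm

theorem opp_of_mem (G : V →ₗ[ℂ] (ℤ → X)) {h : ℤ} {v : V} (hv : v ∈ 𝒱.wt h) {K : ℕ}
    (hK : ∀ i : ℕ, K ≤ i → ((Lop 𝒱.toVOAData 𝒱.Y 1) ^ i) v = 0) (n : ℤ) :
    opp 𝒱 G v n = ∑ i ∈ Finset.range K, ((-1 : ℂ) ^ h * ((i.factorial : ℂ))⁻¹) •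
      G (((Lop 𝒱.toVOAData 𝒱.Y 1) ^ i) v) (i - 2 * h - n) := by
  have e : theta 𝒱 v = ∑ i ∈ Finset.range K, Finsupp.single ((i : ℤ) - 2 * h)
      (((-1 : ℂ) ^ h * ((i.factorial : ℂ))⁻¹) • ((Lop 𝒱.toVOAData 𝒱.Y 1) ^ i) v) := by
    rw [theta_of_mem 𝒱 h ⟨v, hv⟩]
    refine finsum_eq_finsetSum_of_support_subset _ fun i hi => ?_
    by_contra hn
    apply hi
    simp only [Finset.coe_range, Set.mem_Iio, not_lt] at hn
    simp only [hK i hn, smul_zero, Finsupp.single_zero]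
  rw [opp, LinearMap.pi_apply, LinearMap.comp_apply, e, map_sum]
  refine Finset.sum_congr rfl fun i _ => ?_
  simp

/-- The coefficient of `x ^ m` in `e^{-x} e^x = 1`. -/
theorem sum_neg_one_pow_div_factorial (m : ℕ) :
    ∑ k ∈ Finset.range (m + 1), (-1 : ℂ) ^ k * ((k.factorial : ℂ)⁻¹ * ((m - k).factorial : ℂ)⁻¹) =
      if m = 0 then 1 else 0 := by
  have h := congrArg (Int.cast : ℤ → ℂ) (Int.alternating_sum_range_choose (n := m))
  push_cast at h
  have hm : (m.factorial : ℂ) ≠ 0 := by exact_mod_cast m.factorial_ne_zero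
  rw [← mul_right_inj' hm, Finset.mul_sum]
  have e : ∀ k ∈ Finset.range (m + 1), (m.factorial : ℂ) *
      ((-1 : ℂ) ^ k * ((k.factorial : ℂ)⁻¹ * ((m - k).factorial : ℂ)⁻¹)) =
      (-1) ^ k * (m.choose k : ℂ) := by
    intro k hk
    rw [Nat.cast_choose ℂ (by simpa [Nat.lt_succ_iff] using hk)]
    have h1 : (k.factorial : ℂ) ≠ 0 := by exact_mod_cast k.factorial_ne_zero
    have h2 : ((m - k).factorial : ℂ) ≠ 0 := by exact_mod_cast (m - k).factorial_ne_zero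
    field_simp
  rw [Finset.sum_congr rfl e, h]
  by_cases h0 : m = 0 <;> simp [h0]

/-- On weight `h` the double opposite is a double sum of terms with `L(1)^(i + j) v`. The two signs
`(-1)^h` and `(-1)^(h - i)` combine to `(-1)^i`, and the exponential series `e^{-x L(1)}` and `e^{x
L(1)}` cancel. -/
theorem opp_opp (G : V →ₗ[ℂ] (ℤ → X)) : opp 𝒱 (opp 𝒱 G) = G := by
  ext v n
  refine 𝒱.induction (p := fun v => opp 𝒱 (opp 𝒱 G) v n = G v n) v (by simp) ?_ ?_
  · intro u v hu hv
    rw [map_add, map_add, Pi.add_apply, Pi.add_apply, hu, hv]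
  · intro h v hv
    obtain ⟨K, hK'⟩ := exists_L1_pow_eq_zero (𝒱 := 𝒱) h
    have hK := hK' v hv
    rw [opp_of_mem _ hv hK]
    -- The inner opposite is taken of a vector of weight `h - i`, which changes the sign and leaves
    -- only `K - i` terms.
    have e (i : ℕ) : opp 𝒱 G (((Lop 𝒱.toVOAData 𝒱.Y 1) ^ i) v) (i - 2 * h - n) =
        ∑ j ∈ Finset.range (K - i), ((-1 : ℂ) ^ (h - i) * ((j.factorial : ℂ))⁻¹) •
          G (((Lop 𝒱.toVOAData 𝒱.Y 1) ^ (i + j)) v) ((i + j : ℕ) + n) := by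
      rw [opp_of_mem (K := K - i) _ (L1_pow_mem 𝒱 h hv i)]
      · refine Finset.sum_congr rfl fun j _ => ?_
        rw [← Module.End.mul_apply, ← pow_add, add_comm j i]
        rw [show (j : ℤ) - 2 * (h - i) - (i - 2 * h - n) = (i + j : ℕ) + n by push_cast; ring]
      · intro j hj
        rw [← Module.End.mul_apply, ← pow_add]
        exact hK _ (by omega)
    simp only [e, Finset.smul_sum, smul_smul]
    -- Collect the terms by `m = i + j`, the total power of `L(1)`.
    rw [← Finset.sum_range_diag_flip K fun i j => ((-1 : ℂ) ^ h * ((i.factorial : ℂ))⁻¹ *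
      ((-1 : ℂ) ^ (h - i) * ((j.factorial : ℂ))⁻¹)) •
        G (((Lop 𝒱.toVOAData 𝒱.Y 1) ^ (i + j)) v) ((i + j : ℕ) + n)]
    have e₂ : ∀ m ∈ Finset.range K, ∑ k ∈ Finset.range (m + 1), ((-1 : ℂ) ^ h *
        ((k.factorial : ℂ))⁻¹ * ((-1 : ℂ) ^ (h - k) * (((m - k).factorial : ℂ))⁻¹)) •
        G (((Lop 𝒱.toVOAData 𝒱.Y 1) ^ (k + (m - k))) v) ((k + (m - k) : ℕ) + n) =
        if m = 0 then G v n else 0 := by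
      intro m _
      have e₃ : ∀ k ∈ Finset.range (m + 1), ((-1 : ℂ) ^ h *
          ((k.factorial : ℂ))⁻¹ * ((-1 : ℂ) ^ (h - k) * (((m - k).factorial : ℂ))⁻¹)) •
          G (((Lop 𝒱.toVOAData 𝒱.Y 1) ^ (k + (m - k))) v) ((k + (m - k) : ℕ) + n) =
          ((-1 : ℂ) ^ k * ((k.factorial : ℂ)⁻¹ * ((m - k).factorial : ℂ)⁻¹)) •
          G (((Lop 𝒱.toVOAData 𝒱.Y 1) ^ m) v) (m + n) := by
        intro k hk
        rw [Nat.add_sub_cancel' (by simpa [Nat.lt_succ_iff] using hk)]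
        congr 1
        have h1 : (-1 : ℂ) ≠ 0 := by norm_num
        rw [zpow_sub₀ h1, zpow_natCast]
        have h2 : (-1 : ℂ) ^ h * (-1) ^ h = 1 := by rw [← mul_zpow]; simp
        have h3 : (-1 : ℂ) ^ k * (-1) ^ k = 1 := by rw [← mul_pow]; simp
        have h4 : ((-1 : ℂ) ^ k)⁻¹ = (-1) ^ k := inv_eq_of_mul_eq_one_left h3
        rw [div_eq_mul_inv, h4]
        linear_combination ((k.factorial : ℂ))⁻¹ * (((m - k).factorial : ℂ))⁻¹ * (-1) ^ k * h2
      rw [Finset.sum_congr rfl e₃, ← Finset.sum_smul, sum_neg_one_pow_div_factorial]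
      by_cases h0 : m = 0
      · subst h0; simp
      · simp [h0]
    rw [Finset.sum_congr rfl e₂, Finset.sum_ite_eq']
    split_ifs with h0
    · rfl
    -- The term `m = 0` is missing only if `K = 0`, and then `v = 0`.
    · have := hK 0 (by simpa using h0)
      simp only [pow_zero, Module.End.one_apply] at this
      simp [this]

theorem vac_mem_wt (𝒱 : VOA V) : 𝒱.vac ∈ 𝒱.wt 0 := by
  rw [VOA.wt, Module.End.mem_eigenspace_iff]
  simp [Lop, 𝒱.creation _ 1 (by norm_num)]

/-- The vacuum has weight 0 and is annihilated by `L(1)`, so only `x ↦ x⁻¹` remains. -/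
theorem opp_vac (G : V →ₗ[ℂ] (ℤ → X)) (n : ℤ) : opp 𝒱 G 𝒱.vac n = G 𝒱.vac (-n) := by
  rw [opp_of_mem (K := 1) G (vac_mem_wt 𝒱)]
  · simp
  · intro i hi
    obtain ⟨i, rfl⟩ := Nat.exists_eq_add_of_le' hi
    rw [pow_succ, Module.End.mul_apply, Lop, 𝒱.creation _ _ (by norm_num), map_zero]

variable {M : Type w} [AddCommGroup M] [Module ℂ M]

theorem coef_contraY_vac {Y : V →ₗ[ℂ] VertexOperator ℂ M} (hY : IsOrdinary 𝒱.toVOAData Y) (n : ℤ)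
    (g : restrictedDual 𝒱.toVOAData Y) :
    coef (contraY hY) 𝒱.vac n g = if n = 0 then g else 0 := by
  apply Subtype.ext
  ext x
  rw [coef_contraY, opp_vac, hY.weak.vacuum]
  by_cases h : n = 0 <;> simp [h]

theorem opp_comp {X' : Type*} [AddCommGroup X'] [Module ℂ X'] (G : V →ₗ[ℂ] (ℤ → X))
    (G' : V →ₗ[ℂ] (ℤ → X')) (f : X →ₗ[ℂ] X') (hf : ∀ v n, f (G v n) = G' v n) (v : V) (n : ℤ) :
    f (opp 𝒱 G v n) = opp 𝒱 G' v n := by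
  simp only [opp_apply, Finsupp.sum, map_sum, hf]

end opposite

/-! ### Iterated Laurent series in two variables -/

section doubleSeries

/-- Iterated Laurent series: Laurent series in the outer variable `y` whose coefficients are Laurent
series in the inner variable `x`. -/
def DoubleLaurent : Type := HahnSeries ℤ (LaurentSeries ℂ)

/-- In this field a negative power of `x + c y` is automatically its expansion in nonnegative powers
of the outer variable `y`, as the delta function convention requires. -/
instance : Field DoubleLaurent := inferInstanceAs (Field (HahnSeries ℤ (LaurentSeries ℂ)))

namespace DoubleLaurent

/-- The coefficient of `y ^ a x ^ b`. -/
def cf (F : DoubleLaurent) (a b : ℤ) : ℂ := (HahnSeries.coeff F a).coeff b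

/-- The outer variable. -/
def yv : DoubleLaurent := (HahnSeries.single 1 1 : HahnSeries ℤ (LaurentSeries ℂ))

/-- The inner variable. -/
def xv : DoubleLaurent :=
  (HahnSeries.C (HahnSeries.single 1 1 : LaurentSeries ℂ) : HahnSeries ℤ (LaurentSeries ℂ))

theorem ext_cf {F G : DoubleLaurent} (h : ∀ a b, cf F a b = cf G a b) : F = G := by
  refine HahnSeries.ext (funext fun a => HahnSeries.ext (funext fun b => ?_))
  exact h a b

@[simp] theorem cf_add (F G : DoubleLaurent) (a b : ℤ) : cf (F + G) a b = cf F a b + cf G a b := rfl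

@[simp] theorem cf_zero (a b : ℤ) : cf 0 a b = 0 := rfl

@[simp] theorem cf_sub (F G : DoubleLaurent) (a b : ℤ) : cf (F - G) a b = cf F a b - cf G a b := by
  rw [eq_sub_iff_add_eq, ← cf_add, sub_add_cancel]

@[simp] theorem cf_neg (F : DoubleLaurent) (a b : ℤ) : cf (-F) a b = -cf F a b := by
  rw [← zero_sub, cf_sub, cf_zero, zero_sub]

/-- The coefficient of `y ^ a x ^ b`, as an additive map. -/
def cfHom (a b : ℤ) : DoubleLaurent →+ ℂ where
  toFun F := cf F a b
  map_zero' := rfl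
  map_add' _ _ := rfl

theorem cf_sum {ι : Type*} (s : Finset ι) (F : ι → DoubleLaurent) (a b : ℤ) :
    cf (∑ i ∈ s, F i) a b = ∑ i ∈ s, cf (F i) a b := map_sum (cfHom a b) F s

/-- Scalars as double series. -/
def const (c : ℂ) : DoubleLaurent := 
  (HahnSeries.C (HahnSeries.C c : LaurentSeries ℂ) : HahnSeries ℤ (LaurentSeries ℂ))

theorem cf_const_mul (c : ℂ) (F : DoubleLaurent) (a b : ℤ) :
    cf (const c * F) a b = c * cf F a b := by
  show (HahnSeries.coeff ((HahnSeries.C (HahnSeries.C c : LaurentSeries ℂ) :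
    HahnSeries ℤ (LaurentSeries ℂ)) * (id F : HahnSeries ℤ (LaurentSeries ℂ))) a).coeff b = _
  rw [HahnSeries.C_mul_eq_smul, HahnSeries.coeff_smul, smul_eq_mul, HahnSeries.C_mul_eq_smul]
  rfl

theorem cf_one (a b : ℤ) : cf 1 a b = if a = 0 ∧ b = 0 then 1 else 0 := by
  show (HahnSeries.coeff (1 : HahnSeries ℤ (LaurentSeries ℂ)) a).coeff b = _
  rw [HahnSeries.coeff_one]
  by_cases ha : a = 0
  · by_cases hb : b = 0 <;> simp [ha, hb, HahnSeries.coeff_one]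
  · simp [ha]

theorem cf_yv_mul (F : DoubleLaurent) (a b : ℤ) : cf (yv * F) a b = cf F (a - 1) b := by
  have := HahnSeries.coeff_single_mul_add (r := (1 : LaurentSeries ℂ))
    (x := (F : HahnSeries ℤ (LaurentSeries ℂ))) (a := a - 1) (b := (1 : ℤ))
  rw [sub_add_cancel, one_mul] at this
  exact congrArg (fun f : LaurentSeries ℂ => f.coeff b) this

theorem cf_xv_mul (F : DoubleLaurent) (a b : ℤ) : cf (xv * F) a b = cf F a (b - 1) := by
  have := HahnSeries.coeff_single_mul_add (r := (1 : ℂ)) (x := HahnSeries.coeff F a) (a := b - 1)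
    (b := (1 : ℤ))
  rw [sub_add_cancel, one_mul] at this
  show (HahnSeries.coeff ((HahnSeries.C (HahnSeries.single 1 1 : LaurentSeries ℂ) :
    HahnSeries ℤ (LaurentSeries ℂ)) * (id F : HahnSeries ℤ (LaurentSeries ℂ))) a).coeff b = _
  rw [HahnSeries.C_mul_eq_smul, HahnSeries.coeff_smul, smul_eq_mul]
  exact this

theorem yv_ne_zero : yv ≠ 0 := by
  intro h
  have := cf_yv_mul 1 1 0
  rw [h, zero_mul, cf_one] at this
  simp at this

theorem xv_ne_zero : xv ≠ 0 := by
  intro h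
  have := cf_xv_mul 1 0 1
  rw [h, zero_mul, cf_one] at this
  simp at this

theorem xv_add_ne_zero (c : ℂ) : xv + const c * yv ≠ 0 := by
  intro h
  have h0 : cf ((xv + const c * yv) * 1) 0 1 = 0 := by rw [h, zero_mul]; rfl
  rw [add_mul, cf_add, cf_xv_mul, mul_assoc, cf_const_mul, cf_yv_mul, cf_one, cf_one] at h0
  simp at h0

theorem cf_yv_zpow_mul (k : ℤ) (F : DoubleLaurent) (a b : ℤ) :
    cf (yv ^ k * F) a b = cf F (a - k) b := by
  induction k using Int.induction_on generalizing F a with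
  | zero => simp
  | succ k ih =>
    rw [zpow_add_one₀ yv_ne_zero, mul_assoc, ih, cf_yv_mul]
    congr 1; ring
  | pred k ih =>
    have := ih (yv⁻¹ * F) (a + 1)
    rw [← mul_assoc, ← zpow_sub_one₀ yv_ne_zero] at this
    have h' := cf_yv_mul (yv ^ (-(k : ℤ) - 1) * F) (a + 1) b
    rw [add_sub_cancel_right, ← mul_assoc, ← zpow_one_add₀ yv_ne_zero, add_sub_cancel, ih] at h'
    rw [← h']
    congr 1; ring

theorem cf_xv_zpow_mul (k : ℤ) (F : DoubleLaurent) (a b : ℤ) :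
    cf (xv ^ k * F) a b = cf F a (b - k) := by
  induction k using Int.induction_on generalizing F b with
  | zero => simp
  | succ k ih =>
    rw [zpow_add_one₀ xv_ne_zero, mul_assoc, ih, cf_xv_mul]
    congr 1; ring
  | pred k ih =>
    have h' := cf_xv_mul (xv ^ (-(k : ℤ) - 1) * F) a (b + 1)
    rw [add_sub_cancel_right, ← mul_assoc, ← zpow_one_add₀ xv_ne_zero, add_sub_cancel, ih] at h'
    rw [← h']
    congr 1; ring

theorem exists_cf_eq_zero (F : DoubleLaurent) : ∃ n₀ : ℕ, ∀ a < -(n₀ : ℤ), ∀ b, cf F a b = 0 := by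
  refine ⟨(-(HahnSeries.order (F : HahnSeries ℤ (LaurentSeries ℂ)))).toNat, fun a ha b => ?_⟩
  have : HahnSeries.coeff (F : HahnSeries ℤ (LaurentSeries ℂ)) a = 0 :=
    HahnSeries.coeff_eq_zero_of_lt_order (by omega)
  rw [cf, this]
  rfl

/-- The binomial sum giving the coefficients of `(x + c y) ^ m F`. -/
def binomSum (c : ℂ) (m : ℤ) (F : DoubleLaurent) (a b : ℤ) : ℂ :=
  ∑ᶠ i : ℕ, c ^ i * (Ring.choose m i : ℤ) * cf F (a - i) (b + i)

theorem finite_binomSum (g : ℕ → ℂ) (F : DoubleLaurent) (a b : ℤ) :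
    Function.HasFiniteSupport fun i : ℕ => g i * cf F (a - i) (b + i) := by
  obtain ⟨n₀, h⟩ := exists_cf_eq_zero F
  exact finite_of_eventually _ (a + n₀ + 1) fun i hi => by rw [h _ (by omega), mul_zero]

theorem finsum_nat_succ {g : ℕ → ℂ} (hg : g.HasFiniteSupport) :
    ∑ᶠ i, g i = g 0 + ∑ᶠ i, g (i + 1) := by
  have hs := Set.Finite.bddAbove hg
  obtain ⟨K, hK⟩ := hs
  have h0 (i : ℕ) (hi : K < i) : g i = 0 := by
    by_contra hne
    exact absurd (hK hne) (by omega)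
  rw [finsum_eq_finsetSum_of_support_subset (s := Finset.range (K + 2)),
    finsum_eq_finsetSum_of_support_subset (s := Finset.range (K + 1)), Finset.sum_range_succ',
    add_comm]
  · intro i hi
    by_contra hn
    simp only [Finset.coe_range, Set.mem_Iio, not_lt] at hn
    exact hi (h0 _ (by omega))
  · intro i hi
    by_contra hn
    simp only [Finset.coe_range, Set.mem_Iio, not_lt] at hn
    exact hi (h0 _ (by omega))

/-- Pascal's rule, summed over `i`. -/
theorem binomSum_succ (c : ℂ) (m : ℤ) (F : DoubleLaurent) (a b : ℤ) :
    binomSum c (m + 1) F a b = binomSum c m ((xv + const c * yv) * F) a (b + 1) := by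
  have e₁ (i : ℕ) : cf ((xv + const c * yv) * F) (a - i) (b + 1 + i) =
      cf F (a - i) (b + i) + c * cf F (a - (i + 1 : ℕ)) (b + (i + 1 : ℕ)) := by
    rw [add_mul, cf_add, cf_xv_mul, mul_assoc, cf_const_mul, cf_yv_mul]
    rw [show b + 1 + (i : ℤ) - 1 = b + i by ring, show a - (i : ℤ) - 1 = a - (i + 1 : ℕ) by
      push_cast; ring, show b + 1 + (i : ℤ) = b + (i + 1 : ℕ) by push_cast; ring]
  have f₁ := finite_binomSum (fun i => c ^ i * (Ring.choose m i : ℤ)) F a b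
  have e₂ (i : ℕ) : cf F (a - (i + 1 : ℕ)) (b + (i + 1 : ℕ)) = cf F (a - 1 - i) (b + 1 + i) := by
    rw [show a - (i + 1 : ℕ) = a - 1 - i by push_cast; ring,
      show b + (i + 1 : ℕ) = b + 1 + i by push_cast; ring]
  have f₂ : Function.HasFiniteSupport fun i : ℕ => c ^ i * (Ring.choose m i : ℤ) *
      (c * cf F (a - (i + 1 : ℕ)) (b + (i + 1 : ℕ))) := by
    simp only [e₂, ← mul_assoc]
    exact finite_binomSum (fun i => c ^ i * (Ring.choose m i : ℤ) * c) F (a - 1) (b + 1)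
  rw [binomSum, binomSum]
  simp only [e₁, mul_add]
  rw [finsum_add_distrib f₁ f₂, finsum_nat_succ f₁, finsum_nat_succ (finite_binomSum _ F a b),
    add_assoc, ← finsum_add_distrib]
  · congr 1
    · simp
    · refine finsum_congr fun i => ?_
      rw [Ring.choose_succ_succ]
      push_cast
      ring
  · simp only [e₂]
    exact finite_binomSum (fun i => c ^ (i + 1) * (Ring.choose m (i + 1) : ℤ)) F (a - 1) (b + 1)
  · exact f₂

/-- The binomial theorem for integer exponents. For negative `m` no inverse series is written down:
`binomSum_succ` is applied to `(x + c y)⁻¹ F`. -/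
theorem cf_zpow_mul (c : ℂ) (m : ℤ) (F : DoubleLaurent) (a b : ℤ) :
    cf ((xv + const c * yv) ^ m * F) a b = binomSum c m F a (b - m) := by
  have h0 := xv_add_ne_zero c
  induction m using Int.induction_on generalizing F b with
  | zero =>
    rw [binomSum, finsum_eq_single _ 0 (fun i hi => by
      rw [Ring.choose_zero_pos ℤ (Nat.pos_of_ne_zero hi)]; simp)]
    simp
  | succ m ih =>
    rw [zpow_add_one₀ h0, mul_assoc, ih, binomSum_succ]
    congr 1; ring
  | pred m ih =>
    have h := binomSum_succ c (-(m : ℤ) - 1) ((xv + const c * yv)⁻¹ * F) a (b + m)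
    rw [mul_inv_cancel_left₀ h0, sub_add_cancel] at h
    rw [zpow_sub_one₀ h0, mul_assoc, ih, show b - -(m : ℤ) = b + m by ring, h]
    congr 1; ring

end DoubleLaurent

end doubleSeries

/-! ### Scalar solutions of the Jacobi identity form a ring -/

section jacobiTriples

open DoubleLaurent

/-- Triples `(P, Q, R)` of series in `((x₁))((x₂))`, `((x₂))((x₁))` and `((x₂))((x₀))`. The first variable
in each of these is the inner one. -/
abbrev JTriple : Type := DoubleLaurent × DoubleLaurent × DoubleLaurent

namespace JTriple

theorem sub_eq_add_const : xv - yv = xv + const (-1) * yv := by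
  refine ext_cf fun a b => ?_
  rw [cf_sub, cf_add, cf_const_mul]
  ring

theorem add_eq_add_const : xv + yv = xv + const 1 * yv := by
  refine ext_cf fun a b => ?_
  rw [cf_add, cf_add, cf_const_mul]
  ring

theorem xv_sub_yv_ne_zero : xv - yv ≠ 0 := sub_eq_add_const ▸ xv_add_ne_zero _

theorem yv_sub_xv_ne_zero : yv - xv ≠ 0 := by
  rw [← neg_sub]; exact neg_ne_zero.2 xv_sub_yv_ne_zero

theorem xv_add_yv_ne_zero : xv + yv ≠ 0 := add_eq_add_const ▸ xv_add_ne_zero _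

/-- The expansions of `x₀ ^ l x₁ ^ m x₂ ^ n`, where `x₀ = x₁ - x₂`. -/
def mon (l m n : ℤ) : JTriple :=
  ((xv - yv) ^ l * xv ^ m * yv ^ n, (yv - xv) ^ l * yv ^ m * xv ^ n,
    yv ^ l * (xv + yv) ^ m * xv ^ n)

theorem mon_mul (l m n l' m' n' : ℤ) :
    mon l m n * mon l' m' n' = mon (l + l') (m + m') (n + n') := by
  simp only [mon, Prod.mk_mul_mk, zpow_add₀ xv_sub_yv_ne_zero, zpow_add₀ yv_sub_xv_ne_zero,
    zpow_add₀ xv_add_yv_ne_zero, zpow_add₀ xv_ne_zero, zpow_add₀ yv_ne_zero]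
  refine Prod.ext ?_ (Prod.ext ?_ ?_) <;> dsimp only <;> ring

theorem mon_zero : mon 0 0 0 = 1 := by
  simp [mon]

/-- The obstruction to the residue form of the Jacobi identity. -/
def res : JTriple →+ ℂ where
  toFun t := cf t.2.2 (-1) (-1) - (cf t.1 (-1) (-1) - cf t.2.1 (-1) (-1))
  map_zero' := by simp
  map_add' s t := by simp only [Prod.fst_add, Prod.snd_add, cf_add]; ring

/-- The Jacobi identity for scalar series. -/
def IsJacobi (t : JTriple) : Prop := ∀ l m n : ℤ, res (mon l m n * t) = 0

theorem binomSum_xv_zpow_mul (c : ℂ) (m n : ℤ) (F : DoubleLaurent) (a b : ℤ) :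
    binomSum c m (xv ^ n * F) a b = binomSum c m F a (b - n) := by
  unfold binomSum
  refine finsum_congr fun i => ?_
  rw [cf_xv_zpow_mul, show b + (i : ℤ) - n = b - n + i by ring]

/-- The residue against `x₀ ^ l x₁ ^ m x₂ ^ n` is the component of the Jacobi identity with indices
`l, m, n`: each expanded monomial contributes one binomial sum. -/
theorem res_mon_mul (l m n : ℤ) (t : JTriple) : res (mon l m n * t) =
    binomSum 1 m t.2.2 (-1 - l) (-1 - m - n) - (binomSum (-1) l t.1 (-1 - n) (-1 - m - l) -
      (-1) ^ l * binomSum (-1) l t.2.1 (-1 - m) (-1 - n - l)) := by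
  have h₁ : cf (yv ^ l * (xv + yv) ^ m * xv ^ n * t.2.2) (-1) (-1) =
      binomSum 1 m t.2.2 (-1 - l) (-1 - m - n) := by
    rw [mul_assoc, mul_assoc, cf_yv_zpow_mul, add_eq_add_const, cf_zpow_mul, binomSum_xv_zpow_mul]
  have h₂ : cf ((xv - yv) ^ l * xv ^ m * yv ^ n * t.1) (-1) (-1) =
      binomSum (-1) l t.1 (-1 - n) (-1 - m - l) := by
    rw [show (xv - yv) ^ l * xv ^ m * yv ^ n * t.1 = yv ^ n * (xv ^ m * ((xv - yv) ^ l * t.1)) by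
      ring, cf_yv_zpow_mul, cf_xv_zpow_mul, sub_eq_add_const, cf_zpow_mul]
  have h₃ : cf ((yv - xv) ^ l * yv ^ m * xv ^ n * t.2.1) (-1) (-1) =
      (-1) ^ l * binomSum (-1) l t.2.1 (-1 - m) (-1 - n - l) := by
    have e : ∀ F : DoubleLaurent, ∀ a b, cf ((-1) ^ l * F) a b = (-1) ^ l * cf F a b := by
      intro F a b
      rcases Int.even_or_odd l with hl | hl
      · rw [hl.neg_one_zpow, hl.neg_one_zpow, one_mul, one_mul]
      · rw [hl.neg_one_zpow, hl.neg_one_zpow, neg_one_mul, neg_one_mul, cf_neg]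
    rw [show yv - xv = -1 * (xv - yv) by ring, mul_zpow, mul_assoc, mul_assoc, mul_assoc, e,
      show (xv - yv) ^ l * (yv ^ m * (xv ^ n * t.2.1)) = yv ^ m * (xv ^ n * ((xv - yv) ^ l * t.2.1))
        by ring, cf_yv_zpow_mul, cf_xv_zpow_mul, sub_eq_add_const, cf_zpow_mul]
  rw [← h₁, ← h₂, ← h₃]
  rfl

theorem IsJacobi.mon_mul {t : JTriple} (h : IsJacobi t) (l m n : ℤ) : IsJacobi (mon l m n * t) :=
  fun l' m' n' => by rw [← mul_assoc, JTriple.mon_mul]; exact h _ _ _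

/-- Monomials are invertible, so poles may be cleared freely. -/
theorem isJacobi_of_mon_mul {t : JTriple} {l m n : ℤ} (h : IsJacobi (mon l m n * t)) :
    IsJacobi t := by
  have := h.mon_mul (-l) (-m) (-n)
  rwa [← mul_assoc, JTriple.mon_mul, neg_add_cancel, neg_add_cancel, neg_add_cancel, mon_zero,
    one_mul] at this

theorem IsJacobi.add {s t : JTriple} (hs : IsJacobi s) (ht : IsJacobi t) : IsJacobi (s + t) :=
  fun l m n => by rw [mul_add, map_add, hs, ht, add_zero]

theorem IsJacobi.sub {s t : JTriple} (hs : IsJacobi s) (ht : IsJacobi t) : IsJacobi (s - t) :=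
  fun l m n => by rw [mul_sub, map_sub, hs, ht, sub_zero]

theorem IsJacobi.sum {ι : Type*} {s : Finset ι} {t : ι → JTriple} (h : ∀ i ∈ s, IsJacobi (t i)) :
    IsJacobi (∑ i ∈ s, t i) := fun l m n => by
  rw [Finset.mul_sum, map_sum]
  exact Finset.sum_eq_zero fun i hi => h i hi l m n

/-- Scalars as triples. -/
def scalar (c : ℂ) : JTriple := (const c, const c, const c)

theorem IsJacobi.scalar_mul {t : JTriple} (h : IsJacobi t) (c : ℂ) : IsJacobi (scalar c * t) :=
  fun l m n => by
    have e : res (scalar c * (mon l m n * t)) = c * res (mon l m n * t) := by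
      simp only [res, scalar, AddMonoidHom.coe_mk, ZeroHom.coe_mk, Prod.fst_mul, Prod.snd_mul,
        cf_const_mul]
      ring
    rw [mul_left_comm, e, h, mul_zero]

/-- The residue is homogeneous, so only `l + m + n = -2` matters, and there the claim is the delta
function identity `deltaOut_eq` at `z = 1`. -/
theorem isJacobi_one : IsJacobi 1 := fun l m n => by
  have key (c : ℂ) (k : ℤ) (a b : ℤ) : binomSum c k 1 a b =
      if 0 ≤ a ∧ a + b = 0 then c ^ a.toNat * (Ring.choose k a.toNat : ℤ) else 0 := by
    unfold binomSum
    rw [finsum_eq_single _ a.toNat]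
    · rw [cf_one]
      by_cases h : 0 ≤ a ∧ a + b = 0
      · rw [if_pos h, if_pos (by omega), mul_one]
      · rw [if_neg h, if_neg (by omega), mul_zero]
    · intro i hi
      rw [cf_one, if_neg (by omega), mul_zero]
  rw [res_mon_mul]
  show binomSum 1 m 1 _ _ - (binomSum (-1) l 1 _ _ - _ * binomSum (-1) l 1 _ _) = 0
  rw [key, key, key]
  by_cases hd : l + m + n = -2
  · have h := deltaOut_eq (z := 1) one_ne_zero (-1 - l) (-1 - m)
    unfold deltaOut deltaFst deltaSnd at h
    simp only [one_zpow, one_mul, mul_one] at h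
    -- Negation of the upper index: `choose (-(m - i + 1)) i = (-1)^i choose m i`.
    have e₁ : (if 0 ≤ -1 - l ∧ -1 - l + (-1 - m - n) = 0 then (1 : ℂ) ^ (-1 - l).toNat *
        (Ring.choose m (-1 - l).toNat : ℤ) else 0) =
        if 0 ≤ -1 - l then ((Ring.choose (-1 - l + (-1 - m)) (-1 - l).toNat : ℤ) : ℂ) *
          (-1) ^ (-1 - l) else 0 := by
      by_cases hl : 0 ≤ -1 - l
      · obtain ⟨i, hi⟩ := Int.eq_ofNat_of_zero_le hl
        rw [if_pos ⟨hl, by omega⟩, if_pos hl, hi, Int.toNat_natCast,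
          show (i : ℤ) + (-1 - m) = -(m - i + 1) by ring, Ring.choose_neg', Ring.multichoose_eq,
          show m - i + 1 + i - 1 = m by ring, zpow_natCast]
        rcases Nat.even_or_odd i with h | h
        · simp [h.neg_one_pow, Int.negOnePow_even (i : ℤ) (by exact_mod_cast h)]
        · simp [h.neg_one_pow, Int.negOnePow_odd (i : ℤ) (by exact_mod_cast h)]
      · rw [if_neg (by omega), if_neg (by omega)]
    rw [e₁, h]
    have e₂ : -(-1 - l) - 1 - (-1 - m) = -1 - n := by omega
    have e₃ : -(-1 - l) - 1 = l := by ring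
    rw [e₂, e₃]
    have e₄ : (if 0 ≤ -1 - n then ((Ring.choose l (-1 - n).toNat : ℤ) : ℂ) * (-1) ^ (-1 - n) else 0) =
        if 0 ≤ -1 - n ∧ -1 - n + (-1 - m - l) = 0 then
          (-1 : ℂ) ^ (-1 - n).toNat * (Ring.choose l (-1 - n).toNat : ℤ) else 0 := by
      by_cases hl : 0 ≤ -1 - n
      · rw [if_pos hl, if_pos ⟨hl, by omega⟩]
        obtain ⟨i, hi⟩ := Int.eq_ofNat_of_zero_le hl
        rw [hi, zpow_natCast, Int.toNat_natCast, mul_comm]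
      · rw [if_neg (by omega), if_neg (by omega)]
    have e₅ : (if 0 ≤ -1 - m then (-1 : ℂ) ^ l * (Ring.choose l (-1 - m).toNat : ℤ) *
        (-1) ^ (-1 - m) else 0) = (-1) ^ l * if 0 ≤ -1 - m ∧ -1 - m + (-1 - n - l) = 0 then
          (-1 : ℂ) ^ (-1 - m).toNat * (Ring.choose l (-1 - m).toNat : ℤ) else 0 := by
      by_cases hl : 0 ≤ -1 - m
      · rw [if_pos hl, if_pos ⟨hl, by omega⟩]
        obtain ⟨i, hi⟩ := Int.eq_ofNat_of_zero_le hl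
        rw [hi, zpow_natCast, Int.toNat_natCast]
        ring
      · rw [if_neg (by omega), if_neg (by omega), mul_zero]
    rw [e₄, e₅]
    ring
  · rw [if_neg (by omega), if_neg (by omega), if_neg (by omega)]
    ring

end JTriple

namespace DoubleLaurent

/-- All coefficients of total degree less than `K` vanish. -/
def DegGE (K : ℤ) (F : DoubleLaurent) : Prop := ∀ a b, a + b < K → cf F a b = 0

theorem finite_coeff_mul {R : Type*} [Ring R] (F G : HahnSeries ℤ R) (n : ℤ) :
    Function.HasFiniteSupport fun k : ℤ => F.coeff k * G.coeff (n - k) := by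
  refine (Set.finite_Icc F.order (n - G.order)).subset fun k hk => ?_
  by_contra hn
  rw [Set.mem_Icc, not_and_or, not_le, not_le] at hn
  apply hk
  rcases hn with hn | hn
  · simp [HahnSeries.coeff_eq_zero_of_lt_order hn]
  · simp [HahnSeries.coeff_eq_zero_of_lt_order (show n - k < G.order by omega)]

theorem coeff_mul_eq_finsum {R : Type*} [Ring R] (F G : HahnSeries ℤ R) (n : ℤ) :
    (F * G).coeff n = ∑ᶠ k : ℤ, F.coeff k * G.coeff (n - k) := by
  rw [HahnSeries.coeff_mul, finsum_eq_finsetSum_of_support_subset (s := (Finset.antidiagonal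
    F.isPWO_support G.isPWO_support n).image Prod.fst), Finset.sum_image]
  · refine Finset.sum_congr rfl fun ij hij => ?_
    rw [Finset.mem_antidiagonal] at hij
    rw [show n - ij.1 = ij.2 by omega]
  · intro a ha b hb hab
    simp only [Finset.mem_coe, Finset.mem_antidiagonal] at ha hb
    exact Prod.ext hab (by omega)
  · intro k hk
    simp only [Finset.coe_image, Set.mem_image, Finset.mem_coe, Finset.mem_antidiagonal]
    exact ⟨(k, n - k), ⟨left_ne_zero_of_mul hk, right_ne_zero_of_mul hk, by simp⟩, rfl⟩

theorem cf_mul (F G : DoubleLaurent) (a b : ℤ) :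
    cf (F * G) a b = ∑ᶠ (k : ℤ) (i : ℤ), cf F k i * cf G (a - k) (b - i) := by
  have h := coeff_mul_eq_finsum (R := LaurentSeries ℂ) F G a
  have h' := (HahnSeries.coeff.addMonoidHom (R := ℂ) b).map_finsum
    (finite_coeff_mul (R := LaurentSeries ℂ) F G a)
  rw [← h] at h'
  refine h'.trans (finsum_congr fun k => ?_)
  exact coeff_mul_eq_finsum _ _ _

theorem DegGE.mul {K L : ℤ} {F G : DoubleLaurent} (hF : DegGE K F) (hG : DegGE L G) :
    DegGE (K + L) (F * G) := fun a b hab => by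
  rw [cf_mul]
  refine finsum_eq_zero_of_forall_eq_zero fun k => finsum_eq_zero_of_forall_eq_zero fun i => ?_
  rcases lt_or_ge (k + i) K with h | h
  · rw [hF _ _ h, zero_mul]
  · rw [hG _ _ (by omega), mul_zero]

theorem DegGE.binomSum_eq_zero {K : ℤ} {F : DoubleLaurent} (hF : DegGE K F) (c : ℂ) (m a b : ℤ)
    (h : a + b < K) : binomSum c m F a b = 0 :=
  finsum_eq_zero_of_forall_eq_zero fun i => by rw [hF _ _ (by omega), mul_zero]

theorem binomSum_zero (c : ℂ) (F : DoubleLaurent) (a b : ℤ) : binomSum c 0 F a b = cf F a b := by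
  rw [binomSum, finsum_eq_single _ 0 (fun i hi => by
    rw [Ring.choose_zero_pos ℤ (Nat.pos_of_ne_zero hi)]; simp)]
  simp

end DoubleLaurent

namespace JTriple

/-- With `m = 0` the Jacobi identity expresses each coefficient of the third series through
coefficients of the first two of the same total degree. -/
theorem IsJacobi.degGE {t : JTriple} (h : IsJacobi t) {K : ℤ} (h₁ : DegGE K t.1)
    (h₂ : DegGE K t.2.1) : DegGE K t.2.2 := fun a b hab => by
  have := h (-1 - a) 0 (-1 - b)
  rw [res_mon_mul, binomSum_zero, h₁.binomSum_eq_zero _ _ _ _ (by omega),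
    h₂.binomSum_eq_zero _ _ _ _ (by omega)] at this
  simpa using this

/-- The triple comes from a power series in `x₁, x₂`. -/
structure IsNormal (t : JTriple) : Prop where
  isJacobi : IsJacobi t
  swap : ∀ a b, cf t.1 a b = cf t.2.1 b a
  supp : ∀ a b, a < 0 ∨ b < 0 → cf t.1 a b = 0

/-- A power of `x₀` removes the pole of the third series; the first two then agree as series in `x₁,
x₂` (weak commutativity). One of them is truncated in `x₂` and the other in `x₁`, so powers of `x₁`
and `x₂` move the common support into the quadrant. -/
theorem IsJacobi.exists_isNormal {t : JTriple} (h : IsJacobi t) :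
    ∃ l m n : ℤ, IsNormal (mon l m n * t) := by
  obtain ⟨N, hN⟩ := exists_cf_eq_zero t.2.2
  have hs := h.mon_mul N 0 0
  set s := mon N 0 0 * t with hsdef
  have hR (a b : ℤ) (ha : a < 0) : cf s.2.2 a b = 0 := by
    have : s.2.2 = yv ^ (N : ℤ) * t.2.2 := by simp [hsdef, mon]
    rw [this, cf_yv_zpow_mul]
    exact hN _ (by omega) _
  have hsw (a b : ℤ) : cf s.1 a b = cf s.2.1 b a := by
    -- For `l = 0` the third series enters only through negative powers of `x₀`, which it no longer
    -- has.
    have := hs 0 (-1 - b) (-1 - a)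
    rw [res_mon_mul, binomSum_zero, binomSum_zero, binomSum, finsum_eq_zero_of_forall_eq_zero
      (fun i => by rw [hR _ _ (by omega), mul_zero])] at this
    simp only [zpow_zero, sub_sub_cancel, sub_zero, one_mul, zero_sub, neg_eq_zero] at this
    exact sub_eq_zero.1 this
  obtain ⟨i, hi⟩ := exists_cf_eq_zero s.1
  obtain ⟨j, hj⟩ := exists_cf_eq_zero s.2.1
  have e₁ (a b : ℤ) : cf (mon 0 j i * s).1 a b = cf s.1 (a - i) (b - j) := by
    have : (mon 0 j i * s).1 = yv ^ (i : ℤ) * (xv ^ (j : ℤ) * s.1) := by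
      simp [mon]; ring
    rw [this, cf_yv_zpow_mul, cf_xv_zpow_mul]
  have e₂ (a b : ℤ) : cf (mon 0 j i * s).2.1 a b = cf s.2.1 (a - j) (b - i) := by
    have : (mon 0 j i * s).2.1 = yv ^ (j : ℤ) * (xv ^ (i : ℤ) * s.2.1) := by
      simp [mon]; ring
    rw [this, cf_yv_zpow_mul, cf_xv_zpow_mul]
  refine ⟨N, j, i, ?_⟩
  have e : mon N j i * t = mon 0 j i * s := by
    rw [hsdef, ← mul_assoc, JTriple.mon_mul]
    simp
  rw [e]
  refine ⟨hs.mon_mul _ _ _, fun a b => by rw [e₁, e₂, hsw], fun a b hab => ?_⟩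
  rw [e₁]
  rcases hab with ha | hb
  · exact hi _ (by omega) _
  · rw [hsw]
    exact hj _ (by omega) _

theorem IsNormal.supp' {t : JTriple} (h : IsNormal t) (a b : ℤ) (hab : a < 0 ∨ b < 0) :
    cf t.2.1 a b = 0 := by
  rw [← h.swap]
  exact h.supp _ _ hab.symm

theorem IsNormal.degGE {t : JTriple} (h : IsNormal t) :
    DegGE 0 t.1 ∧ DegGE 0 t.2.1 ∧ DegGE 0 t.2.2 := by
  have h₁ : DegGE 0 t.1 := fun a b hab => h.supp a b (by omega)
  have h₂ : DegGE 0 t.2.1 := fun a b hab => h.supp' a b (by omega)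
  exact ⟨h₁, h₂, h.isJacobi.degGE h₁ h₂⟩

/-- The residue against a monomial involves only coefficients of total degree `-2 - l - m - n`. -/
theorem res_mon_mul_eq_zero {t : JTriple} {K l m n : ℤ} (hK : -2 - l - m - n < K)
    (h : DegGE K t.1 ∧ DegGE K t.2.1 ∧ DegGE K t.2.2) : res (mon l m n * t) = 0 := by
  rw [res_mon_mul, h.1.binomSum_eq_zero _ _ _ _ (by omega),
    h.2.1.binomSum_eq_zero _ _ _ _ (by omega), h.2.2.binomSum_eq_zero _ _ _ _ (by omega)]
  simp

/-- The polynomial part of a triple. -/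
def truncation (K : ℕ) (t : JTriple) : JTriple :=
  ∑ i ∈ Finset.range K, ∑ j ∈ Finset.range K, scalar (cf t.1 j i) * mon 0 i j

theorem truncation_mul {s : JTriple} (hs : IsJacobi s) (K : ℕ) (t : JTriple) :
    IsJacobi (truncation K t * s) := by
  simp only [truncation, Finset.sum_mul, mul_assoc]
  exact IsJacobi.sum fun i _ => IsJacobi.sum fun j _ => (hs.mon_mul _ _ _).scalar_mul _

theorem cf_scalar_mul_mon_fst (c : ℂ) (i j a b : ℤ) :
    cf (scalar c * mon 0 i j).1 a b = if a = j ∧ b = i then c else 0 := by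
  have : (scalar c * mon 0 i j).1 = const c * (yv ^ j * (xv ^ i * 1)) := by
    show const c * ((xv - yv) ^ (0 : ℤ) * xv ^ i * yv ^ j) = _
    rw [zpow_zero]; ring
  rw [this, cf_const_mul, cf_yv_zpow_mul, cf_xv_zpow_mul, cf_one]
  simp [sub_eq_zero]

theorem cf_scalar_mul_mon_snd (c : ℂ) (i j a b : ℤ) :
    cf (scalar c * mon 0 i j).2.1 a b = if b = j ∧ a = i then c else 0 := by
  have : (scalar c * mon 0 i j).2.1 = const c * (yv ^ i * (xv ^ j * 1)) := by
    show const c * ((yv - xv) ^ (0 : ℤ) * yv ^ i * xv ^ j) = _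
    rw [zpow_zero]; ring
  rw [this, cf_const_mul, cf_yv_zpow_mul, cf_xv_zpow_mul, cf_one]
  simp [sub_eq_zero, and_comm]

theorem sum_ite_range {K : ℕ} (f : ℤ → ℤ → ℂ) (a b : ℤ) :
    ∑ i ∈ Finset.range K, ∑ j ∈ Finset.range K, (if a = (j : ℤ) ∧ b = (i : ℤ) then f j i else 0) =
      if (0 ≤ a ∧ a < K) ∧ 0 ≤ b ∧ b < K then f a b else 0 := by
  split_ifs with h
  · rw [Finset.sum_eq_single b.toNat, Finset.sum_eq_single a.toNat]
    · rw [if_pos (by omega), Int.toNat_of_nonneg h.1.1, Int.toNat_of_nonneg h.2.1]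
    · intro j _ hj
      rw [if_neg (by omega)]
    · intro hn
      exact absurd (Finset.mem_range.2 (by omega)) hn
    · intro i _ hi
      exact Finset.sum_eq_zero fun j _ => by rw [if_neg (by omega)]
    · intro hn
      exact absurd (Finset.mem_range.2 (by omega)) hn
  · refine Finset.sum_eq_zero fun i hi => Finset.sum_eq_zero fun j hj => ?_
    rw [Finset.mem_range] at hi hj
    rw [if_neg (by omega)]

theorem cf_truncation_fst (K : ℕ) (t : JTriple) (a b : ℤ) : cf (truncation K t).1 a b =
    if (0 ≤ a ∧ a < K) ∧ 0 ≤ b ∧ b < K then cf t.1 a b else 0 := by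
  simp only [truncation, Prod.fst_sum, cf_sum, cf_scalar_mul_mon_fst]
  exact sum_ite_range (fun a b => cf t.1 a b) a b

theorem cf_truncation_snd (K : ℕ) (t : JTriple) (a b : ℤ) : cf (truncation K t).2.1 a b =
    if (0 ≤ b ∧ b < K) ∧ 0 ≤ a ∧ a < K then cf t.1 b a else 0 := by
  simp only [truncation, Prod.fst_sum, Prod.snd_sum, cf_sum, cf_scalar_mul_mon_snd]
  exact sum_ite_range (fun a b => cf t.1 a b) b a

/-- Nonnegative exponents with sum less than `K` are both less than `K`, so all these coefficients
are removed from the first two series. The third one follows by `IsJacobi.degGE`. -/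
theorem IsNormal.degGE_sub_truncation {t : JTriple} (h : IsNormal t) (K : ℕ) :
    DegGE K (t - truncation K t).1 ∧ DegGE K (t - truncation K t).2.1 ∧
      DegGE K (t - truncation K t).2.2 := by
  have h₁ : DegGE K (t - truncation K t).1 := fun a b hab => by
    rw [Prod.fst_sub, cf_sub, cf_truncation_fst]
    split_ifs with hc
    · ring
    · rw [h.supp _ _ (by omega), sub_zero]
  have h₂ : DegGE K (t - truncation K t).2.1 := fun a b hab => by
    rw [Prod.snd_sub, Prod.fst_sub, cf_sub, cf_truncation_snd]
    split_ifs with hc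
    · rw [h.swap]; ring
    · rw [h.supp' _ _ (by omega), sub_zero]
  have h₃ := truncation_mul isJacobi_one K t
  rw [mul_one] at h₃
  exact ⟨h₁, h₂, (h.isJacobi.sub h₃).degGE h₁ h₂⟩

/-- Multiplication by a polynomial preserves the Jacobi identity. For a fixed residue, the rest of
`s` can be taken of such high total degree that its product with `t` does not contribute. -/
theorem IsNormal.mul {s t : JTriple} (hs : IsNormal s) (ht : IsNormal t) : IsJacobi (s * t) :=
  fun l m n => by
    -- Just larger than `-2 - l - m - n`, the only total degree that the residue sees.
    set K := (-1 - l - m - n).toNat with hK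
    have e : s * t = truncation K s * t + (s - truncation K s) * t := by ring
    rw [e, mul_add, map_add, truncation_mul ht.isJacobi, zero_add]
    have h := hs.degGE_sub_truncation K
    have h' := ht.degGE
    exact res_mon_mul_eq_zero (K := K + 0) (by omega)
      ⟨h.1.mul h'.1, h.2.1.mul h'.2.1, h.2.2.mul h'.2.2⟩

/-- Clear the poles of both factors by monomials, multiply the normal triples, and divide by the
monomials again. -/
theorem IsJacobi.mul {s t : JTriple} (hs : IsJacobi s) (ht : IsJacobi t) : IsJacobi (s * t) := by
  obtain ⟨l, m, n, h⟩ := hs.exists_isNormal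
  obtain ⟨l', m', n', h'⟩ := ht.exists_isNormal
  have := h.mul h'
  rw [mul_mul_mul_comm, JTriple.mon_mul] at this
  exact isJacobi_of_mon_mul this

end JTriple
end jacobiTriples

/-! ### Tensor products of generalized modules -/

section tensorJacobi

open DoubleLaurent JTriple

variable {V : Type v} [AddCommGroup V] [Module ℂ V]
variable {M : Type w} [AddCommGroup M] [Module ℂ M]
variable {N : Type w} [AddCommGroup N] [Module ℂ N]

theorem pairing_zero₂ (Y : V →ₗ[ℂ] VertexOperator ℂ M) (Φ : Module.Dual ℂ M) (x : M) :
    pairing Y Φ 0 x = 0 := by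
  ext n; simp [pairing]

theorem pairing_zero₃ (Y : V →ₗ[ℂ] VertexOperator ℂ M) (Φ : Module.Dual ℂ M) (u : V) :
    pairing Y Φ u 0 = 0 := by
  ext n; simp [pairing]

/-- The double series `⟨Φ, Y(u, x₁) Y(v, x₂) x⟩`, with outer variable `x₂`. -/
def prodSeries (Y : V →ₗ[ℂ] VertexOperator ℂ M) (Φ : Module.Dual ℂ M) (u v : V) (x : M) :
    DoubleLaurent :=
  show HahnSeries ℤ (LaurentSeries ℂ) from
  { coeff := fun a => pairing Y Φ u (coef Y v a x)
    isPWO_support' := by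
      obtain ⟨n₀, h⟩ := coef_trunc Y v x
      refine (BddBelow.isWF ⟨n₀, fun n hn => ?_⟩).isPWO
      by_contra hlt
      exact hn (by simp [h n (not_le.1 hlt), pairing_zero₃]) }

/-- The double series `⟨Φ, Y(Y(u, x₀) v, x₂) x⟩`, with outer variable `x₀`. -/
def iterSeries (𝒱 : VOAData V) (Y : V →ₗ[ℂ] VertexOperator ℂ M) (Φ : Module.Dual ℂ M) (u v : V)
    (x : M) : DoubleLaurent :=
  show HahnSeries ℤ (LaurentSeries ℂ) from
  { coeff := fun a => pairing Y Φ (coef 𝒱.Y u a v) x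
    isPWO_support' := by
      obtain ⟨n₀, h⟩ := coef_trunc 𝒱.Y u v
      refine (BddBelow.isWF ⟨n₀, fun n hn => ?_⟩).isPWO
      by_contra hlt
      exact hn (by simp [h n (not_le.1 hlt), pairing_zero₂]) }

theorem cf_prodSeries (Y : V →ₗ[ℂ] VertexOperator ℂ M) (Φ : Module.Dual ℂ M) (u v : V) (x : M)
    (a b : ℤ) : cf (prodSeries Y Φ u v x) a b = Φ (coef Y u b (coef Y v a x)) := rfl

theorem cf_iterSeries (𝒱 : VOAData V) (Y : V →ₗ[ℂ] VertexOperator ℂ M) (Φ : Module.Dual ℂ M)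
    (u v : V) (x : M) (a b : ℤ) :
    cf (iterSeries 𝒱 Y Φ u v x) a b = Φ (coef Y (coef 𝒱.Y u a v) b x) := rfl

/-- The three series in the Jacobi identity, paired with a functional. -/
def jacobiTriple (𝒱 : VOAData V) (Y : V →ₗ[ℂ] VertexOperator ℂ M) (Φ : Module.Dual ℂ M) (u v : V)
    (x : M) : JTriple :=
  (prodSeries Y Φ u v x, prodSeries Y Φ v u x, iterSeries 𝒱 Y Φ u v x)

theorem jacobiTriple_ext {s t : JTriple} (h₁ : ∀ a b, cf s.1 a b = cf t.1 a b)
    (h₂ : ∀ a b, cf s.2.1 a b = cf t.2.1 a b) (h₃ : ∀ a b, cf s.2.2 a b = cf t.2.2 a b) : s = t :=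
  Prod.ext (ext_cf h₁) (Prod.ext (ext_cf h₂) (ext_cf h₃))

section additivity

variable (𝒱 : VOAData V) (Y : V →ₗ[ℂ] VertexOperator ℂ M) (Φ : Module.Dual ℂ M) (u u' v v' : V)
  (x x' : M)

theorem jacobiTriple_add_left : jacobiTriple 𝒱 Y Φ (u + u') v x =
    jacobiTriple 𝒱 Y Φ u v x + jacobiTriple 𝒱 Y Φ u' v x := by
  apply jacobiTriple_ext <;> intro a b <;>
    simp [jacobiTriple, cf_prodSeries, cf_iterSeries]

theorem jacobiTriple_add_mid : jacobiTriple 𝒱 Y Φ u (v + v') x =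
    jacobiTriple 𝒱 Y Φ u v x + jacobiTriple 𝒱 Y Φ u v' x := by
  apply jacobiTriple_ext <;> intro a b <;>
    simp [jacobiTriple, cf_prodSeries, cf_iterSeries]

theorem jacobiTriple_add_right : jacobiTriple 𝒱 Y Φ u v (x + x') =
    jacobiTriple 𝒱 Y Φ u v x + jacobiTriple 𝒱 Y Φ u v x' := by
  apply jacobiTriple_ext <;> intro a b <;>
    simp [jacobiTriple, cf_prodSeries, cf_iterSeries]

theorem jacobiTriple_zero_left : jacobiTriple 𝒱 Y Φ 0 v x = 0 := by
  apply jacobiTriple_ext <;> intro a b <;>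
    simp [jacobiTriple, cf_prodSeries, cf_iterSeries]

theorem jacobiTriple_zero_mid : jacobiTriple 𝒱 Y Φ u 0 x = 0 := by
  apply jacobiTriple_ext <;> intro a b <;>
    simp [jacobiTriple, cf_prodSeries, cf_iterSeries]

theorem jacobiTriple_zero_right : jacobiTriple 𝒱 Y Φ u v 0 = 0 := by
  apply jacobiTriple_ext <;> intro a b <;>
    simp [jacobiTriple, cf_prodSeries, cf_iterSeries]

end additivity

theorem JTriple.isJacobi_zero : IsJacobi 0 := fun l m n => by rw [mul_zero, map_zero]

theorem res_jacobiTriple (𝒱 : VOAData V) (Y : V →ₗ[ℂ] VertexOperator ℂ M) (Φ : Module.Dual ℂ M)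
    (u v : V) (x : M) (l m n : ℤ) : res (mon l m n * jacobiTriple 𝒱 Y Φ u v x) =
      Φ (∑ᶠ i : ℕ, Ring.choose m i • mode Y (mode 𝒱.Y u (l + i) v) (m + n - i) x) -
      Φ (∑ᶠ i : ℕ, ((-1) ^ i * Ring.choose l i) •
      (mode Y u (m + l - i) (mode Y v (n + i) x) -
        (l.negOnePow : ℤ) • mode Y v (n + l - i) (mode Y u (m + i) x))) := by
  have e₁ := Φ.toAddMonoidHom.map_finsum (jacobi_fin_left 𝒱 Y u v l m n x)
  have e₂ := Φ.toAddMonoidHom.map_finsum (jacobi_fin_right Y u v l m n x)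
  simp only [LinearMap.toAddMonoidHom_coe] at e₁ e₂
  rw [res_mon_mul, e₁, e₂]
  congr 1
  · refine finsum_congr fun i => ?_
    rw [map_zsmul, zsmul_eq_mul, one_pow, one_mul]
    congr 1
    simp only [jacobiTriple, cf_iterSeries, mode]
    rw [show -(l + (i : ℤ)) - 1 = -1 - l - i by ring,
      show -(m + n - (i : ℤ)) - 1 = -1 - m - n + i by ring]
  · have f₁ := finite_binomSum (fun i => (-1) ^ i * (Ring.choose l i : ℤ))
      (jacobiTriple 𝒱 Y Φ u v x).1 (-1 - n) (-1 - m - l)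
    have f₂ := finite_binomSum (fun i => (-1) ^ l * ((-1) ^ i * (Ring.choose l i : ℤ)))
      (jacobiTriple 𝒱 Y Φ u v x).2.1 (-1 - m) (-1 - n - l)
    have f₃ := finite_binomSum (fun i => ((-1) ^ i * (Ring.choose l i : ℤ)))
      (jacobiTriple 𝒱 Y Φ u v x).2.1 (-1 - m) (-1 - n - l)
    unfold binomSum
    rw [mul_finsum' _ _ f₃]
    simp only [← mul_assoc] at f₂ ⊢
    rw [← finsum_sub_distrib f₁ f₂]
    refine finsum_congr fun i => ?_
    rw [map_zsmul, map_sub, map_zsmul, zsmul_eq_mul, zsmul_eq_mul, Int.cast_negOnePow]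
    simp only [jacobiTriple, cf_prodSeries, mode]
    rw [show -(m + l - (i : ℤ)) - 1 = -1 - m - l + i by ring,
      show -(n + (i : ℤ)) - 1 = -1 - n - i by ring,
      show -(n + l - (i : ℤ)) - 1 = -1 - n - l + i by ring,
      show -(m + (i : ℤ)) - 1 = -1 - m - i by ring]
    push_cast
    ring

theorem isJacobi_jacobiTriple {𝒱 : VOAData V} {Y : V →ₗ[ℂ] VertexOperator ℂ M} {u v : V} {x : M}
    (h : ∀ l m n, JacobiAt 𝒱 Y u v l m n x) (Φ : Module.Dual ℂ M) :
    IsJacobi (jacobiTriple 𝒱 Y Φ u v x) := fun l m n => by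
  rw [res_jacobiTriple, h l m n, sub_self]

/-- A vector-valued Jacobi identity may be tested on any family of functionals that separates
points. -/
theorem jacobiAt_of_isJacobi {𝒱 : VOAData V} {Y : V →ₗ[ℂ] VertexOperator ℂ M} {u v : V} {x : M}
    {ι : Type*} {Φ : ι → Module.Dual ℂ M} (hΦ : ∀ y, (∀ i, Φ i y = 0) → y = 0)
    (h : ∀ i, IsJacobi (jacobiTriple 𝒱 Y (Φ i) u v x)) (l m n : ℤ) : JacobiAt 𝒱 Y u v l m n x := by
  rw [JacobiAt, ← sub_eq_zero]
  refine hΦ _ fun i => ?_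
  rw [map_sub, ← res_jacobiTriple]
  exact h i l m n

/-- The functional `φ ⊗ ψ`. -/
def tensorDual (φ : Module.Dual ℂ M) (ψ : Module.Dual ℂ N) : Module.Dual ℂ (M ⊗[ℂ] N) :=
  TensorProduct.dualDistrib ℂ M N (φ ⊗ₜ ψ)

theorem tensorDual_tmul (φ : Module.Dual ℂ M) (ψ : Module.Dual ℂ N) (x : M) (y : N) :
    tensorDual φ ψ (x ⊗ₜ y) = φ x * ψ y := TensorProduct.dualDistrib_apply _ _ _ _

/-- Against a product functional, `Y₁(u, x) ⊗ Y₂(v, x)` becomes a product of scalar series. The next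
lemmas repeat this for two vertex operators and for iterates. -/
theorem pairing_tensorY (Y₁ : V →ₗ[ℂ] VertexOperator ℂ M) (Y₂ : V →ₗ[ℂ] VertexOperator ℂ N)
    (φ : Module.Dual ℂ M) (ψ : Module.Dual ℂ N) (u v : V) (x : M) (y : N) :
    pairing (tensorY Y₁ Y₂) (tensorDual φ ψ) (u ⊗ₜ v) (x ⊗ₜ y) =
      pairing Y₁ φ u x * pairing Y₂ ψ v y := by
  ext n
  rw [coeff_mul_eq_finsum]
  show tensorDual φ ψ (coef (tensorY Y₁ Y₂) (u ⊗ₜ v) n (x ⊗ₜ y)) = _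
  rw [coef_tensorY_tmul]
  refine ((tensorDual φ ψ).toAddMonoidHom.map_finsum (tensor_fin Y₁ Y₂ u v n x y)).trans ?_
  exact finsum_congr fun k => tensorDual_tmul _ _ _ _

/-- `pairing` as an additive map in the module variable. -/
def pairingRight (Y : V →ₗ[ℂ] VertexOperator ℂ M) (Φ : Module.Dual ℂ M) (u : V) :
    M →+ LaurentSeries ℂ where
  toFun x := pairing Y Φ u x
  map_zero' := pairing_zero₃ Y Φ u
  map_add' := pairing_add₃ Y Φ u

/-- `pairing` as an additive map in the algebra variable. -/
def pairingLeft (Y : V →ₗ[ℂ] VertexOperator ℂ M) (Φ : Module.Dual ℂ M) (x : M) :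
    V →+ LaurentSeries ℂ where
  toFun u := pairing Y Φ u x
  map_zero' := pairing_zero₂ Y Φ x
  map_add' u v := pairing_add₂ Y Φ u v x

theorem DoubleLaurent.ext_coeff_mul {F G H : DoubleLaurent}
    (h : ∀ n : ℤ, HahnSeries.coeff H n =
      ∑ᶠ k : ℤ, HahnSeries.coeff F k * HahnSeries.coeff G (n - k)) : H = F * G :=
  HahnSeries.ext (funext fun n => (h n).trans
    (coeff_mul_eq_finsum (R := LaurentSeries ℂ) F G n).symm)

theorem prodSeries_tensorY (Y₁ : V →ₗ[ℂ] VertexOperator ℂ M) (Y₂ : V →ₗ[ℂ] VertexOperator ℂ N)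
    (φ : Module.Dual ℂ M) (ψ : Module.Dual ℂ N) (u₁ u₂ v₁ v₂ : V) (x : M) (y : N) :
    prodSeries (tensorY Y₁ Y₂) (tensorDual φ ψ) (u₁ ⊗ₜ u₂) (v₁ ⊗ₜ v₂) (x ⊗ₜ y) =
      prodSeries Y₁ φ u₁ v₁ x * prodSeries Y₂ ψ u₂ v₂ y := by
  refine DoubleLaurent.ext_coeff_mul fun n => ?_
  show pairing _ _ _ (coef (tensorY Y₁ Y₂) (v₁ ⊗ₜ v₂) n (x ⊗ₜ y)) = _
  rw [coef_tensorY_tmul]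
  refine ((pairingRight (tensorY Y₁ Y₂) (tensorDual φ ψ) (u₁ ⊗ₜ u₂)).map_finsum
    (tensor_fin Y₁ Y₂ v₁ v₂ n x y)).trans ?_
  exact finsum_congr fun k => pairing_tensorY _ _ _ _ _ _ _ _

theorem iterSeries_tensorY (𝒱 : VOAData V) (Y₁ : V →ₗ[ℂ] VertexOperator ℂ M)
    (Y₂ : V →ₗ[ℂ] VertexOperator ℂ N) (φ : Module.Dual ℂ M) (ψ : Module.Dual ℂ N)
    (u₁ u₂ v₁ v₂ : V) (x : M) (y : N) :
    iterSeries 𝒱.tensor (tensorY Y₁ Y₂) (tensorDual φ ψ) (u₁ ⊗ₜ u₂) (v₁ ⊗ₜ v₂) (x ⊗ₜ y) =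
      iterSeries 𝒱 Y₁ φ u₁ v₁ x * iterSeries 𝒱 Y₂ ψ u₂ v₂ y := by
  refine DoubleLaurent.ext_coeff_mul fun n => ?_
  show pairing _ _ (coef (tensorY 𝒱.Y 𝒱.Y) (u₁ ⊗ₜ u₂) n (v₁ ⊗ₜ v₂)) _ = _
  rw [coef_tensorY_tmul]
  refine ((pairingLeft (tensorY Y₁ Y₂) (tensorDual φ ψ) (x ⊗ₜ y)).map_finsum
    (tensor_fin 𝒱.Y 𝒱.Y u₁ u₂ n v₁ v₂)).trans ?_
  exact finsum_congr fun k => pairing_tensorY _ _ _ _ _ _ _ _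

/-- On pure tensors the triple of the tensor product is the product of the triples of the factors,
so `IsJacobi.mul` applies; the rest is additivity. -/
theorem isJacobi_tensorY {𝒱 : VOAData V} {Y₁ : V →ₗ[ℂ] VertexOperator ℂ M}
    {Y₂ : V →ₗ[ℂ] VertexOperator ℂ N} (h₁ : IsWeakModule 𝒱 Y₁) (h₂ : IsWeakModule 𝒱 Y₂)
    (φ : Module.Dual ℂ M) (ψ : Module.Dual ℂ N) (a b : V ⊗[ℂ] V) (t : M ⊗[ℂ] N) :
    IsJacobi (jacobiTriple 𝒱.tensor (tensorY Y₁ Y₂) (tensorDual φ ψ) a b t) := by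
  induction a using TensorProduct.induction_on with
  | zero => rw [jacobiTriple_zero_left]; exact JTriple.isJacobi_zero
  | add a a' ha ha' => rw [jacobiTriple_add_left]; exact ha.add ha'
  | tmul u₁ u₂ =>
    induction b using TensorProduct.induction_on with
    | zero => rw [jacobiTriple_zero_mid]; exact JTriple.isJacobi_zero
    | add a a' ha ha' => rw [jacobiTriple_add_mid]; exact ha.add ha'
    | tmul v₁ v₂ =>
      induction t using TensorProduct.induction_on with
      | zero => rw [jacobiTriple_zero_right]; exact JTriple.isJacobi_zero
      | add a a' ha ha' => rw [jacobiTriple_add_right]; exact ha.add ha'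
      | tmul x y =>
        have e : jacobiTriple 𝒱.tensor (tensorY Y₁ Y₂) (tensorDual φ ψ) (u₁ ⊗ₜ u₂) (v₁ ⊗ₜ v₂)
            (x ⊗ₜ y) = jacobiTriple 𝒱 Y₁ φ u₁ v₁ x * jacobiTriple 𝒱 Y₂ ψ u₂ v₂ y :=
          Prod.ext (prodSeries_tensorY _ _ _ _ _ _ _ _ _ _)
            (Prod.ext (prodSeries_tensorY _ _ _ _ _ _ _ _ _ _)
              (iterSeries_tensorY _ _ _ _ _ _ _ _ _ _ _))
        rw [e]
        exact (isJacobi_jacobiTriple (fun l m n => h₁.jacobi u₁ v₁ l m n x) φ).mul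
          (isJacobi_jacobiTriple (fun l m n => h₂.jacobi u₂ v₂ l m n y) ψ)

/-- Coordinates with respect to a tensor product basis are product functionals. -/
theorem tensorDual_separating (t : M ⊗[ℂ] N)
    (h : ∀ p : Module.Dual ℂ M × Module.Dual ℂ N, tensorDual p.1 p.2 t = 0) : t = 0 := by
  let b := Module.Basis.ofVectorSpace ℂ M
  let c := Module.Basis.ofVectorSpace ℂ N
  refine (b.tensorProduct c).ext_elem fun i => ?_
  have e : (b.tensorProduct c).coord i = tensorDual (b.coord i.1) (c.coord i.2) := by
    obtain ⟨i, j⟩ := i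
    ext x y
    simp [tensorDual_tmul, mul_comm]
  rw [← Module.Basis.coord_apply, e, h (b.coord i.1, c.coord i.2), map_zero]
  rfl

theorem coef_tensorY_vac {𝒱 : VOAData V} {Y₁ : V →ₗ[ℂ] VertexOperator ℂ M}
    {Y₂ : V →ₗ[ℂ] VertexOperator ℂ N} (h₁ : IsWeakModule 𝒱 Y₁) (v : V) (n : ℤ) (x : M) (y : N) :
    coef (tensorY Y₁ Y₂) (𝒱.vac ⊗ₜ v) n (x ⊗ₜ y) = x ⊗ₜ coef Y₂ v n y := by
  rw [coef_tensorY_tmul, finsum_eq_single _ 0 (fun i hi => by rw [h₁.vacuum, if_neg hi]; simp),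
    h₁.vacuum, if_pos rfl, sub_zero]
  rfl

theorem coef_tensorY_vac_right {𝒱 : VOAData V} {Y₁ : V →ₗ[ℂ] VertexOperator ℂ M}
    {Y₂ : V →ₗ[ℂ] VertexOperator ℂ N} (h₂ : IsWeakModule 𝒱 Y₂) (u : V) (n : ℤ) (x : M) (y : N) :
    coef (tensorY Y₁ Y₂) (u ⊗ₜ 𝒱.vac) n (x ⊗ₜ y) = coef Y₁ u n x ⊗ₜ y := by
  rw [coef_tensorY_tmul, finsum_eq_single _ n (fun i hi => by
    rw [h₂.vacuum, if_neg (by omega)]; simp), h₂.vacuum, if_pos (by omega)]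
  rfl

theorem isWeakModule_tensorY {𝒱 : VOAData V} {Y₁ : V →ₗ[ℂ] VertexOperator ℂ M}
    {Y₂ : V →ₗ[ℂ] VertexOperator ℂ N} (h₁ : IsWeakModule 𝒱 Y₁) (h₂ : IsWeakModule 𝒱 Y₂) :
    IsWeakModule 𝒱.tensor (tensorY Y₁ Y₂) where
  vacuum n := by
    refine TensorProduct.ext' fun x y => ?_
    show coef (tensorY Y₁ Y₂) (𝒱.vac ⊗ₜ 𝒱.vac) n (x ⊗ₜ y) = _
    rw [coef_tensorY_vac h₁, h₂.vacuum]
    split_ifs <;> simp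
  jacobi a b l m n t := jacobiAt_of_isJacobi
    (Φ := fun p : Module.Dual ℂ M × Module.Dual ℂ N => tensorDual p.1 p.2) tensorDual_separating
    (fun p => isJacobi_tensorY h₁ h₂ p.1 p.2 a b t) l m n

theorem Lop_tensor_tmul {𝒱 : VOAData V} {Y₁ : V →ₗ[ℂ] VertexOperator ℂ M}
    {Y₂ : V →ₗ[ℂ] VertexOperator ℂ N} (h₁ : IsWeakModule 𝒱 Y₁) (h₂ : IsWeakModule 𝒱 Y₂) (n : ℤ)
    (x : M) (y : N) : Lop 𝒱.tensor (tensorY Y₁ Y₂) n (x ⊗ₜ y) =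
      Lop 𝒱 Y₁ n x ⊗ₜ y + x ⊗ₜ Lop 𝒱 Y₂ n y := by
  rw [Lop, mode]
  show coef (tensorY Y₁ Y₂) (𝒱.ω ⊗ₜ 𝒱.vac + 𝒱.vac ⊗ₜ 𝒱.ω) _ _ = _
  rw [map_add, Pi.add_apply, LinearMap.add_apply, coef_tensorY_vac h₁, coef_tensorY_vac_right h₂]
  rfl

theorem tmul_mem_eigenspace {𝒱 : VOAData V} {Y₁ : V →ₗ[ℂ] VertexOperator ℂ M}
    {Y₂ : V →ₗ[ℂ] VertexOperator ℂ N} (h₁ : IsWeakModule 𝒱 Y₁) (h₂ : IsWeakModule 𝒱 Y₂)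
    {h k : ℂ} {x : M} {y : N} (hx : x ∈ (Lop 𝒱 Y₁ 0).eigenspace h)
    (hy : y ∈ (Lop 𝒱 Y₂ 0).eigenspace k) :
    x ⊗ₜ y ∈ (Lop 𝒱.tensor (tensorY Y₁ Y₂) 0).eigenspace (h + k) := by
  rw [Module.End.mem_eigenspace_iff] at *
  rw [Lop_tensor_tmul h₁ h₂, hx, hy, add_smul, TensorProduct.smul_tmul', TensorProduct.tmul_smul]

/-- To prove an additive property of the elements of a tensor product of two modules that are
spanned by families of subspaces, it suffices to consider pure tensors of elements of these. -/
theorem tensor_induction_iSup {ι κ : Type*} {A : ι → Submodule ℂ M} {B : κ → Submodule ℂ N}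
    (hA : ⨆ i, A i = ⊤) (hB : ⨆ j, B j = ⊤) {p : M ⊗[ℂ] N → Prop} (h0 : p 0)
    (hadd : ∀ s t, p s → p t → p (s + t)) (h : ∀ i j, ∀ x ∈ A i, ∀ y ∈ B j, p (x ⊗ₜ y))
    (t : M ⊗[ℂ] N) : p t := by
  induction t using TensorProduct.induction_on with
  | zero => exact h0
  | add s t hs ht => exact hadd s t hs ht
  | tmul x y =>
    refine Submodule.iSup_induction A (motive := fun x => p (x ⊗ₜ y))
      (hA ▸ Submodule.mem_top : x ∈ ⨆ i, A i) (fun i x hx => ?_) (by simpa using h0)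
      (fun x x' h h' => by rw [TensorProduct.add_tmul]; exact hadd _ _ h h')
    refine Submodule.iSup_induction B (motive := fun y => p (x ⊗ₜ y))
      (hB ▸ Submodule.mem_top : y ∈ ⨆ i, B i) (fun j y hy => h i j x hx y hy) (by simpa using h0)
      (fun x x' h h' => by rw [TensorProduct.tmul_add]; exact hadd _ _ h h')

theorem isGeneralized_tensorY {𝒱 : VOAData V} {Y₁ : V →ₗ[ℂ] VertexOperator ℂ M}
    {Y₂ : V →ₗ[ℂ] VertexOperator ℂ N} (h₁ : IsGeneralized 𝒱 Y₁) (h₂ : IsGeneralized 𝒱 Y₂) :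
    IsGeneralized 𝒱.tensor (tensorY Y₁ Y₂) where
  weak := isWeakModule_tensorY h₁.weak h₂.weak
  semisimple := eq_top_iff.2 fun t _ => tensor_induction_iSup h₁.semisimple h₂.semisimple
    (Submodule.zero_mem _) (fun _ _ => Submodule.add_mem _) (fun h k _ hx _ hy =>
      Submodule.mem_iSup_of_mem (h + k) (tmul_mem_eigenspace h₁.weak h₂.weak hx hy)) t

end tensorJacobi

/-! ### Submodules with weights in one coset of ℤ -/

section cosets

variable {V : Type v} [AddCommGroup V] [Module ℂ V]
variable {M : Type w} [AddCommGroup M] [Module ℂ M]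
variable {N : Type w} [AddCommGroup N] [Module ℂ N]

/-- The restriction of a vertex operator map to a stable subspace. -/
def subY (Y : V →ₗ[ℂ] VertexOperator ℂ M) (S : Submodule ℂ M)
    (hS : ∀ v n, ∀ x ∈ S, coef Y v n x ∈ S) : V →ₗ[ℂ] VertexOperator ℂ S :=
  ofCoef
    { toFun := fun v n => (coef Y v n).restrict (hS v n)
      map_add' := fun u v => by ext n x; simp
      map_smul' := fun c v => by ext n x; simp }
    fun v x => by
      obtain ⟨n₀, h⟩ := coef_trunc Y v x.1
      exact ⟨n₀, fun n hn => Subtype.ext (h n hn)⟩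

theorem subY_intertwines {Y : V →ₗ[ℂ] VertexOperator ℂ M} {S : Submodule ℂ M}
    (hS : ∀ v n, ∀ x ∈ S, coef Y v n x ∈ S) : Intertwines (subY Y S hS) Y S.subtype :=
  fun _ _ _ => rfl

theorem Intertwines.jacobiAt_of_injective {𝒱 : VOAData V} {Y : V →ₗ[ℂ] VertexOperator ℂ M}
    {Y' : V →ₗ[ℂ] VertexOperator ℂ N} {f : M →ₗ[ℂ] N} (hf : Intertwines Y Y' f)
    (hi : Function.Injective f) {u v : V} {l m n : ℤ} {x : M}
    (hx : JacobiAt 𝒱 Y' u v l m n (f x)) : JacobiAt 𝒱 Y u v l m n x := by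
  have e₁ := f.toAddMonoidHom.map_finsum (jacobi_fin_left 𝒱 Y u v l m n x)
  have e₂ := f.toAddMonoidHom.map_finsum (jacobi_fin_right Y u v l m n x)
  unfold JacobiAt at *
  apply hi
  simp only [LinearMap.toAddMonoidHom_coe] at e₁ e₂
  rw [e₁, e₂]
  simpa [hf.mode] using hx

theorem Intertwines.isWeakModule_of_injective {𝒱 : VOAData V} {Y : V →ₗ[ℂ] VertexOperator ℂ M}
    {Y' : V →ₗ[ℂ] VertexOperator ℂ N} {f : M →ₗ[ℂ] N} (hf : Intertwines Y Y' f)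
    (hi : Function.Injective f) (hY : IsWeakModule 𝒱 Y') : IsWeakModule 𝒱 Y where
  vacuum n := by
    ext x
    apply hi
    rw [hf, hY.vacuum]
    split_ifs <;> simp
  jacobi u v l m n x := hf.jacobiAt_of_injective hi (hY.jacobi u v l m n (f x))

variable {𝒱 : VOA V}

/-- The part of a module with weights in `μ + ℤ`. -/
def cosetPart (𝒱 : VOA V) (Y : V →ₗ[ℂ] VertexOperator ℂ M) (μ : ℂ) : Submodule ℂ M :=
  ⨆ k : ℤ, (Lop 𝒱.toVOAData Y 0).eigenspace (μ + k)

/-- `V` has integral weights, so the coefficients of its vertex operators shift weights by integers.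
-/
theorem cosetPart_stable {Y : V →ₗ[ℂ] VertexOperator ℂ M} (hY : IsWeakModule 𝒱.toVOAData Y)
    (μ : ℂ) (v : V) (n : ℤ) (x : M) (hx : x ∈ cosetPart 𝒱 Y μ) :
    coef Y v n x ∈ cosetPart 𝒱 Y μ := by
  refine 𝒱.induction (p := fun v => coef Y v n x ∈ cosetPart 𝒱 Y μ) v (by simp) ?_ ?_
  · intro u v hu hv
    rw [map_add]
    exact Submodule.add_mem _ hu hv
  · intro h v hv
    refine Submodule.iSup_induction _ (motive := fun x => coef Y v n x ∈ cosetPart 𝒱 Y μ) hx ?_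
      (by simp) fun x y hx hy => by rw [map_add]; exact Submodule.add_mem _ hx hy
    intro k x hx
    have := coef_weight hY hv n hx
    refine Submodule.mem_iSup_of_mem (k + h + n) ?_
    convert this using 2
    push_cast
    ring

/-- The vertex operator map on the part of a module with weights in `μ + ℤ`. -/
def cosetY {Y : V →ₗ[ℂ] VertexOperator ℂ M} (hY : IsWeakModule 𝒱.toVOAData Y) (μ : ℂ) :
    V →ₗ[ℂ] VertexOperator ℂ (cosetPart 𝒱 Y μ) := subY Y _ (cosetPart_stable hY μ)

theorem mem_eigenspace_cosetY {Y : V →ₗ[ℂ] VertexOperator ℂ M} (hY : IsWeakModule 𝒱.toVOAData Y)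
    (μ h : ℂ) (x : cosetPart 𝒱 Y μ) : x ∈ (Lop 𝒱.toVOAData (cosetY hY μ) 0).eigenspace h ↔
      (x : M) ∈ (Lop 𝒱.toVOAData Y 0).eigenspace h := by
  rw [Module.End.mem_eigenspace_iff, Module.End.mem_eigenspace_iff, ← Subtype.coe_inj]
  rfl

theorem iSup_eigenspace_cosetY {Y : V →ₗ[ℂ] VertexOperator ℂ M}
    (hY : IsWeakModule 𝒱.toVOAData Y) (μ : ℂ) :
    ⨆ k : ℤ, (Lop 𝒱.toVOAData (cosetY hY μ) 0).eigenspace (μ + k) = ⊤ := by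
  rw [eq_top_iff]
  rintro ⟨x, hx⟩ -
  have : cosetPart 𝒱 Y μ ≤ (⨆ k : ℤ, (Lop 𝒱.toVOAData (cosetY hY μ) 0).eigenspace (μ + k)).map
      (cosetPart 𝒱 Y μ).subtype := by
    refine iSup_le fun k y hy => ?_
    refine ⟨⟨y, Submodule.mem_iSup_of_mem k hy⟩, Submodule.mem_iSup_of_mem k ?_, rfl⟩
    exact (mem_eigenspace_cosetY hY μ _ _).2 hy
  obtain ⟨y, hy, rfl⟩ := this hx
  exact hy

theorem isOrdinary_cosetY {Y : V →ₗ[ℂ] VertexOperator ℂ M} (hY : IsOrdinary 𝒱.toVOAData Y)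
    (μ : ℂ) : IsOrdinary 𝒱.toVOAData (cosetY hY.weak μ) where
  weak := (subY_intertwines _).isWeakModule_of_injective (Submodule.subtype_injective _) hY.weak
  semisimple := by
    rw [eq_top_iff, ← iSup_eigenspace_cosetY hY.weak μ]
    exact iSup_le fun k => le_iSup (fun h => (Lop 𝒱.toVOAData (cosetY hY.weak μ) 0).eigenspace h) _
  finite h := by
    have := hY.finite h
    let f : (Lop 𝒱.toVOAData (cosetY hY.weak μ) 0).eigenspace h →ₗ[ℂ]
        (Lop 𝒱.toVOAData Y 0).eigenspace h :=
      ((cosetPart 𝒱 Y μ).subtype ∘ₗ Submodule.subtype _).codRestrict _ fun x =>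
        (mem_eigenspace_cosetY hY.weak μ h x.1).1 x.2
    refine FiniteDimensional.of_injective f fun x y hxy => ?_
    exact Subtype.ext (Subtype.ext (show (f x : M) = f y by rw [hxy]))
  bounded := by
    obtain ⟨r, hr⟩ := hY.bounded
    refine ⟨r, fun h hh => (Submodule.eq_bot_iff _).2 fun x hx => ?_⟩
    have := (mem_eigenspace_cosetY hY.weak μ h x).1 hx
    rw [hr h hh, Submodule.mem_bot] at this
    exact Subtype.ext this

/-- A spanning family of subspaces of eigenspaces already exhausts each eigenspace, because
eigenspaces for different eigenvalues are independent. -/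
theorem eigenspace_eq_iSup {ι : Type*} {A : Module.End ℂ M} {S : ι → Submodule ℂ M} {c : ι → ℂ}
    (hS : ∀ i, S i ≤ A.eigenspace (c i)) (htop : ⨆ i, S i = ⊤) (h : ℂ) :
    A.eigenspace h = ⨆ (i : ι) (_ : c i = h), S i := by
  refine le_antisymm (fun x hx => ?_) (iSup₂_le fun i hi => hi ▸ hS i)
  have hsplit : ⨆ i, S i ≤ (⨆ (i : ι) (_ : c i = h), S i) ⊔ ⨆ k ≠ h, A.eigenspace k :=
    iSup_le fun i => by
      by_cases hk : c i = h
      · exact le_sup_of_le_left (le_iSup₂_of_le i hk le_rfl)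
      · exact le_sup_of_le_right (le_iSup₂_of_le (c i) hk (hS i))
  obtain ⟨a, ha, b, hb, rfl⟩ := Submodule.mem_sup.1 (hsplit (htop ▸ Submodule.mem_top : x ∈ _))
  have ha' : a ∈ A.eigenspace h := (iSup₂_le fun i hi => hi ▸ hS i :
    (⨆ (i : ι) (_ : c i = h), S i) ≤ A.eigenspace h) ha
  have hb' : b ∈ A.eigenspace h := by simpa using Submodule.sub_mem _ hx ha'
  have : b = 0 := (Submodule.disjoint_def.1 (A.eigenspaces_iSupIndep h)) _ hb' hb
  simpa [this] using ha

/-- A weight of the tensor product can in general split in infinitely many ways into weights of the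
factors. With one coset for each factor, the weights `μ + a` and `ν + b` are bounded below and have
a prescribed sum, which leaves finitely many pairs `(a, b)`. -/
theorem isOrdinary_tensorY {Y₁ : V →ₗ[ℂ] VertexOperator ℂ M} {Y₂ : V →ₗ[ℂ] VertexOperator ℂ N}
    (h₁ : IsOrdinary 𝒱.toVOAData Y₁) (h₂ : IsOrdinary 𝒱.toVOAData Y₂) {μ ν : ℂ}
    (hμ : ⨆ k : ℤ, (Lop 𝒱.toVOAData Y₁ 0).eigenspace (μ + k) = ⊤)
    (hν : ⨆ k : ℤ, (Lop 𝒱.toVOAData Y₂ 0).eigenspace (ν + k) = ⊤) :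
    IsOrdinary 𝒱.toVOAData.tensor (tensorY Y₁ Y₂) := by
  let S : ℤ × ℤ → Submodule ℂ (M ⊗[ℂ] N) := fun p =>
    Submodule.map₂ (TensorProduct.mk ℂ M N) ((Lop 𝒱.toVOAData Y₁ 0).eigenspace (μ + p.1))
      ((Lop 𝒱.toVOAData Y₂ 0).eigenspace (ν + p.2))
  have hS (p : ℤ × ℤ) : S p ≤
      (Lop 𝒱.toVOAData.tensor (tensorY Y₁ Y₂) 0).eigenspace ((μ + p.1) + (ν + p.2)) :=
    Submodule.map₂_le.2 fun x hx y hy => tmul_mem_eigenspace h₁.weak h₂.weak hx hy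
  have htop : ⨆ p, S p = ⊤ := eq_top_iff.2 fun t _ => tensor_induction_iSup hμ hν
    (Submodule.zero_mem _) (fun _ _ => Submodule.add_mem _) (fun i j x hx y hy =>
      Submodule.mem_iSup_of_mem (i, j) (Submodule.apply_mem_map₂ _ hx hy)) t
  have heig := eigenspace_eq_iSup hS htop
  obtain ⟨r, hr⟩ := h₁.bounded
  obtain ⟨s, hs⟩ := h₂.bounded
  have hbot₁ (p : ℤ × ℤ) (hp : μ.re + p.1 < r) : S p = ⊥ := by
    simp only [S]
    rw [hr _ (by simpa using hp), Submodule.map₂_bot_left]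
  have hbot₂ (p : ℤ × ℤ) (hp : ν.re + p.2 < s) : S p = ⊥ := by
    simp only [S]
    rw [hs _ (by simpa using hp), Submodule.map₂_bot_right]
  refine ⟨isGeneralized_tensorY h₁.toIsGeneralized h₂.toIsGeneralized, fun h => ?_, r + s,
    fun h hh => ?_⟩
  -- The lower bound on one of the two weights is an upper bound on the other, since their sum is
  -- `h`.
  · have hfin : {p : ℤ × ℤ | (μ + p.1) + (ν + p.2) = h ∧ S p ≠ ⊥}.Finite := by
      have hI : (Set.Icc ⌊r - μ.re⌋ ⌈h.re - μ.re - s⌉ ×ˢ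
        Set.Icc ⌊s - ν.re⌋ ⌈h.re - ν.re - r⌉).Finite := (Set.finite_Icc _ _).prod (Set.finite_Icc _ _)
      refine hI.subset ?_
      rintro ⟨a, b⟩ ⟨hab, hne⟩
      have ha : r ≤ μ.re + a := not_lt.1 fun hlt => hne (hbot₁ (a, b) hlt)
      have hb : s ≤ ν.re + b := not_lt.1 fun hlt => hne (hbot₂ (a, b) hlt)
      have hre := congrArg Complex.re hab
      simp at hre
      refine ⟨⟨?_, ?_⟩, ?_, ?_⟩
      · exact Int.cast_le (R := ℝ).1 ((Int.floor_le _).trans (by linarith))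
      · exact Int.cast_le (R := ℝ).1 (le_trans (by simp; linarith) (Int.le_ceil _))
      · exact Int.cast_le (R := ℝ).1 ((Int.floor_le _).trans (by linarith))
      · exact Int.cast_le (R := ℝ).1 (le_trans (by simp; linarith) (Int.le_ceil _))
    have e : (Lop 𝒱.toVOAData.tensor (tensorY Y₁ Y₂) 0).eigenspace h =
        ⨆ p : {p : ℤ × ℤ | (μ + p.1) + (ν + p.2) = h ∧ S p ≠ ⊥}, S p := by
      rw [heig]
      refine le_antisymm (iSup₂_le fun p hp => ?_) (iSup_le fun p => le_iSup₂_of_le p.1 p.2.1 le_rfl)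
      by_cases hb : S p = ⊥
      · rw [hb]; exact bot_le
      · exact le_iSup (fun p : {p : ℤ × ℤ | (μ + p.1) + (ν + p.2) = h ∧ S p ≠ ⊥} => S p)
          ⟨p, hp, hb⟩
    rw [e]
    have := hfin.to_subtype
    have (p : {p : ℤ × ℤ | (μ + p.1) + (ν + p.2) = h ∧ S p ≠ ⊥}) : FiniteDimensional ℂ (S p) := by
      have i₁ := h₁.finite (μ + p.1.1)
      have i₂ := h₂.finite (ν + p.1.2)
      rw [← Submodule.fg_iff_finiteDimensional] at i₁ i₂ ⊢
      exact i₁.map₂ _ i₂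
    infer_instance
  · rw [heig, eq_bot_iff]
    refine iSup₂_le fun p hp => le_of_eq ?_
    have hre := congrArg Complex.re hp
    simp at hre
    by_cases hlt : μ.re + p.1 < r
    · exact hbot₁ p hlt
    · exact hbot₂ p (by linarith)

end cosets

/-! ### Maps compatible with the vertex operators on `D_{Q(z)}(M)` -/

section compatible

variable {V : Type v} [AddCommGroup V] [Module ℂ V]
variable {M : Type w} [AddCommGroup M] [Module ℂ M]
variable {N : Type w} [AddCommGroup N] [Module ℂ N]
variable {X : Type w} [AddCommGroup X] [Module ℂ X]
variable {𝒱 : VOA V} {z : ℂ}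

theorem tensorY_intertwines {M' N' : Type w} [AddCommGroup M'] [Module ℂ M'] [AddCommGroup N']
    [Module ℂ N'] {Y₁ : V →ₗ[ℂ] VertexOperator ℂ M} {Y₂ : V →ₗ[ℂ] VertexOperator ℂ N}
    {Y₁' : V →ₗ[ℂ] VertexOperator ℂ M'} {Y₂' : V →ₗ[ℂ] VertexOperator ℂ N'} {f : M →ₗ[ℂ] M'}
    {g : N →ₗ[ℂ] N'} (hf : Intertwines Y₁ Y₁' f) (hg : Intertwines Y₂ Y₂' g) :
    Intertwines (tensorY Y₁ Y₂) (tensorY Y₁' Y₂') (TensorProduct.map f g) := fun a n t => by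
  induction a using TensorProduct.induction_on with
  | zero => simp
  | add a b ha hb => simp only [map_add, Pi.add_apply, LinearMap.add_apply, ha, hb]
  | tmul u v =>
    induction t using TensorProduct.induction_on with
    | zero => simp
    | add s t hs ht => simp only [map_add, hs, ht]
    | tmul x y =>
      rw [TensorProduct.map_tmul, coef_tensorY_tmul, coef_tensorY_tmul]
      refine ((TensorProduct.map f g).toAddMonoidHom.map_finsum
        (tensor_fin Y₁ Y₂ u v n x y)).trans (finsum_congr fun i => ?_)
      refine (TensorProduct.map_tmul f g _ _).trans ?_
      rw [hf, hg]

/-- `G` maps into the domain of `Y_{Q(z)}` and carries the vertex operators to `Y_{Q(z)}`. -/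
structure QzCompatible (𝒱 : VOA V) (z : ℂ) (Y : V →ₗ[ℂ] VertexOperator ℂ M)
    (YX : V ⊗[ℂ] V →ₗ[ℂ] VertexOperator ℂ X) (G : X →ₗ[ℂ] Module.Dual ℂ M) : Prop where
  mem : ∀ t, G t ∈ qzDomain 𝒱 z Y
  comm : ∀ a n t, YQz 𝒱 z Y a n ⟨G t, mem t⟩ = G (coef YX a n t)

variable {Y : V →ₗ[ℂ] VertexOperator ℂ M} {YX : V ⊗[ℂ] V →ₗ[ℂ] VertexOperator ℂ X}
  {G : X →ₗ[ℂ] Module.Dual ℂ M}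

theorem QzCompatible.comp {X' : Type w} [AddCommGroup X'] [Module ℂ X']
    {YX' : V ⊗[ℂ] V →ₗ[ℂ] VertexOperator ℂ X'} (h : QzCompatible 𝒱 z Y YX G) {f : X' →ₗ[ℂ] X}
    (hf : Intertwines YX' YX f) : QzCompatible 𝒱 z Y YX' (G ∘ₗ f) where
  mem t := h.mem (f t)
  comm a n t := (h.comm a n (f t)).trans (congrArg G (hf a n t).symm)

theorem QzCompatible.isQzStable_range (h : QzCompatible 𝒱 z Y YX G) :
    IsQzStable 𝒱 z Y (LinearMap.range G) where
  le := by
    rintro _ ⟨t, rfl⟩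
    exact h.mem t
  mem := by
    rintro a n _ ⟨t, rfl⟩
    rw [h.comm]
    exact ⟨_, rfl⟩
  trunc := by
    rintro a _ ⟨t, rfl⟩
    obtain ⟨n₀, hn⟩ := coef_trunc YX a t
    exact ⟨n₀, fun n hlt => by rw [h.comm, hn n hlt, map_zero]⟩

/-- The range is a homomorphic image of `X`, and both the module axioms and the semisimplicity of
`L(0) ⊗ 1` pass to images. -/
theorem QzCompatible.isRSummand_range (h : QzCompatible 𝒱 z Y YX G)
    (hX : IsOrdinary 𝒱.toVOAData.tensor YX)
    (hss : ⨆ k : ℂ, (mode YX (𝒱.ω ⊗ₜ 𝒱.vac) 1).eigenspace k = ⊤) :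
    IsRSummand 𝒱 z Y (LinearMap.range G) := by
  have hi : Intertwines YX (restrictY h.isQzStable_range) G.rangeRestrict := fun a n t => by
    apply Subtype.ext
    rw [coef_restrictY]
    exact (h.comm a n t).symm
  have hs := G.surjective_rangeRestrict
  exact ⟨h.isQzStable_range, hi.isOrdinary hs hX,
    iSup_eigenspace_of_surjective (fun x => hi.mode _ _ x) hs hss⟩

theorem iSup_eigenspace_left {Y₁ : V →ₗ[ℂ] VertexOperator ℂ M} {Y₂ : V →ₗ[ℂ] VertexOperator ℂ N}
    (h₁ : IsGeneralized 𝒱.toVOAData Y₁) (h₂ : IsWeakModule 𝒱.toVOAData Y₂) :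
    ⨆ k : ℂ, (mode (tensorY Y₁ Y₂) (𝒱.ω ⊗ₜ 𝒱.vac) 1).eigenspace k = ⊤ := by
  rw [eq_top_iff]
  have htop : ⨆ _ : Unit, (⊤ : Submodule ℂ N) = ⊤ := by simp
  refine fun t _ => tensor_induction_iSup h₁.semisimple htop (Submodule.zero_mem _)
    (fun _ _ => Submodule.add_mem _) (fun h _ x hx y _ => Submodule.mem_iSup_of_mem h ?_) t
  rw [Module.End.mem_eigenspace_iff] at *
  rw [mode, coef_tensorY_vac_right h₂, TensorProduct.smul_tmul']
  exact congrArg (· ⊗ₜ y) hx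

/-- The tensor product of all of `N` and `N₂` need not be a module, so its image need not be a
summand of `R_{Q(z)}`. Every pure tensor of weight vectors lies in a tensor product of coset parts,
and the image of that is a summand. -/
theorem QzCompatible.mem_RQz {Y₁ : V →ₗ[ℂ] VertexOperator ℂ N} {N₂ : Type w} [AddCommGroup N₂]
    [Module ℂ N₂] {Y₂ : V →ₗ[ℂ] VertexOperator ℂ N₂} {G : N ⊗[ℂ] N₂ →ₗ[ℂ] Module.Dual ℂ M}
    (h : QzCompatible 𝒱 z Y (tensorY Y₁ Y₂) G) (h₁ : IsOrdinary 𝒱.toVOAData Y₁)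
    (h₂ : IsOrdinary 𝒱.toVOAData Y₂) (t : N ⊗[ℂ] N₂) : G t ∈ RQz 𝒱 z Y := by
  refine tensor_induction_iSup h₁.semisimple h₂.semisimple (p := fun t => G t ∈ RQz 𝒱 z Y)
    (by simp) (fun s t hs ht => by rw [map_add]; exact Submodule.add_mem _ hs ht) ?_ t
  intro μ ν x hx y hy
  have hc := h.comp (tensorY_intertwines (subY_intertwines (cosetPart_stable h₁.weak μ))
    (subY_intertwines (cosetPart_stable h₂.weak ν)))
  have o₁ := isOrdinary_cosetY h₁ μ
  have o₂ := isOrdinary_cosetY h₂ ν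
  have hr := hc.isRSummand_range (isOrdinary_tensorY o₁ o₂ (iSup_eigenspace_cosetY h₁.weak μ)
    (iSup_eigenspace_cosetY h₂.weak ν)) (iSup_eigenspace_left o₁.toIsGeneralized o₂.weak)
  -- The coset is represented by the weight of `x` itself, so the integer shift is 0.
  have hx' : x ∈ cosetPart 𝒱 Y₁ μ := Submodule.mem_iSup_of_mem 0 (by simpa using hx)
  have hy' : y ∈ cosetPart 𝒱 Y₂ ν := Submodule.mem_iSup_of_mem 0 (by simpa using hy)
  exact hr.le ⟨(⟨x, hx'⟩ : cosetPart 𝒱 Y₁ μ) ⊗ₜ (⟨y, hy'⟩ : cosetPart 𝒱 Y₂ ν), rfl⟩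

/-- `G` maps into `D_{Q(z)}(M)`, `Y^L` acts on its values through the first factor, and `Y^R` through
the second factor. -/
structure IsLRCompatible (𝒱 : VOA V) (z : ℂ) (Y : V →ₗ[ℂ] VertexOperator ℂ M)
    {N₁ N₂ : Type w} [AddCommGroup N₁] [Module ℂ N₁] [AddCommGroup N₂] [Module ℂ N₂]
    (Y₁ : V →ₗ[ℂ] VertexOperator ℂ N₁) (Y₂ : V →ₗ[ℂ] VertexOperator ℂ N₂)
    (G : N₁ ⊗[ℂ] N₂ →ₗ[ℂ] Module.Dual ℂ M) : Prop where
  mem : ∀ x y, G (x ⊗ₜ y) ∈ qzFunctionals z Y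
  right : ∀ v n x y, YRop z Y v n (G (x ⊗ₜ y)) = G (x ⊗ₜ coef Y₂ v n y)
  left : ∀ v n x y, YLop 𝒱 z Y v n (G (x ⊗ₜ y)) = G (coef Y₁ v n x ⊗ₜ y)

variable {N₁ N₂ : Type w} [AddCommGroup N₁] [Module ℂ N₁] [AddCommGroup N₂] [Module ℂ N₂]
  {Y₁ : V →ₗ[ℂ] VertexOperator ℂ N₁} {Y₂ : V →ₗ[ℂ] VertexOperator ℂ N₂}
  {G : N₁ ⊗[ℂ] N₂ →ₗ[ℂ] Module.Dual ℂ M}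

theorem finite_tensor_flip (Y₁ : V →ₗ[ℂ] VertexOperator ℂ N₁) (Y₂ : V →ₗ[ℂ] VertexOperator ℂ N₂)
    (u v : V) (n : ℤ) (x : N₁) (y : N₂) : Function.HasFiniteSupport
      fun j : ℤ => coef Y₁ u (n - j) x ⊗ₜ[ℂ] coef Y₂ v j y := by
  refine (Set.Finite.preimage (f := fun j : ℤ => n - j)
    (fun a _ b _ hab => sub_right_injective hab) (tensor_fin Y₁ Y₂ u v n x y)).subset fun j hj => ?_
  simpa using hj

theorem coef_tensorY_tmul_flip (Y₁ : V →ₗ[ℂ] VertexOperator ℂ N₁)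
    (Y₂ : V →ₗ[ℂ] VertexOperator ℂ N₂) (u v : V) (n : ℤ) (x : N₁) (y : N₂) :
    coef (tensorY Y₁ Y₂) (u ⊗ₜ v) n (x ⊗ₜ y) =
      ∑ᶠ j : ℤ, coef Y₁ u (n - j) x ⊗ₜ[ℂ] coef Y₂ v j y := by
  rw [coef_tensorY_tmul, ← finsum_comp_equiv (Equiv.subLeft n)]
  simp

/-- The products of coefficients of `Y^L` and `Y^R` on `G (x ⊗ y)` are images under `G` of the terms
of a finite sum in the tensor product, which gives the finiteness required by `qzDomain`. -/
theorem IsLRCompatible.mem_qzDomain (h : IsLRCompatible 𝒱 z Y Y₁ Y₂ G) (t : N₁ ⊗[ℂ] N₂) :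
    G t ∈ qzDomain 𝒱 z Y := by
  induction t using TensorProduct.induction_on with
  | zero => rw [map_zero]; exact Submodule.zero_mem _
  | add s t hs ht => rw [map_add]; exact Submodule.add_mem _ hs ht
  | tmul x y =>
    refine ⟨h.mem x y, fun v n => ?_, fun u v n => ?_⟩
    · rw [h.right]
      exact h.mem _ _
    · simp only [h.right, h.left]
      exact (finite_tensor_flip Y₁ Y₂ u v n x y).subset fun j hj h0 => hj (by simp only [h0, map_zero])

theorem IsLRCompatible.qzCompatible (h : IsLRCompatible 𝒱 z Y Y₁ Y₂ G) :
    QzCompatible 𝒱 z Y (tensorY Y₁ Y₂) G where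
  mem := h.mem_qzDomain
  comm a n t := by
    have hadd (s t : N₁ ⊗[ℂ] N₂) : (⟨G (s + t), h.mem_qzDomain _⟩ : qzDomain 𝒱 z Y) =
        ⟨G s, h.mem_qzDomain s⟩ + ⟨G t, h.mem_qzDomain t⟩ := Subtype.ext (map_add G s t)
    have hzero : (⟨G 0, h.mem_qzDomain _⟩ : qzDomain 𝒱 z Y) = 0 := Subtype.ext (map_zero G)
    induction a using TensorProduct.induction_on with
    | zero => simp
    | add a b ha hb => simp only [map_add, Pi.add_apply, LinearMap.add_apply, ha, hb]
    | tmul u v =>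
      induction t using TensorProduct.induction_on with
      | zero => rw [hzero]; simp
      | add s t hs ht => rw [hadd, map_add, hs, ht, map_add, map_add]
      | tmul x y =>
        rw [YQz_tmul, coef_tensorY_tmul_flip]
        simp only [h.right, h.left]
        exact (G.toAddMonoidHom.map_finsum (finite_tensor_flip Y₁ Y₂ u v n x y)).symm

theorem shift_const (z c : ℂ) (n : ℤ) :
    shiftZero z (iotaZero (RatFunc.C c)) n = (if n = 0 then c else 0) ∧
      shiftInf z (iotaZero (RatFunc.C c)) n = if n = 0 then c else 0 := by
  constructor
  · show (iotaZero (ratShift z (ratOf _))).coeff n = _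
    rw [ratOf_iotaZero, ratShift_C, iotaZero_C, HahnSeries.coeff_single]
    split_ifs <;> rfl
  · rw [shiftInf, LinearMap.comp_apply, LinearMap.comp_apply, ratOf_iotaZero, ratShift_C, iotaInf_C]

theorem pairing_vac (hY : ∀ n x, coef Y 𝒱.vac n x = if n = 0 then x else 0)
    (β : Module.Dual ℂ M) (x : M) : pairing Y β 𝒱.vac x = iotaZero (RatFunc.C (β x)) := by
  rw [iotaZero_C]
  ext n
  show β (coef Y 𝒱.vac n x) = _
  rw [hY, HahnSeries.coeff_single]
  split_ifs <;> simp

theorem YRop_vac (hY : ∀ n x, coef Y 𝒱.vac n x = if n = 0 then x else 0) (n : ℤ)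
    (β : Module.Dual ℂ M) : YRop z Y 𝒱.vac n β = if n = 0 then β else 0 := by
  ext x
  rw [YRop, dualOp_apply, pairing_vac hY, (shift_const z (β x) n).1]
  split_ifs <;> simp

theorem YLop_vac (hY : ∀ n x, coef Y 𝒱.vac n x = if n = 0 then x else 0) (n : ℤ)
    (β : Module.Dual ℂ M) : YLop 𝒱 z Y 𝒱.vac n β = if n = 0 then β else 0 := by
  ext x
  rw [YLop, opp_vac, dualOp_apply, pairing_vac hY, (shift_const z (β x) _).2]
  simp only [neg_eq_zero]
  split_ifs <;> simp

/-- `Y^L(1, x)` and `Y^R(1, x)` are identities, so `Y_{Q(z)}(1 ⊗ v, x) = Y^R(v, x)` and `Y_{Q(z)}(v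
⊗ 1, x) = Y^L(v, x)`. Only the vacuum property of `Y` enters; the Jacobi identity on the
contragredient module is not needed. -/
theorem QzCompatible.isLRCompatible (hY : ∀ n x, coef Y 𝒱.vac n x = if n = 0 then x else 0)
    (h₁ : IsWeakModule 𝒱.toVOAData Y₁) (h₂ : IsWeakModule 𝒱.toVOAData Y₂)
    (h : QzCompatible 𝒱 z Y (tensorY Y₁ Y₂) G) : IsLRCompatible 𝒱 z Y Y₁ Y₂ G where
  mem x y := (h.mem (x ⊗ₜ y)).1
  right v n x y := by
    have := h.comm (𝒱.vac ⊗ₜ v) n (x ⊗ₜ y)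
    -- Of the sum over `j` only the term with the constant coefficient of `Y^L(1, x)` survives, that
    -- is `j = n`.
    rw [YQz_tmul, coef_tensorY_vac h₁, finsum_eq_single _ n (fun j hj => by
      rw [YLop_vac hY, if_neg (by omega)]), YLop_vac hY, if_pos (by omega)] at this
    exact this
  left v n x y := by
    have := h.comm (v ⊗ₜ 𝒱.vac) n (x ⊗ₜ y)
    rw [YQz_tmul, coef_tensorY_vac_right h₂, finsum_eq_single _ 0 (fun j hj => by
      rw [YRop_vac hY, if_neg hj, map_zero]), YRop_vac hY, if_pos rfl, sub_zero] at this
    exact this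

end compatible

/-! ### Intertwining maps as morphisms to `F_{Q(z)}(W)` -/

section intertwining

variable {V : Type v} [AddCommGroup V] [Module ℂ V] {𝒱 : VOA V} {z : ℂ}

/-- `e^{x L(1)} (-x^{-2})^{L(0)} v` is a Laurent polynomial, so finitely many lower truncations
become one upper truncation under `x ↦ x⁻¹`. -/
theorem opp_upperTrunc {M : Type w} [AddCommGroup M] [Module ℂ M] (𝒱 : VOA V)
    (Y : V →ₗ[ℂ] VertexOperator ℂ M) (v : V) (x : M) :
    ∃ n₀ : ℤ, ∀ n, n₀ < n → opp 𝒱 (coef Y) v n x = 0 := by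
  choose c hc using fun u => coef_trunc Y u x
  obtain ⟨B, hB⟩ := ((theta 𝒱 v).support.image fun k => k - c (theta 𝒱 v k)).bddAbove
  refine ⟨B, fun n hn => ?_⟩
  rw [opp_apply, Finsupp.sum, LinearMap.sum_apply]
  refine Finset.sum_eq_zero fun k hk => hc _ _ ?_
  have := hB (Finset.mem_coe.2 (Finset.mem_image_of_mem (fun k => k - c (theta 𝒱 v k)) hk))
  omega

variable {W₁ W₂ W : VModule.{v, w} 𝒱.toVOAData}
  {F : W₁.obj.carrier ⊗[ℂ] W₂.obj.carrier →ₗ[ℂ] Completion W}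

theorem isQzIntertwining_iff_threeTerm : IsQzIntertwining 𝒱 z W₁ W₂ W F ↔
    ∀ (v : V) (w₁ : W₁.obj.carrier) (w₂ : W₂.obj.carrier) (g : Contra W),
      ThreeTerm z (pairing (contraY W.property) (F (w₁ ⊗ₜ w₂)) v g).coeff
        (fun j => F (opp 𝒱 (coef W₁.obj.Y) v j w₁ ⊗ₜ w₂) g)
        (fun j => F (w₁ ⊗ₜ coef W₂.obj.Y v j w₂) g) := by
  refine ⟨fun h v w₁ w₂ g => ⟨lowerTrunc_coeff _, ?_, ?_, h v w₁ w₂ g⟩,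
    fun h v w₁ w₂ g => (h v w₁ w₂ g).eq⟩
  · obtain ⟨n₀, hn⟩ := opp_upperTrunc 𝒱 W₁.obj.Y v w₁
    exact ⟨n₀, fun n hlt => by simp [hn n hlt]⟩
  · obtain ⟨n₀, hn⟩ := coef_trunc W₂.obj.Y v w₂
    exact ⟨n₀, fun n hlt => by simp [hn n hlt]⟩

/-- `T ↦ F(T w₁ ⊗ w₂)` -/
def applyLeft (F : W₁.obj.carrier ⊗[ℂ] W₂.obj.carrier →ₗ[ℂ] Completion W) (w₁ : W₁.obj.carrier)
    (w₂ : W₂.obj.carrier) : Module.End ℂ W₁.obj.carrier →ₗ[ℂ] Completion W :=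
  F ∘ₗ (TensorProduct.mk ℂ _ _).flip w₂ ∘ₗ LinearMap.applyₗ w₁

/-- The rational expansions describe `(Y^L)^o`, not `Y^L`. Taking opposites of both sides passes
from one to the other, as this is an involution. -/
theorem YLop_iff (Y : V →ₗ[ℂ] VertexOperator ℂ (Contra W)) (w₁ : W₁.obj.carrier)
    (w₂ : W₂.obj.carrier) :
    (∀ v n, YLop 𝒱 z Y v n (F (w₁ ⊗ₜ w₂)) = F (coef W₁.obj.Y v n w₁ ⊗ₜ w₂)) ↔
      ∀ v n, dualOp Y (shiftInf z) v n (F (w₁ ⊗ₜ w₂)) =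
        F (opp 𝒱 (coef W₁.obj.Y) v n w₁ ⊗ₜ w₂) := by
  let ev : Module.End ℂ (Completion W) →ₗ[ℂ] Completion W := LinearMap.applyₗ (F (w₁ ⊗ₜ w₂))
  let G : V →ₗ[ℂ] (ℤ → Completion W) := (applyLeft F w₁ w₂).compLeft ℤ ∘ₗ coef W₁.obj.Y
  have hG (v : V) (n : ℤ) : F (opp 𝒱 (coef W₁.obj.Y) v n w₁ ⊗ₜ w₂) = opp 𝒱 G v n :=
    opp_comp (coef W₁.obj.Y) G (applyLeft F w₁ w₂) (fun _ _ => rfl) v n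
  constructor
  · intro h v n
    have := opp_comp (𝒱 := 𝒱) (YLop 𝒱 z Y) G ev (fun v n => h v n) v n
    rw [YLop, opp_opp] at this
    rw [hG]
    exact this
  · intro h v n
    have := opp_comp (𝒱 := 𝒱) (dualOp Y (shiftInf z)) (opp 𝒱 G) ev
      (fun v n => (h v n).trans (hG v n)) v n
    rw [opp_opp] at this
    exact this

/-- Against a fixed `g`, the three-term identity amounts to rationality of `⟨F(w₁ ⊗ w₂), Y'(v, x)
g⟩` together with formulas for its shifted expansions at ∞ and at 0. The first formula is the action
of `(Y^L)^o` through `W₁`, the second that of `Y^R` through `W₂`. -/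
theorem isQzIntertwining_iff (hz : z ≠ 0) : IsQzIntertwining 𝒱 z W₁ W₂ W F ↔
    IsLRCompatible 𝒱 z (contraY W.property) W₁.obj.Y W₂.obj.Y F := by
  rw [isQzIntertwining_iff_threeTerm]
  constructor
  · intro h
    refine ⟨fun x y v => ?_, fun v n x y => ?_, fun v n x y => ?_⟩
    · obtain ⟨b, hb⟩ := coef_trunc W₂.obj.Y v y
      obtain ⟨c, hc⟩ := opp_upperTrunc 𝒱 W₁.obj.Y v x
      -- The pole at `-z` is bounded by the truncation of `Y(v, x) w₂` and the pole at ∞ by that of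
      -- `Y^o(v, x) w₁`, neither of which involves `g`. Only the pole at 0 depends on `g`.
      refine ⟨(-b).toNat, c.toNat, fun g => ?_⟩
      obtain ⟨a, ha⟩ := (h v x y g).lower
      obtain ⟨p, hp⟩ := (h v x y g).exists_fraction hz (k := (-a).toNat) (l := (-b).toNat)
        (m := c.toNat) (fun n hn => ha n (by omega))
        (fun n hn => by rw [hb n (by omega)]; simp) (fun n hn => by rw [hc n (by omega)]; simp)
      exact ⟨_, p, hp⟩
    · ext g
      exact congrFun ((h v x y g).shift_eq hz).2 n
    · revert v n
      rw [YLop_iff]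
      intro v n
      ext g
      exact congrFun ((h v x y g).shift_eq hz).1 n
  · intro h v x y g
    obtain ⟨l, m, hlm⟩ := h.mem x y v
    obtain ⟨k, p, -, e⟩ := hlm g
    convert threeTerm_shift hz p k l e using 1
    · funext n
      exact (LinearMap.congr_fun ((YLop_iff _ x y).1 (fun v n => h.left v n x y) v n) g).symm
    · funext n
      exact (LinearMap.congr_fun (h.right v n x y) g).symm

theorem tensor_isGeneralized (W₁ W₂ : VModule.{v, w} 𝒱.toVOAData) :
    IsGeneralized 𝒱.toVOAData.tensor (tensorY W₁.obj.Y W₂.obj.Y) :=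
  isGeneralized_tensorY W₁.property.toIsGeneralized W₂.property.toIsGeneralized

/-- The morphism to `F_{Q(z)}(W)` given by a `Q(z)`-intertwining map. -/
def homOfIntertwining (hz : z ≠ 0) (hF : IsQzIntertwining 𝒱 z W₁ W₂ W F)
    (h : IsGeneralized 𝒱.toVOAData.tensor (tensorY W₁.obj.Y W₂.obj.Y)) :
    tensorObj W₁ W₂ h ⟶ (FQz 𝒱 z).obj W :=
  have hc := ((isQzIntertwining_iff hz).1 hF).qzCompatible
  ObjectProperty.homMk ⟨F.codRestrict _ (hc.mem_RQz W₁.property W₂.property), fun a n t =>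
    Subtype.ext (hc.comm a n t).symm⟩

theorem homOfIntertwining_apply (hz : z ≠ 0) (hF : IsQzIntertwining 𝒱 z W₁ W₂ W F)
    (h : IsGeneralized 𝒱.toVOAData.tensor (tensorY W₁.obj.Y W₂.obj.Y))
    (t : W₁.obj.carrier ⊗[ℂ] W₂.obj.carrier) :
    (RQz 𝒱 z (contraY W.property)).subtype ((homOfIntertwining hz hF h).hom.toLin t) = F t := rfl

/-- The linear map to the completion underlying a morphism to `F_{Q(z)}(W)`. -/
def toCompletion {h : IsGeneralized 𝒱.toVOAData.tensor (tensorY W₁.obj.Y W₂.obj.Y)}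
    (f : tensorObj W₁ W₂ h ⟶ (FQz 𝒱 z).obj W) :
    W₁.obj.carrier ⊗[ℂ] W₂.obj.carrier →ₗ[ℂ] Completion W :=
  (RQz 𝒱 z (contraY W.property)).subtype ∘ₗ f.hom.toLin

/-- A morphism to `F_{Q(z)}(W)` has values in the domain of `Y_{Q(z)}` and commutes with it.
Separating the two factors by means of the vacuum gives back the intertwining identity. -/
theorem isQzIntertwining_toCompletion (hz : z ≠ 0)
    {h : IsGeneralized 𝒱.toVOAData.tensor (tensorY W₁.obj.Y W₂.obj.Y)}
    (f : tensorObj W₁ W₂ h ⟶ (FQz 𝒱 z).obj W) :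
    IsQzIntertwining 𝒱 z W₁ W₂ W (toCompletion f) := by
  rw [isQzIntertwining_iff hz]
  have hc : QzCompatible 𝒱 z (contraY W.property) (tensorY W₁.obj.Y W₂.obj.Y) (toCompletion f) :=
    { mem := fun t => (RQz_stable 𝒱 z _).le (f.hom.toLin t).2
      comm := fun a n t => (congrArg Subtype.val (f.hom.comm a n t)).symm }
  exact hc.isLRCompatible (coef_contraY_vac W.property) W₁.property.weak W₂.property.weak

theorem hom_ext_toCompletion
    {h : IsGeneralized 𝒱.toVOAData.tensor (tensorY W₁.obj.Y W₂.obj.Y)}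
    {f g : tensorObj W₁ W₂ h ⟶ (FQz 𝒱 z).obj W} (e : toCompletion f = toCompletion g) : f = g := by
  apply ObjectProperty.hom_ext
  apply WeakModule.Hom.ext
  ext1 t
  exact Subtype.ext (LinearMap.congr_fun e t)

theorem toCompletion_comp {U : VModule.{v, w} 𝒱.toVOAData}
    {h : IsGeneralized 𝒱.toVOAData.tensor (tensorY W₁.obj.Y W₂.obj.Y)}
    (f : tensorObj W₁ W₂ h ⟶ (FQz 𝒱 z).obj W) (η : W ⟶ U) :
    toCompletion (f ≫ (FQz 𝒱 z).map η) = completionMap η ∘ₗ toCompletion f := rfl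

end intertwining

/-! ### Comparison of the universal properties -/

theorem isUniversal_iff {C D : Type*} [Category* C] [Category* D] {T : C ⥤ D} {A : D} {c : C}
    (f : A ⟶ T.obj c) : Nonempty (StructuredArrow.mk f).IsUniversal ↔
      ∀ (d : C) (g : A ⟶ T.obj d), ∃! η : c ⟶ d, f ≫ T.map η = g := by
  constructor
  · rintro ⟨hu⟩ d g
    exact hu.existsUnique (StructuredArrow.mk g)
  · intro h
    exact ⟨Limits.IsInitial.ofUniqueHom
      (fun B => StructuredArrow.homMk (h B.right B.hom).choose (h B.right B.hom).choose_spec.1)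
      fun B m => StructuredArrow.ext _ _
        ((h B.right B.hom).choose_spec.2 m.right (StructuredArrow.w m))⟩

end

end VOATheory

theorem proposition4p7 {V : Type v} [AddCommGroup V] [Module ℂ V] (𝒱 : VOA V) (z : ℂ) (hz : z ≠ 0)
    (W₁ W₂ : VModule.{v, w} 𝒱.toVOAData) (P : QzProduct 𝒱 z W₁ W₂) :
    IsQzTensorProduct P ↔ IsUniversalArrow 𝒱 z W₁ W₂ P.module P.map := by
  have ef {h} {f : tensorObj W₁ W₂ h ⟶ (FQz 𝒱 z).obj P.module}
      (hf : ∀ t, (RQz 𝒱 z (contraY P.module.property)).subtype (f.hom.toLin t) = P.map t) :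
      toCompletion f = P.map := LinearMap.ext hf
  -- A morphism to `F_{Q(z)}` is determined by its underlying map to the completion, and there
  -- `F_{Q(z)}(η)` is the extension of `η`. Hence the two conditions on `η` are the same equation.
  have eη {h} {f : tensorObj W₁ W₂ h ⟶ (FQz 𝒱 z).obj P.module} (hf : toCompletion f = P.map)
      (Q : QzProduct 𝒱 z W₁ W₂) (g : tensorObj W₁ W₂ h ⟶ (FQz 𝒱 z).obj Q.module)
      (hg : toCompletion g = Q.map) (η : P.module ⟶ Q.module) :
      IsProductHom P Q η ↔ f ≫ (FQz 𝒱 z).map η = g := by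
    refine ⟨fun hη => hom_ext_toCompletion ?_, fun hη => ?_⟩
    · rw [toCompletion_comp, hf, hg]
      exact hη.symm
    · have := congrArg toCompletion hη
      rw [toCompletion_comp, hf, hg] at this
      exact this.symm
  constructor
  · intro hP
    refine ⟨tensor_isGeneralized W₁ W₂, homOfIntertwining hz P.isIntertwining _,
      homOfIntertwining_apply hz P.isIntertwining _, (isUniversal_iff _).2 fun U g => ?_⟩
    -- Every test morphism `g` is itself a Q(z)-product, so the universal property of `P` can be
    -- applied to it.
    let Q : QzProduct 𝒱 z W₁ W₂ := ⟨U, toCompletion g, isQzIntertwining_toCompletion hz g⟩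
    have e := eη (ef (homOfIntertwining_apply hz P.isIntertwining _)) Q g rfl
    exact (existsUnique_congr e).1 (hP Q)
  · rintro ⟨h, f, hf, hu⟩ Q
    have e := eη (ef hf) Q (homOfIntertwining hz Q.isIntertwining h) rfl
    exact (existsUnique_congr e).2 ((isUniversal_iff f).1 hu _ _)
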